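/- **Structure categories and families.** Let $\mathfrak F$ be a small category. A *fibre functor* on $\mathfrak F$ is a functor $\phi\colon\mathfrak F\to\mathbf{Top}$ such that every space $\phi(V)$ is locally compact, second countable and Hausdorff. An *$(\mathfrak F,\phi)$-family* $X$ is a map $p\colon X\to\bar X$ together with, for each $b\in\bar X$, an object $X_b$ of $\mathfrak F$ and a homeomorphism (chart) $\Phi_b\colon p^{-1}(b)\approx\phi(X_b)$. An *$\mathfrak F$-map* $X\to Y$ is a pair of continuous maps $f\colon X\to Y$, $\bar f\colon\bar X\to\bar Y$ with $p_Yf=\bar fp_X$ which on each fibre is, in the charts, of the form $\phi(g)$ for a morphism $g\colon X_b\to Y_{\bar f(b)}$ of $\mathfrak F$. A family is an *$\mathfrak F$-bundle* if every $b\in\bar X$ has a neighbourhood $U$ such that $X|U$ is $\mathfrak F$-isomorphic to a product family $U\times\phi(V)\to U$. **Stratified bundles.** A *stratified space* is a space $\bar X$ with a filtration $\bar X_0\subset\bar X_1\subset\cdots$, $\bar X=\operatorname{colim}\bar X_i$, where $\bar X_0$ is a CW-space and, for $i\ge1$, $\bar X_i=\bar X_{i-1}\cup_{\bar h_i}\bar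 M_i$ is the push-out of a CW-pair $(\bar M_i,\bar A_i)$ along a map $\bar h_i\colon\bar A_i\to\bar X_{i-1}$. An *$(\mathfrak F,\phi)$-stratified bundle* over $\bar X$ is an $(\mathfrak F,\phi)$-family $X\to\bar X$ such that, with $X_i=X|\bar X_i$: $X_0$ is an $\mathfrak F$-bundle; $X=\operatorname{colim}X_i$; and for each $i\ge 1$ there are an $\mathfrak F$-bundle $M_i\to\bar M_i$ and an $\mathfrak F$-map $h_i\colon M_i|\bar A_i\to X_{i-1}$ over $\bar h_i$ such that $X_i=X_{i-1}\cup_{h_i}M_i$ is the push-out of families. **Function spaces and NKC.** Let $\phi$ be faithful with all $\phi(V)$ nonempty. Give $\operatorname{Hom}_{\mathfrak F}(V,W)$ the compact-open topology as a subset of the continuous maps $\phi(V)\to\phi(W)$. For an $(\mathfrak F,\phi)$-family $X$ let $X^V$ be the space of $\mathfrak F$-maps from the point family $\phi(V)\to *$ to $X$, with the compact-open topology, projecting to $\bar X$ by $a\mapsto p(a(v_0))$ for any $v_0\in\phi(V)$; its fibre over $b$ is $\operatorname{Hom}_{\mathfrak F}(V,X_b)$. For $K\subset \phi(V)$ write $N_{K,U}=\{a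 : a(K)\subset U\}$. The pair $(\mathfrak F,\phi)$ is *NKC* if for every $V$ there is a family $\mathcal K$ of compact subsets of $\phi(V)$ such that (i) for every $(\mathfrak F,\phi)$-family $Y$ the sets $N_{K,U}\subset Y^V$, $K\in\mathcal K$, $U\subset Y$ open, form a sub-basis of the topology of $Y^V$, and (ii) for all $K\in\mathcal K$, all $W$ and all compact $C\subset\phi(W)$ the subspace $N_{K,C}\subset\operatorname{Hom}_{\mathfrak F}(V,W)$ is compact. **Principal stratified bundle diagrams.** Replacing spaces by $\mathfrak F^{op}$-diagrams of spaces (over fixed base spaces) and $\phi$ by the functor $\operatorname{Hom}\colon W\mapsto\operatorname{Hom}_{\mathfrak F}(-,W)$ in the definitions of family, map, bundle and stratified bundle, one obtains the notion of an $(\mathfrak F,\operatorname{Hom})$-stratified bundle diagram, also called a *principal stratified bundle diagram*, $P\colon\mathfrak F^{op}\to\mathbf{Top}_{\bar X}$. In particular each $b\in\bar X$ has an object $P_b$ and a natural homeomorphism $\Phi_b\colon P(-)_b\approx\operatorname{Hom}_{\mathfrak F}(-,P_b)$. For a functor $\psi\colon\mathfrak F\to\mathbf{Top}$ the coend $P\otimes_{\mathfrak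 F}\psi$ is the quotient space of $\coprod_VP(V)\times\psi(V)$ by the relations $(P(\alpha)x,y)\sim(x,\psi(\alpha)y)$; it maps to $\bar X$. **Theorem.** Let $\mathfrak F$ be a small category with a faithful fibre functor $\phi$ all of whose values are nonempty. 1. Suppose $(\mathfrak F,\phi)$ is NKC, and let $X$ be an $(\mathfrak F,\phi)$-stratified bundle over a stratified space $\bar X$. Then each $W\mapsto\operatorname{Hom}_{\mathfrak F}(V,W)$ is again a fibre functor, and the diagram $X^\circ\colon V\mapsto X^V$ (with objects $X_b$ and the charts induced by those of $X$) is a principal stratified bundle diagram over the same stratified space $\bar X$. 2. Conversely, let $P$ be a principal stratified bundle diagram over a stratified space $\bar X$, and let $\psi$ be any fibre functor on $\mathfrak F$ (for instance $\psi=\phi$; not necessarily faithful) which is continuous, i.e. all maps $\operatorname{Hom}_{\mathfrak F}(V,W)\to\operatorname{Map}(\psi(V),\psi(W))$ are continuous for the compact-open topologies. Then $P\otimes_{\mathfrak F}\psi\to\bar X$, with objects $P_b$ and charts $[x,y]\mapsto\psi(\Phi_b(x))(y)$, is an $(\mathfrak F,\psi)$-stratified bundle over the same stratified space $\bar X$.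 3. In the situation of 1, $X^\circ\otimes_{\mathfrak F}\phi=X$: the evaluation $[a,y]\mapsto a(y)$ is a homeomorphism $X^\circ\otimes_{\mathfrak F}\phi\approx X$ and an isomorphism of $(\mathfrak F,\phi)$-families over the identity of $\bar X$. -/

import Mathlib

open CategoryTheory Topology Set

universe u

namespace StratBundle

/-! ### Structure categories, families and bundles -/

section Families

variable {F : Type u} [SmallCategory F]

/-- A fibre functor on the small category `F`: every space `φ V` is locally compact,
second countable and Hausdorff. The pair `(F, φ)` is then a structure category. -/
structure IsFibreFunctor (φ : F ⥤ TopCat.{u}) : Prop where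
  locallyCompact : ∀ V, LocallyCompactSpace (φ.obj V)
  secondCountable : ∀ V, SecondCountableTopology (φ.obj V)
  t2 : ∀ V, T2Space (φ.obj V)

/-- The fibre over `b ∈ U` of the restriction of `p : X → B` to `U` is the fibre of `p`. -/
def restrictFibre {X B : Type u} [TopologicalSpace X] [TopologicalSpace B] (p : C(X, B))
    (U : Set B) (b : U) :
    {x : (p ⁻¹' U : Set X) // (⟨p x.1, x.2⟩ : U) = b} ≃ₜ (p ⁻¹' {b.1} : Set X) where
  toFun x := ⟨x.1.1, congrArg Subtype.val x.2⟩
  invFun x := ⟨⟨x.1, by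
    have h : p x.1 = b.1 := x.2
    simp [h]⟩, Subtype.ext x.2⟩
  left_inv _ := rfl
  right_inv _ := rfl
  continuous_toFun := by fun_prop
  continuous_invFun := by fun_prop

/-- An `(F, φ)`-family with total space `X` and base space `B`: a projection, an object `fib b`
of `F` for every point `b` of the base, and a chart, i.e. a homeomorphism from the fibre over `b`
onto `φ (fib b)`. -/
structure Family (φ : F ⥤ TopCat.{u}) (X B : Type u) [TopologicalSpace X]
    [TopologicalSpace B] where
  proj : C(X, B)
  fib : B → F
  chart : ∀ b : B, (proj ⁻¹' {b} : Set X) ≃ₜ φ.obj (fib b)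

namespace Family

variable {φ : F ⥤ TopCat.{u}} {X B X' B' : Type u} [TopologicalSpace X] [TopologicalSpace B]
  [TopologicalSpace X'] [TopologicalSpace B']

/-- The inverse of the chart at `b`, as a map from `φ (fib b)` into the total space. -/
def incl (E : Family φ X B) (b : B) : C(φ.obj (E.fib b), X) :=
  ⟨fun y => ((E.chart b).symm y : X), by fun_prop⟩

theorem proj_incl (E : Family φ X B) (b : B) (y : φ.obj (E.fib b)) : E.proj (E.incl b y) = b :=
  ((E.chart b).symm y).2

theorem isEmbedding_incl (E : Family φ X B) (b : B) : IsEmbedding (E.incl b) :=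
  IsEmbedding.subtypeVal.comp (E.chart b).symm.isEmbedding

/-- `(f, fbar)` is an `F`-map: it commutes with the projections, and on every fibre it is,
in the charts, of the form `φ g` for a morphism `g` of `F`. -/
structure IsMap (E : Family φ X B) (E' : Family φ X' B') (f : C(X, X')) (fbar : C(B, B')) :
    Prop where
  comm : ∀ x, E'.proj (f x) = fbar (E.proj x)
  fibre : ∀ b, ∃ g : E.fib b ⟶ E'.fib (fbar b),
    ∀ y, f (E.incl b y) = E'.incl (fbar b) (φ.map g y)

/-- `(e, ebar)` is an `F`-isomorphism. -/
def IsIso (E : Family φ X B) (E' : Family φ X' B') (e : X ≃ₜ X') (ebar : B ≃ₜ B') : Prop :=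
  E.IsMap E' e ebar ∧ E'.IsMap E e.symm ebar.symm

/-- On the fibre over `b` the map `f` is an isomorphism of fibres: in the charts it is of the form
`φ g`, and the inverse of `φ g` is of the form `φ g'` too. -/
def IsFibreIso (E : Family φ X B) (E' : Family φ X' B') (f : C(X, X')) (fbar : C(B, B'))
    (b : B) : Prop :=
  ∃ (g : E.fib b ⟶ E'.fib (fbar b)) (g' : E'.fib (fbar b) ⟶ E.fib b),
    (∀ y, f (E.incl b y) = E'.incl (fbar b) (φ.map g y)) ∧
    φ.map g ≫ φ.map g' = 𝟙 _ ∧ φ.map g' ≫ φ.map g = 𝟙 _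

/-- The restriction of a family to a subspace `U` of the base. -/
def restrict (E : Family φ X B) (U : Set B) : Family φ (E.proj ⁻¹' U : Set X) U where
  proj := ⟨fun x => ⟨E.proj x.1, x.2⟩, by fun_prop⟩
  fib b := E.fib b
  chart b := (restrictFibre E.proj U b).trans (E.chart b)

end Family

/-- The product family `B × φ V → B`. -/
def productFamily (φ : F ⥤ TopCat.{u}) (V : F) (B : Type u) [TopologicalSpace B] :
    Family φ (B × φ.obj V) B where
  proj := ⟨Prod.fst, continuous_fst⟩
  fib _ := V
  chart b :=
    { toFun := fun x => x.1.2
      invFun := fun y => ⟨(b, y), rfl⟩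
      left_inv := by
        rintro ⟨⟨b', y⟩, h⟩
        obtain rfl : b' = b := h
        rfl
      right_inv := fun _ => rfl
      continuous_toFun := by fun_prop
      continuous_invFun := by fun_prop }

/-- The point family `φ V → *`. -/
def pointFamily (φ : F ⥤ TopCat.{u}) (V : F) : Family φ (φ.obj V) PUnit.{u + 1} where
  proj := ⟨fun _ => PUnit.unit, continuous_const⟩
  fib _ := V
  chart _ :=
    { toFun := fun x => x.1
      invFun := fun y => ⟨y, rfl⟩
      left_inv := fun _ => rfl
      right_inv := fun _ => rfl
      continuous_toFun := by fun_prop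
      continuous_invFun := by fun_prop }

/-- An `F`-bundle: every point of the base has a neighbourhood over which the family is
`F`-isomorphic to a product family. -/
def Family.IsBundle {φ : F ⥤ TopCat.{u}} {X B : Type u} [TopologicalSpace X]
    [TopologicalSpace B] (E : Family φ X B) : Prop :=
  ∀ b : B, ∃ U ∈ 𝓝 b, ∃ (V : F) (e : (E.proj ⁻¹' U : Set X) ≃ₜ U × φ.obj V),
    (E.restrict U).IsIso (productFamily φ V U) e (Homeomorph.refl U)

end Families

/-! ### Stratified spaces and stratified bundles -/

/-- `M` is a CW-space, i.e. homeomorphic to a CW-complex (equivalently, a CW-complex structure can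
be put on `M` itself). -/
def IsCWSpace (M : Type u) [TopologicalSpace M] : Prop :=
  T2Space M ∧ Nonempty (CWComplex (univ : Set M))

/-- `(M, A)` is a CW-pair, i.e. homeomorphic to a pair formed by a CW-complex and a
subcomplex. -/
def IsCWPair (M : Type u) [TopologicalSpace M] (A : Set M) : Prop :=
  T2Space M ∧ ∃ (_ : CWComplex (univ : Set M)) (K : CWComplex.Subcomplex (univ : Set M)),
    (K : Set M) = A

/-- The inclusion of a subspace. -/
def valMap {M : Type u} [TopologicalSpace M] (A : Set M) : C(A, M) :=
  ⟨Subtype.val, continuous_subtype_val⟩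

/-- A stratification of the space `B`: a filtration `skel 0 ⊆ skel 1 ⊆ ⋯` with colimit `B`, such
that `skel 0` is a CW-space and `skel (i + 1)` is obtained from `skel i` by attaching `M i` along a
map `attach i : A i → skel i`, where `(M i, A i)` is a CW-pair. -/
structure StratifiedSpace (B : Type u) [TopologicalSpace B] where
  skel : ℕ → Set B
  skel_subset : ∀ i, skel i ⊆ skel (i + 1)
  iUnion_skel : ⋃ i, skel i = univ
  coherent : IsCoherentWith (range skel)
  cw_zero : IsCWSpace (skel 0)
  M : ℕ → TopCat.{u}
  A : ∀ i, Set (M i)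
  cwPair : ∀ i, IsCWPair (M i) (A i)
  attach : ∀ i, C(A i, skel i)
  char : ∀ i, C(M i, skel (i + 1))
  isPushout : ∀ i, IsPushout (TopCat.ofHom (valMap (A i))) (TopCat.ofHom (attach i))
    (TopCat.ofHom (char i)) (TopCat.ofHom (ContinuousMap.inclusion (skel_subset i)))

section Families

variable {F : Type u} [SmallCategory F]

/-- The family `E` over the stratified space `B` is an `F`-stratified bundle: it is an `F`-bundle
over `skel 0`, its total space is the colimit of the parts over the `skel i`, and the part over
`skel (i + 1)` is the push-out, in the category of families, of an `F`-bundle `N` over `M i` along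
an `F`-map `h`, covering `attach i`, from the restriction of `N` to `A i` into the part over
`skel i`. The push-out of families along a closed inclusion is the push-out of the total and base
spaces, with the charts of `N` at the points coming from `M i \ A i`; this is why `Φ` is required
to be an isomorphism on the fibres over these points. -/
def Family.IsStratifiedBundle {φ : F ⥤ TopCat.{u}} {X B : Type u} [TopologicalSpace X]
    [TopologicalSpace B] (S : StratifiedSpace B) (E : Family φ X B) : Prop :=
  (E.restrict (S.skel 0)).IsBundle ∧
  IsCoherentWith (range fun i => E.proj ⁻¹' S.skel i) ∧
  ∀ i, ∃ (T : TopCat.{u}) (N : Family φ T (S.M i))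
    (h : C((N.proj ⁻¹' S.A i : Set T), (E.proj ⁻¹' S.skel i : Set X)))
    (Φ : C(T, (E.proj ⁻¹' S.skel (i + 1) : Set X))),
    N.IsBundle ∧
    (N.restrict (S.A i)).IsMap (E.restrict (S.skel i)) h (S.attach i) ∧
    N.IsMap (E.restrict (S.skel (i + 1))) Φ (S.char i) ∧
    IsPushout (TopCat.ofHom (valMap (N.proj ⁻¹' S.A i))) (TopCat.ofHom h) (TopCat.ofHom Φ)
      (TopCat.ofHom (ContinuousMap.inclusion (preimage_mono (S.skel_subset i)))) ∧
    ∀ m ∉ S.A i, N.IsFibreIso (E.restrict (S.skel (i + 1))) Φ (S.char i) m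

/-! ### Function spaces and the NKC property -/

/-- The set of morphisms `Hom(V, W)`, to be topologized by means of `φ`. -/
@[ext]
structure HomSpace (φ : F ⥤ TopCat.{u}) (V W : F) : Type u where
  hom : V ⟶ W

/-- The compact-open topology on `Hom(V, W)`, for a faithful functor `φ`. -/
instance (φ : F ⥤ TopCat.{u}) (V W : F) : TopologicalSpace (HomSpace φ V W) :=
  TopologicalSpace.induced (fun g => ((φ.map g.hom).hom : C(φ.obj V, φ.obj W)))
    ContinuousMap.compactOpen

theorem continuous_hom_map (φ : F ⥤ TopCat.{u}) (V W : F) :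
    Continuous (fun g : HomSpace φ V W => ((φ.map g.hom).hom : C(φ.obj V, φ.obj W))) :=
  continuous_induced_dom

/-- Composition with `α : W ⟶ W'`, as a map `Hom(V, W) → Hom(V, W')`. -/
def HomSpace.postcomp (φ : F ⥤ TopCat.{u}) (V : F) {W W' : F} (α : W ⟶ W') :
    C(HomSpace φ V W, HomSpace φ V W') where
  toFun g := ⟨g.hom ≫ α⟩
  continuous_toFun := by
    refine continuous_induced_rng.2 ?_
    have h := (ContinuousMap.continuous_postcomp (φ.map α).hom).comp (continuous_hom_map φ V W)
    refine h.congr fun g => ?_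
    ext y
    simp

/-- Composition with `α : V' ⟶ V`, as a map `Hom(V, W) → Hom(V', W)`. -/
def HomSpace.precomp (φ : F ⥤ TopCat.{u}) (W : F) {V V' : F} (α : V' ⟶ V) :
    C(HomSpace φ V W, HomSpace φ V' W) where
  toFun g := ⟨α ≫ g.hom⟩
  continuous_toFun := by
    refine continuous_induced_rng.2 ?_
    have h := (ContinuousMap.continuous_precomp (φ.map α).hom).comp (continuous_hom_map φ V W)
    refine h.congr fun g => ?_
    ext y
    simp

/-- The functor `φ^V : W ↦ Hom(V, W)`. -/
def homFunctor (φ : F ⥤ TopCat.{u}) (V : F) : F ⥤ TopCat.{u} where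
  obj W := TopCat.of (HomSpace φ V W)
  map α := TopCat.ofHom (HomSpace.postcomp φ V α)
  map_id W := by
    ext g
    exact Category.comp_id g.hom
  map_comp α β := by
    ext g
    exact (Category.assoc g.hom α β).symm

/-- The function space `E^V` of all `F`-maps from the point family of `V` to `E`, with the
compact-open topology (as a subspace of `C(φ V, X)`). -/
abbrev Family.MapSpace {φ : F ⥤ TopCat.{u}} {X B : Type u} [TopologicalSpace X]
    [TopologicalSpace B] (E : Family φ X B) (V : F) : Type u :=
  {a : C(φ.obj V, X) // ∃ abar : C(PUnit.{u + 1}, B), (pointFamily φ V).IsMap E a abar}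

/-- A family `𝒦` of compact subsets of `φ V` is generating if for every `F`-family `E` the sets
`N_{K,U}`, with `K ∈ 𝒦` and `U` open, form a sub-basis of the topology of `E^V`. -/
def IsGenerating (φ : F ⥤ TopCat.{u}) (V : F) (𝒦 : Set (Set (φ.obj V))) : Prop :=
  (∀ K ∈ 𝒦, IsCompact K) ∧
  ∀ (X B : Type u) [TopologicalSpace X] [TopologicalSpace B] (E : Family φ X B),
    (inferInstance : TopologicalSpace (E.MapSpace V)) = TopologicalSpace.generateFrom
      {N | ∃ K ∈ 𝒦, ∃ U : Set X, IsOpen U ∧ N = {a : E.MapSpace V | MapsTo a.1 K U}}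

/-- The NKC property. -/
def IsNKC (φ : F ⥤ TopCat.{u}) : Prop :=
  ∀ V : F, ∃ 𝒦 : Set (Set (φ.obj V)), IsGenerating φ V 𝒦 ∧
    ∀ K ∈ 𝒦, ∀ (W : F) (C : Set (φ.obj W)), IsCompact C →
      IsCompact {g : HomSpace φ V W | MapsTo (φ.map g.hom) K C}

/-! ### Diagrams: families, bundles and stratified bundles with fibre functor `Hom` -/

/-- A family in the category of `Fᵒᵖ`-diagrams of spaces with fibre functor
`Hom : W ↦ Hom(-, W)`, with total diagram `P` and base space `B`: a projection making `P` a
diagram of spaces over `B`, an object `fib b` for every `b`, and an isomorphism of diagrams from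
the fibre over `b` onto `Hom(-, fib b)`. -/
structure DiagFamily (φ : F ⥤ TopCat.{u}) (P : Fᵒᵖ ⥤ TopCat.{u}) (B : Type u)
    [TopologicalSpace B] where
  proj : ∀ V : F, C(P.obj (.op V), B)
  proj_map : ∀ {V W : F} (α : V ⟶ W) (x : P.obj (.op W)), proj V (P.map α.op x) = proj W x
  fib : B → F
  chart : ∀ (b : B) (V : F), (proj V ⁻¹' {b} : Set (P.obj (.op V))) ≃ₜ HomSpace φ V (fib b)
  chart_map : ∀ (b : B) {V W : F} (α : V ⟶ W) (x : (proj W ⁻¹' {b} : Set (P.obj (.op W)))),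
    chart b V ⟨P.map α.op x.1, (proj_map α x.1).trans x.2⟩ = ⟨α ≫ (chart b W x).hom⟩

namespace DiagFamily

variable {φ : F ⥤ TopCat.{u}} {P P' : Fᵒᵖ ⥤ TopCat.{u}} {B B' : Type u} [TopologicalSpace B]
  [TopologicalSpace B']

/-- The inverse of the chart at `b`. -/
def incl (E : DiagFamily φ P B) (b : B) (V : F) (g : V ⟶ E.fib b) : P.obj (.op V) :=
  ((E.chart b V).symm ⟨g⟩).1

/-- A map of diagram families: a map of diagrams covering `fbar`, given in the charts of every fibre
by composition with a morphism of `F`. -/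
structure IsMap (E : DiagFamily φ P B) (E' : DiagFamily φ P' B') (f : P ⟶ P')
    (fbar : C(B, B')) : Prop where
  comm : ∀ (V : F) (x : P.obj (.op V)), E'.proj V (f.app (.op V) x) = fbar (E.proj V x)
  fibre : ∀ b, ∃ g : E.fib b ⟶ E'.fib (fbar b), ∀ (V : F) (y : V ⟶ E.fib b),
    f.app (.op V) (E.incl b V y) = E'.incl (fbar b) V (y ≫ g)

/-- Isomorphisms of diagram families. -/
def IsIso (E : DiagFamily φ P B) (E' : DiagFamily φ P' B') (e : P ≅ P') (ebar : B ≃ₜ B') : Prop :=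
  E.IsMap E' e.hom ebar ∧ E'.IsMap E e.inv ebar.symm

/-- On the fibre over `b` the map `f` is given by an isomorphism of `F`. -/
def IsFibreIso (E : DiagFamily φ P B) (E' : DiagFamily φ P' B') (f : P ⟶ P') (fbar : C(B, B'))
    (b : B) : Prop :=
  ∃ g : E.fib b ≅ E'.fib (fbar b), ∀ (V : F) (y : V ⟶ E.fib b),
    f.app (.op V) (E.incl b V y) = E'.incl (fbar b) V (y ≫ g.hom)

/-- The part of the diagram lying over `U`. -/
abbrev part (E : DiagFamily φ P B) (U : Set B) : Fᵒᵖ ⥤ TopCat.{u} where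
  obj V := TopCat.of (E.proj V.unop ⁻¹' U : Set (P.obj V))
  map {V W} α := TopCat.ofHom ⟨fun x => ⟨P.map α x.1, by
      have h := E.proj_map α.unop x.1
      have hx : E.proj V.unop x.1 ∈ U := x.2
      change E.proj W.unop (P.map α x.1) ∈ U
      rw [← h] at hx
      exact hx⟩, by fun_prop⟩
  map_id V := by
    ext x
    exact ConcreteCategory.congr_hom (P.map_id V) x.1
  map_comp α β := by
    ext x
    exact ConcreteCategory.congr_hom (P.map_comp α β) x.1

/-- The inclusion of the part over `U` into the part over `U'`, at the object `V`. -/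
def partIncl (E : DiagFamily φ P B) {U U' : Set B} (h : U ⊆ U') (V : F) :
    (E.part U).obj (.op V) ⟶ (E.part U').obj (.op V) :=
  TopCat.ofHom (ContinuousMap.inclusion (preimage_mono h))

/-- The inclusion of the part over `U` into the whole diagram, at the object `V`. -/
def partVal (E : DiagFamily φ P B) (U : Set B) (V : F) :
    (E.part U).obj (.op V) ⟶ P.obj (.op V) :=
  TopCat.ofHom (valMap (E.proj V ⁻¹' U))

/-- The restriction of a diagram family to a subspace of the base. -/
def restrict (E : DiagFamily φ P B) (U : Set B) : DiagFamily φ (E.part U) U where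
  proj V := ⟨fun x => ⟨E.proj V x.1, x.2⟩, by fun_prop⟩
  proj_map α x := Subtype.ext (E.proj_map α x.1)
  fib b := E.fib b
  chart b V := (restrictFibre (E.proj V) U b).trans (E.chart b V)
  chart_map b _ _ α x := E.chart_map b α ⟨x.1.1, congrArg Subtype.val x.2⟩

end DiagFamily

/-- The product diagram `V ↦ B × Hom(V, W)`. -/
abbrev productDiag (φ : F ⥤ TopCat.{u}) (W : F) (B : Type u) [TopologicalSpace B] :
    Fᵒᵖ ⥤ TopCat.{u} where
  obj V := TopCat.of (B × HomSpace φ V.unop W)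
  map α := TopCat.ofHom ((ContinuousMap.id B).prodMap (HomSpace.precomp φ W α.unop))
  map_id V := by
    apply TopCat.ext
    rintro ⟨b, g⟩
    exact Prod.ext rfl (HomSpace.ext (Category.id_comp g.hom))
  map_comp α β := by
    apply TopCat.ext
    rintro ⟨b, g⟩
    exact Prod.ext rfl (HomSpace.ext (Category.assoc β.unop α.unop g.hom))

/-- The product diagram family with fibre `Hom(-, W)`. -/
def productDiagFamily (φ : F ⥤ TopCat.{u}) (W : F) (B : Type u) [TopologicalSpace B] :
    DiagFamily φ (productDiag φ W B) B where
  proj V := (ContinuousMap.fst : C(B × HomSpace φ V W, B))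
  proj_map _ _ := rfl
  fib _ := W
  chart b V :=
    { toFun := fun x => (x.1 : B × HomSpace φ V W).2
      invFun := fun y => ⟨((b, y) : B × HomSpace φ V W), rfl⟩
      left_inv := by
        rintro ⟨⟨b', y⟩, h⟩
        obtain rfl : b' = b := h
        rfl
      right_inv := fun _ => rfl
      continuous_toFun := continuous_snd.comp continuous_subtype_val
      continuous_invFun := by
        refine Continuous.subtype_mk ?_ _
        exact continuous_const.prodMk continuous_id }
  chart_map _ _ _ _ _ := rfl

namespace DiagFamily

variable {φ : F ⥤ TopCat.{u}} {P : Fᵒᵖ ⥤ TopCat.{u}} {B : Type u} [TopologicalSpace B]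

/-- An `(F, Hom)`-bundle diagram: locally isomorphic to a product diagram. -/
def IsBundle (E : DiagFamily φ P B) : Prop :=
  ∀ b : B, ∃ U ∈ 𝓝 b, ∃ (W : F) (e : E.part U ≅ productDiag φ W U),
    (E.restrict U).IsIso (productDiagFamily φ W U) e (Homeomorph.refl U)

/-- A principal stratified bundle diagram, i.e. an `(F, Hom)`-stratified bundle diagram over the
stratified space `B`: the definition of a stratified bundle with spaces replaced by diagrams of
spaces (colimits of diagrams are computed objectwise). -/
def IsPrincipalStratifiedBundle (S : StratifiedSpace B) (E : DiagFamily φ P B) : Prop :=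
  (E.restrict (S.skel 0)).IsBundle ∧
  (∀ V : F, IsCoherentWith (range fun i => E.proj V ⁻¹' S.skel i)) ∧
  ∀ i, ∃ (Q : Fᵒᵖ ⥤ TopCat.{u}) (N : DiagFamily φ Q (S.M i))
    (h : N.part (S.A i) ⟶ E.part (S.skel i)) (Φ : Q ⟶ E.part (S.skel (i + 1))),
    N.IsBundle ∧
    (N.restrict (S.A i)).IsMap (E.restrict (S.skel i)) h (S.attach i) ∧
    N.IsMap (E.restrict (S.skel (i + 1))) Φ (S.char i) ∧
    (∀ V : F, IsPushout (N.partVal (S.A i) V) (h.app (.op V)) (Φ.app (.op V))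
      (E.partIncl (S.skel_subset i) V)) ∧
    ∀ m ∉ S.A i, N.IsFibreIso (E.restrict (S.skel (i + 1))) Φ (S.char i) m

end DiagFamily

/-! ### The associated diagram `V ↦ E^V` -/

namespace Family

variable {φ : F ⥤ TopCat.{u}} {X B : Type u} [TopologicalSpace X] [TopologicalSpace B]

theorem mapSpace_iff (E : Family φ X B) {V : F} (a : C(φ.obj V, X)) :
    (∃ abar : C(PUnit.{u + 1}, B), (pointFamily φ V).IsMap E a abar) ↔
      ∃ (b : B) (g : V ⟶ E.fib b), ∀ y, a y = E.incl b (φ.map g y) := by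
  constructor
  · rintro ⟨abar, h⟩
    obtain ⟨g, hg⟩ := h.fibre PUnit.unit
    exact ⟨abar PUnit.unit, g, hg⟩
  · rintro ⟨b, g, hg⟩
    refine ⟨⟨fun _ => b, continuous_const⟩, ⟨fun x => ?_, fun _ => ⟨g, hg⟩⟩⟩
    change E.proj (a x) = b
    rw [hg, E.proj_incl]

theorem mapSpace_precomp (E : Family φ X B) {V W : F} (α : V ⟶ W) (a : E.MapSpace W) :
    ∃ abar : C(PUnit.{u + 1}, B), (pointFamily φ V).IsMap E (a.1.comp (φ.map α).hom) abar := by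
  obtain ⟨b, g, hg⟩ := (E.mapSpace_iff a.1).1 a.2
  exact (E.mapSpace_iff _).2 ⟨b, α ≫ g, fun y => by simp [hg]⟩

/-- The map `E^W → E^V` induced by a morphism `α : V ⟶ W`. -/
def mapSpacePrecomp (E : Family φ X B) {V W : F} (α : V ⟶ W) : C(E.MapSpace W, E.MapSpace V) where
  toFun a := ⟨a.1.comp (φ.map α).hom, E.mapSpace_precomp α a⟩
  continuous_toFun := Continuous.subtype_mk
    ((ContinuousMap.continuous_precomp _).comp continuous_subtype_val) _

/-- The diagram `V ↦ E^V`. -/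
abbrev assocDiag (E : Family φ X B) : Fᵒᵖ ⥤ TopCat.{u} where
  obj V := TopCat.of (E.MapSpace V.unop)
  map α := TopCat.ofHom (E.mapSpacePrecomp α.unop)
  map_id V := by
    ext a y
    change a.1 ((φ.map (𝟙 V.unop)) y) = a.1 y
    simp
  map_comp α β := by
    ext a y
    change a.1 ((φ.map (β.unop ≫ α.unop)) y) = a.1 (φ.map α.unop (φ.map β.unop y))
    simp

variable [∀ V : F, Nonempty (φ.obj V)]

/-- The projection `E^V → B`, `a ↦ p (a v₀)`, where `v₀` is any point of `φ V`. -/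
noncomputable def mapSpaceProj (E : Family φ X B) (V : F) : C(E.MapSpace V, B) where
  toFun a := E.proj (a.1 (Classical.arbitrary (φ.obj V)))
  continuous_toFun := E.proj.continuous.comp
    ((continuous_eval_const _).comp continuous_subtype_val)

theorem mapSpaceProj_eq (E : Family φ X B) {V : F} (a : E.MapSpace V) (y : φ.obj V) :
    E.proj (a.1 y) = E.mapSpaceProj V a := by
  obtain ⟨b, g, hg⟩ := (E.mapSpace_iff a.1).1 a.2
  change _ = E.proj (a.1 _)
  rw [hg, hg, E.proj_incl, E.proj_incl]

/-- The homeomorphism of `Hom(V, fib b)` onto the fibre of `E^V` over `b`, which sends `g` to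
the composite of `φ g` and the inverse of the chart at `b`. -/
noncomputable def homFibre [φ.Faithful] (E : Family φ X B) (b : B) (V : F) :
    HomSpace φ V (E.fib b) ≃ₜ (E.mapSpaceProj V ⁻¹' {b} : Set (E.MapSpace V)) := by
  let j : HomSpace φ V (E.fib b) → (E.mapSpaceProj V ⁻¹' {b} : Set (E.MapSpace V)) := fun g =>
    ⟨⟨(E.incl b).comp (φ.map g.hom).hom, (E.mapSpace_iff _).2 ⟨b, g.hom, fun _ => rfl⟩⟩,
      E.proj_incl b _⟩
  have hj : Function.Bijective j := by
    constructor
    · intro g g' h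
      refine HomSpace.ext (φ.map_injective ?_)
      ext y
      have h1 : E.incl b (φ.map g.hom y) = E.incl b (φ.map g'.hom y) :=
        congrArg (fun a => a.1.1 y) h
      exact (E.isEmbedding_incl b).injective h1
    · rintro ⟨a, ha⟩
      obtain ⟨b', g, hg⟩ := (E.mapSpace_iff a.1).1 a.2
      obtain rfl : b' = b := by
        have h2 := E.mapSpaceProj_eq a (Classical.arbitrary _)
        rw [hg, E.proj_incl] at h2
        exact h2.trans ha
      refine ⟨⟨g⟩, Subtype.ext (Subtype.ext ?_)⟩
      ext y
      exact (hg y).symm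
  refine (Equiv.ofBijective j hj).toHomeomorphOfIsInducing ?_
  have h3 : IsInducing (fun g : HomSpace φ V (E.fib b) =>
      (E.incl b).comp ((φ.map g.hom).hom : C(φ.obj V, φ.obj (E.fib b)))) :=
    (ContinuousMap.isInducing_postcomp _ (E.isEmbedding_incl b).isInducing).comp ⟨rfl⟩
  have h4 : IsInducing (fun a : (E.mapSpaceProj V ⁻¹' {b} : Set (E.MapSpace V)) => a.1.1) :=
    IsInducing.subtypeVal.comp IsInducing.subtypeVal
  exact h4.of_comp_iff.1 h3

theorem mapSpaceProj_precomp (E : Family φ X B) {V W : F} (α : V ⟶ W) (a : E.MapSpace W) :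
    E.mapSpaceProj V (E.mapSpacePrecomp α a) = E.mapSpaceProj W a := by
  rw [← E.mapSpaceProj_eq a (φ.map α (Classical.arbitrary _)),
    ← E.mapSpaceProj_eq _ (Classical.arbitrary _)]
  rfl

theorem homFibre_symm_precomp [φ.Faithful] (E : Family φ X B) (b : B) {V W : F} (α : V ⟶ W)
    (x : (E.mapSpaceProj W ⁻¹' {b} : Set (E.MapSpace W))) :
    (E.homFibre b V).symm
      ⟨E.mapSpacePrecomp α x.1, (E.mapSpaceProj_precomp α x.1).trans x.2⟩ =
      ⟨α ≫ ((E.homFibre b W).symm x).hom⟩ := by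
  obtain ⟨g, rfl⟩ := (E.homFibre b W).surjective x
  rw [Homeomorph.symm_apply_eq, Homeomorph.symm_apply_apply]
  refine Subtype.ext (Subtype.ext ?_)
  ext y
  change E.incl b (φ.map g.hom (φ.map α y)) = E.incl b (φ.map (α ≫ g.hom) y)
  simp

/-- The associated diagram `V ↦ E^V`, as a diagram family with fibre functor `Hom`. -/
noncomputable def assoc [φ.Faithful] (E : Family φ X B) : DiagFamily φ E.assocDiag B where
  proj V := E.mapSpaceProj V
  proj_map α a := E.mapSpaceProj_precomp α a
  fib := E.fib
  chart b V := (E.homFibre b V).symm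
  chart_map b _ _ α x := E.homFibre_symm_precomp b α x

end Family

/-! ### The coend -/

/-- The relation `(P(α) x, y) ∼ (x, ψ(α) y)` on the disjoint union of the `P V × ψ V`. -/
inductive CoendRel (P : Fᵒᵖ ⥤ TopCat.{u}) (ψ : F ⥤ TopCat.{u}) :
    (Σ V : F, P.obj (.op V) × ψ.obj V) → (Σ V : F, P.obj (.op V) × ψ.obj V) → Prop
  | rel {V W : F} (α : V ⟶ W) (x : P.obj (.op W)) (y : ψ.obj V) :
      CoendRel P ψ ⟨V, (P.map α.op x, y)⟩ ⟨W, (x, ψ.map α y)⟩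

/-- The coend of `P` and `ψ`, with the quotient topology of the disjoint union. -/
def Coend (P : Fᵒᵖ ⥤ TopCat.{u}) (ψ : F ⥤ TopCat.{u}) : Type u := Quot (CoendRel P ψ)

instance (P : Fᵒᵖ ⥤ TopCat.{u}) (ψ : F ⥤ TopCat.{u}) : TopologicalSpace (Coend P ψ) :=
  inferInstanceAs (TopologicalSpace (Quot (CoendRel P ψ)))

/-- The class of `(x, y)`. -/
def Coend.mk {P : Fᵒᵖ ⥤ TopCat.{u}} {ψ : F ⥤ TopCat.{u}} {V : F} (x : P.obj (.op V))
    (y : ψ.obj V) : Coend P ψ :=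
  Quot.mk _ ⟨V, (x, y)⟩

namespace DiagFamily

variable {φ : F ⥤ TopCat.{u}} {P : Fᵒᵖ ⥤ TopCat.{u}} {B : Type u} [TopologicalSpace B]

/-- The projection of the coend onto the base space, `[x, y] ↦ p x`. -/
def coendProj (E : DiagFamily φ P B) (ψ : F ⥤ TopCat.{u}) : C(Coend P ψ, B) where
  toFun := Quot.lift (fun z => E.proj z.1 z.2.1) (by
    rintro _ _ ⟨α, x, y⟩
    exact E.proj_map α x)
  continuous_toFun := by
    refine continuous_quot_lift _ (continuous_sigma fun V => ?_)
    exact (E.proj V).continuous.comp continuous_fst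

/-- The charts of the coend are the maps `[x, y] ↦ ψ (Φ_b x) y`, where `Φ_b` is the chart of `P`
at `b`. -/
def IsCoendChart (E : DiagFamily φ P B) (ψ : F ⥤ TopCat.{u})
    (chart : ∀ b : B, (E.coendProj ψ ⁻¹' {b} : Set (Coend P ψ)) ≃ₜ ψ.obj (E.fib b)) : Prop :=
  ∀ (b : B) (V : F) (x : (E.proj V ⁻¹' {b} : Set (P.obj (.op V)))) (y : ψ.obj V),
    chart b ⟨Coend.mk x.1 y, x.2⟩ = ψ.map (E.chart b V x).hom y

/-- The coend as an `(F, ψ)`-family over `B`, given the charts. -/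
def coendFamily (E : DiagFamily φ P B) (ψ : F ⥤ TopCat.{u})
    (chart : ∀ b : B, (E.coendProj ψ ⁻¹' {b} : Set (Coend P ψ)) ≃ₜ ψ.obj (E.fib b)) :
    Family ψ (Coend P ψ) B where
  proj := E.coendProj ψ
  fib := E.fib
  chart := chart

end DiagFamily

end Families

end StratBundle

open StratBundle

/-! An `F`-map out of `φ V` lies over a single point of the base. As sets, therefore, `X ↦ X^V` and
`P ↦ P ⊗ ψ` respect the colimits and push-outs that define a stratified bundle, and the whole
difficulty lies in the topologies.

For function spaces the claim is that a set `s` of `F`-maps is closed in `X^V` once its preimages in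
the function spaces of `X_0` and of all attached bundles `M_i` are closed
(`IsStratifiedBundle.isClosed_mapSpace`). Let `a ∉ s` lie over `b`. The fibre of `X^V` over `b` is
`Hom(V, X_b)`, which lifts continuously to one of the pieces, so `s` is closed in this fibre. The
sub-basis of NKC (i) then yields finitely many compact `K_i ⊆ φ V` such that no member of `s` maps
every `K_i` into `a(K_i)` (`exists_avoids_of_isNKC`). If the compact sets `a(K_i)` can be thickened
to open sets `U_i` with the same avoidance property, the intersection of the sets `N_{K_i,U_i}` is a
neighbourhood of `a` that misses `s`.

The `U_i` are built stratum by stratum (`IsPartialNhd.exists_succ`) and, inside a stratum, cell by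
cell (`IsBundle.exists_extension_of_isCWPair`). Over one closed cell the total space is locally
compact, Hausdorff and second countable, so the relatively open sets already chosen over the
boundary can be exhausted by compact sets and thickened step by step (`exists_open_extension`). A
single thickening from compact to open sets is `Avoids.exists_isOpen`. It works because NKC (ii),
globalized in `IsBundle.isCompact_setOf_mapsTo`, makes the set of relevant `F`-maps compact.

For coends the tool is that a product with the locally compact space `ψ V` preserves quotient
topologies (`isClosed_prod_of_jointly`), so the coend inherits colimits and push-outs from `P`. A
trivialization of `P` over `U` induces one of the coend, with fibre `ψ W`, by continuity of `ψ`.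

Evaluation `X° ⊗ φ → X` is bijective because on each fibre both sides are `φ (X_b)`. Its inverse is
continuous because over a trivialization `k` it is `(u, y) ↦ [k(u, ·), y]`, and the topology of `X`
is detected on bundles. -/

/-! ### Attaching spaces -/

namespace StratBundle

/-- `Z` is obtained from `Y` by attaching `M` along `f : A → Y`: a point-set description of
push-outs of spaces along the inclusion of a subspace `A`. -/
structure IsAttaching {M Y Z : Type*} [TopologicalSpace M] [TopologicalSpace Y]
    [TopologicalSpace Z] (A : Set M) (f : A → Y) (g : M → Z) (j : Y → Z) : Prop where
  comm : ∀ a : A, g a = j (f a)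
  injOn : InjOn g Aᶜ
  notMem : ∀ m ∉ A, g m ∉ range j
  surj : ∀ z, z ∈ range j ∨ ∃ m ∉ A, g m = z
  isClosed : ∀ s : Set Z, IsClosed (g ⁻¹' s) → IsClosed (j ⁻¹' s) → IsClosed s

/-- The map `M ⊕ Y → Z` is a quotient map, so a cocone descends once it is constant on its fibres.
Distinct points with the same image are linked through points of `A`, by `comm` and the injectivity
of `j`. -/
theorem IsAttaching.isPushout {M Y Z : TopCat.{u}} {A : Set M} {f : C(A, Y)} {g : C(M, Z)}
    {j : C(Y, Z)} (hj : Function.Injective j) (h : IsAttaching A f g j) :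
    IsPushout (TopCat.ofHom (valMap A)) (TopCat.ofHom f) (TopCat.ofHom g) (TopCat.ofHom j) := by
  have hw : TopCat.ofHom (valMap A) ≫ TopCat.ofHom g = TopCat.ofHom f ≫ TopCat.ofHom j := by
    ext a
    exact h.comm a
  let q : C(M ⊕ Y, Z) := ⟨Sum.elim g j, by fun_prop⟩
  have hq : IsQuotientMap q := by
    refine isQuotientMap_iff_isClosed.2 ⟨?_, fun s => ⟨fun hs => hs.preimage q.continuous, ?_⟩⟩
    · intro z
      rcases h.surj z with ⟨y, hy⟩ | ⟨m, -, hm⟩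
      · exact ⟨Sum.inr y, hy⟩
      · exact ⟨Sum.inl m, hm⟩
    · intro hs
      rw [isClosed_sum_iff] at hs
      exact h.isClosed s hs.1 hs.2
  have hdesc : ∀ (s : Limits.PushoutCocone (TopCat.ofHom (valMap A)) (TopCat.ofHom f))
      (a b : M ⊕ Y), q a = q b → Sum.elim s.inl s.inr a = Sum.elim s.inl s.inr b := by
    intro s
    have key : ∀ (a : A), s.inl (a : M) = s.inr (f a) := fun a =>
      ConcreteCategory.congr_hom s.condition a
    have hMY : ∀ (m : M) (y : Y), g m = j y → s.inl m = s.inr y := by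
      intro m y hmy
      by_cases hm : m ∈ A
      · have h1 := h.comm ⟨m, hm⟩
        have h2 : f ⟨m, hm⟩ = y := hj (h1.symm.trans hmy)
        rw [← h2]
        exact key ⟨m, hm⟩
      · exact absurd ⟨y, hmy.symm⟩ (h.notMem m hm)
    rintro (m | y) (m' | y') hab
    · change s.inl m = s.inl m'
      have hab : g m = g m' := hab
      by_cases hm' : m' ∈ A
      · rw [hMY m (f ⟨m', hm'⟩) (hab.trans (h.comm ⟨m', hm'⟩))]
        exact (key ⟨m', hm'⟩).symm
      · by_cases hm : m ∈ A
        · rw [hMY m' (f ⟨m, hm⟩) (hab.symm.trans (h.comm ⟨m, hm⟩))]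
          exact key ⟨m, hm⟩
        · rw [h.injOn hm hm' hab]
    · exact hMY m y' hab
    · exact (hMY m' y hab.symm).symm
    · have hab : j y = j y' := hab
      rw [hj hab]
  refine ⟨⟨hw⟩, ⟨Limits.PushoutCocone.IsColimit.mk hw (fun s => TopCat.ofHom
    (hq.lift ⟨Sum.elim s.inl s.inr, by fun_prop⟩ (hdesc s))) ?_ ?_ ?_⟩⟩
  · intro s
    ext m
    exact congrArg (fun k : C(M ⊕ Y, s.pt) => k (Sum.inl m)) (hq.lift_comp _ _)
  · intro s
    ext y
    exact congrArg (fun k : C(M ⊕ Y, s.pt) => k (Sum.inr y)) (hq.lift_comp _ _)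
  · intro s m h1 h2
    ext z
    obtain ⟨x, rfl⟩ := hq.surjective z
    have h3 := hq.lift_comp (⟨Sum.elim s.inl s.inr, by fun_prop⟩ : C(M ⊕ Y, s.pt)) (hdesc s)
    refine Eq.trans ?_ (congrArg (fun k : C(M ⊕ Y, s.pt) => k x) h3).symm
    rcases x with x | x
    · exact ConcreteCategory.congr_hom h1 x
    · exact ConcreteCategory.congr_hom h2 x

/-- The point-set properties are read off from maps into two-point spaces: the indiscrete one
detects points, the Sierpiński space detects closed sets. -/
theorem _root_.CategoryTheory.IsPushout.isAttaching {M Y Z : TopCat.{u}} {A : Set M} {f : C(A, Y)}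
    {g : C(M, Z)} {j : C(Y, Z)}
    (h : IsPushout (TopCat.ofHom (valMap A)) (TopCat.ofHom f) (TopCat.ofHom g) (TopCat.ofHom j)) :
    IsAttaching A f g j := by
  have hw := h.w
  -- Every function into the indiscrete space is continuous, so every pair of predicates on `M` and
  -- `Y` that agree over `A` descends to `Z`.
  let Ω : TopCat.{u} := @TopCat.of (ULift.{u} Prop) ⊤
  have toΩ : ∀ (W : TopCat.{u}) (p : W → ULift.{u} Prop), ∃ k : W ⟶ Ω, ∀ w, k w = p w :=
    fun W p => ⟨@TopCat.ofHom _ _ _ ⊤ (@ContinuousMap.mk _ _ _ ⊤ p continuous_top), fun _ => rfl⟩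
  have sep : ∀ m ∉ A, ∃ d : Z → ULift.{u} Prop, (∀ m', d (g m') = ⟨m' = m⟩) ∧
      ∀ y, d (j y) = ⟨False⟩ := by
    intro m hm
    obtain ⟨k, hk⟩ := toΩ M fun m' => ⟨m' = m⟩
    obtain ⟨l, hl⟩ := toΩ Y fun _ => ⟨False⟩
    have hkl : TopCat.ofHom (valMap A) ≫ k = TopCat.ofHom f ≫ l := by
      apply TopCat.ext
      intro a
      refine (hk _).trans (Eq.trans ?_ (hl (f a)).symm)
      refine congrArg ULift.up (eq_false ?_)
      rintro h0
      exact hm (h0 ▸ a.2)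
    refine ⟨h.desc k l hkl, fun m' => ?_, fun y => ?_⟩
    · exact (ConcreteCategory.congr_hom (h.inl_desc k l hkl) m').trans (hk m')
    · exact (ConcreteCategory.congr_hom (h.inr_desc k l hkl) y).trans (hl y)
  have comm : ∀ a : A, g a = j (f a) := fun a => ConcreteCategory.congr_hom hw a
  have surj : ∀ z, z ∈ range j ∨ ∃ m ∉ A, g m = z := by
    intro z
    by_contra hz
    obtain ⟨k, hk⟩ := toΩ Z fun z' => ⟨z' = z⟩
    obtain ⟨l, hl⟩ := toΩ Z fun _ => ⟨False⟩
    have hz1 : z ∉ range j := fun h' => hz (Or.inl h')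
    have hz2 : z ∉ range g := by
      rintro ⟨m, hm⟩
      by_cases hmA : m ∈ A
      · exact hz1 ⟨f ⟨m, hmA⟩, (comm ⟨m, hmA⟩).symm.trans hm⟩
      · exact hz (Or.inr ⟨m, hmA, hm⟩)
    -- The indicator of a missed point and the constant `False` agree on `M` and on `Y`, so
    -- uniqueness of descent identifies them.
    have hkl : k = l := by
      refine h.hom_ext ?_ ?_
      · apply TopCat.ext
        intro m
        refine (hk _).trans (Eq.trans ?_ (hl _).symm)
        exact congrArg ULift.up (eq_false fun h0 => hz2 ⟨m, h0⟩)
      · apply TopCat.ext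
        intro y
        refine (hk _).trans (Eq.trans ?_ (hl _).symm)
        exact congrArg ULift.up (eq_false fun h0 => hz1 ⟨y, h0⟩)
    have h1 := hk z
    rw [hkl, hl z] at h1
    simpa using congrArg ULift.down h1
  refine ⟨comm, ?_, ?_, surj, ?_⟩
  · intro m hm m' hm' hmm
    obtain ⟨d, hd, -⟩ := sep m' hm'
    have h1 := hd m
    rw [hmm, hd m'] at h1
    have h2 := congrArg ULift.down h1
    simpa using h2.symm
  · rintro m hm ⟨y, hy⟩
    obtain ⟨d, hd, hd'⟩ := sep m hm
    have h1 := hd m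
    rw [← hy, hd' y] at h1
    have h2 := congrArg ULift.down h1
    simp at h2
  · intro s hs hs'
    -- Now `Prop` carries its Sierpiński topology, for which continuity of a predicate means that
    -- the set where it holds is open. The indicators of the complement of `s` glue to a continuous
    -- map on `Z`.
    obtain ⟨k, hk⟩ : ∃ k : M ⟶ TopCat.of (ULift.{u} Prop), ∀ m, k m = ⟨g m ∉ s⟩ :=
      ⟨TopCat.ofHom ⟨fun m => ⟨g m ∉ s⟩, continuous_uliftUp.comp
        (continuous_Prop.2 hs.isOpen_compl)⟩, fun _ => rfl⟩
    obtain ⟨l, hl⟩ : ∃ l : Y ⟶ TopCat.of (ULift.{u} Prop), ∀ y, l y = ⟨j y ∉ s⟩ :=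
      ⟨TopCat.ofHom ⟨fun y => ⟨j y ∉ s⟩, continuous_uliftUp.comp
        (continuous_Prop.2 hs'.isOpen_compl)⟩, fun _ => rfl⟩
    have hkl : TopCat.ofHom (valMap A) ≫ k = TopCat.ofHom f ≫ l := by
      apply TopCat.ext
      intro a
      refine (hk _).trans (Eq.trans ?_ (hl _).symm)
      exact congrArg (fun z => ULift.up (z ∉ s)) (comm a)
    have hid : ∀ z, h.desc k l hkl z = ⟨z ∉ s⟩ := by
      intro z
      have hg : ∀ m, h.desc k l hkl (g m) = ⟨g m ∉ s⟩ := fun m =>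
        (ConcreteCategory.congr_hom (h.inl_desc k l hkl) m).trans (hk m)
      rcases surj z with ⟨y, rfl⟩ | ⟨m, -, rfl⟩
      · exact (ConcreteCategory.congr_hom (h.inr_desc k l hkl) y).trans (hl y)
      · exact hg m
    have hc : Continuous fun z => (h.desc k l hkl z).down :=
      continuous_uliftDown.comp (h.desc k l hkl).hom.continuous
    simp only [hid] at hc
    exact isOpen_compl_iff.1 (continuous_Prop.1 hc)

end StratBundle

/-! ### Point-set preliminaries -/

namespace StratBundle

theorem IsAttaching.isClosed_range {M Y Z : Type*} [TopologicalSpace M] [TopologicalSpace Y]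
    [TopologicalSpace Z] {A : Set M} {f : A → Y} {g : M → Z} {j : Y → Z}
    (h : IsAttaching A f g j) (hA : IsClosed A) : IsClosed (range j) := by
  refine h.isClosed _ ?_ (by simp)
  convert hA using 1
  ext m
  refine ⟨fun hm => by_contra fun hmA => h.notMem m hmA hm, fun hm => ?_⟩
  exact ⟨f ⟨m, hm⟩, (h.comm ⟨m, hm⟩).symm⟩

/-- The image of a second countable space under a closed continuous surjection with compact
fibres is second countable. -/
theorem secondCountableTopology_of_isClosedMap {D Y : Type*} [TopologicalSpace D]
    [TopologicalSpace Y] [SecondCountableTopology D] {f : D → Y} (hf : Continuous f)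
    (hcl : IsClosedMap f) (hsurj : Function.Surjective f)
    (hcpt : ∀ y, IsCompact (f ⁻¹' {y})) : SecondCountableTopology Y := by
  obtain ⟨b, hbc, -, hb⟩ := TopologicalSpace.exists_countable_basis D
  -- `t s` is the set of points whose fibre lies in `⋃₀ s`; it is open because `f` is closed. Finite
  -- `s` suffice because fibres are compact.
  let t : Set (Set D) → Set Y := fun s => (f '' (⋃₀ s)ᶜ)ᶜ
  have htopen : ∀ s ⊆ b, IsOpen (t s) := fun s hs =>
    (hcl _ (isOpen_sUnion fun u hu => hb.isOpen (hs hu)).isClosed_compl).isOpen_compl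
  have hbasis : TopologicalSpace.IsTopologicalBasis (t '' {s | s.Finite ∧ s ⊆ b}) := by
    refine TopologicalSpace.isTopologicalBasis_of_isOpen_of_nhds ?_ ?_
    · rintro _ ⟨s, ⟨-, hs⟩, rfl⟩
      exact htopen s hs
    · intro y v hy hv
      have hsub : f ⁻¹' {y} ⊆ ⋃₀ {u ∈ b | u ⊆ f ⁻¹' v} := by
        rintro x hx
        have hx' : f x = y := hx
        obtain ⟨u, hu, hxu, huv⟩ := hb.exists_subset_of_mem_open
          (show x ∈ f ⁻¹' v by simpa [hx'] using hy) (hv.preimage hf)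
        exact ⟨u, ⟨hu, huv⟩, hxu⟩
      obtain ⟨s, hs, hsf, hys⟩ := (hcpt y).elim_finite_subcover_image
        (b := {u ∈ b | u ⊆ f ⁻¹' v}) (c := id) (fun u hu => hb.isOpen hu.1)
        (by simpa [sUnion_eq_biUnion] using hsub)
      have hys : f ⁻¹' {y} ⊆ ⋃₀ s := by simpa [sUnion_eq_biUnion] using hys
      refine ⟨t s, ⟨s, ⟨hsf, fun u hu => (hs hu).1⟩, rfl⟩, ?_, ?_⟩
      · rintro ⟨x, hx, hxy⟩
        exact hx (hys hxy)
      · intro z hz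
        obtain ⟨x, rfl⟩ := hsurj z
        have hx : x ∈ ⋃₀ s := by_contra fun hx => hz ⟨x, hx, rfl⟩
        obtain ⟨u, hu, hxu⟩ := hx
        exact (hs hu).2 hxu
  exact hbasis.secondCountableTopology
    ((Set.countable_ofPred_finite_subset hbc).image t)

/-- Each `U i` is locally closed, hence σ-compact, say the union of compact sets `D i n`. Starting
from `C`, compact tuples `L n` are chosen with `L n ∪ D n` in the interior of `L (n + 1)`, all good
and with trace on `A` inside `U`. The union of the interiors is the required tuple: it absorbs all
of `U`, and goodness passes to increasing unions of open tuples. -/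
theorem exists_open_extension {I Y : Type*} [TopologicalSpace Y]
    [LocallyCompactSpace Y] [T2Space Y] [SecondCountableTopology Y]
    (good : (I → Set Y) → Prop) (hanti : ∀ U U', (∀ i, U i ⊆ U' i) → good U' → good U)
    (hnhds : ∀ L, (∀ i, IsCompact (L i)) → good L →
      ∃ O, (∀ i, IsOpen (O i) ∧ L i ⊆ O i) ∧ good O)
    (hunion : ∀ O : ℕ → I → Set Y, (∀ n i, IsOpen (O n i)) → (∀ i, Monotone fun n => O n i) →
      (∀ n, good (O n)) → good fun i => ⋃ n, O n i)
    {A : Set Y} (hA : IsClosed A) (U : I → Set Y) (hU : ∀ i, ∃ O, IsOpen O ∧ U i = O ∩ A)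
    (hext : ∀ L, (∀ i, L i ∩ A ⊆ U i) → good L → good fun i => L i ∪ U i)
    (C : I → Set Y) (hC : ∀ i, IsCompact (C i)) (hCA : ∀ i, C i ∩ A ⊆ U i) (hCg : good C) :
    ∃ W : I → Set Y, (∀ i, IsOpen (W i)) ∧ (∀ i, W i ∩ A = U i) ∧ (∀ i, C i ⊆ W i) ∧ good W := by
  have hUA : ∀ i, U i ⊆ A := fun i => by
    obtain ⟨O, -, h⟩ := hU i
    rw [h]
    exact inter_subset_right
  have hsigma : ∀ i, ∃ D : ℕ → Set Y, (∀ n, IsCompact (D n)) ∧ ⋃ n, D n = U i := by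
    intro i
    obtain ⟨O, hO, h⟩ := hU i
    have h1 : IsLocallyClosed (U i) := h ▸ hO.isLocallyClosed.inter hA.isLocallyClosed
    have := h1.locallyCompactSpace
    exact isSigmaCompact_iff_sigmaCompactSpace.2 inferInstance
  choose D hDc hDU using hsigma
  let Inv : (I → Set Y) → Prop := fun L =>
    (∀ i, IsCompact (L i)) ∧ (∀ i, L i ∩ A ⊆ U i) ∧ good L
  have step : ∀ (n : ℕ) (L : {L // Inv L}), ∃ L' : {L // Inv L},
      ∀ i, L.1 i ∪ D i n ⊆ interior (L'.1 i) := by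
    rintro n ⟨L, hLc, hLA, hLg⟩
    have hDn : ∀ i, D i n ⊆ U i := fun i => hDU i ▸ subset_iUnion _ n
    -- `L ∪ U` is good by `hext`, hence so is the smaller compact tuple `L ∪ D n`.
    obtain ⟨O, hO, hOg⟩ := hnhds (fun i => L i ∪ D i n) (fun i => (hLc i).union (hDc i n))
      (hanti _ _ (fun i => union_subset_union_right _ (hDn i)) (hext L hLA hLg))
    choose G hG hGU using hU
    -- Staying inside `G i ∪ Aᶜ` forces the trace of `L'` on `A` into `G i ∩ A = U i`.
    have h1 : ∀ i, ∃ L' : Set Y, IsCompact L' ∧ L i ∪ D i n ⊆ interior L' ∧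
        L' ⊆ O i ∩ (G i ∪ Aᶜ) := by
      intro i
      refine exists_compact_between ((hLc i).union (hDc i n))
        ((hO i).1.inter ((hG i).union hA.isOpen_compl)) (subset_inter (hO i).2 ?_)
      rintro x (hx | hx)
      · by_cases hxA : x ∈ A
        · have h2 := hLA i ⟨hx, hxA⟩
          rw [hGU i] at h2
          exact Or.inl h2.1
        · exact Or.inr hxA
      · have h2 := hDn i hx
        rw [hGU i] at h2
        exact Or.inl h2.1
    choose L' hL'c hL' hL'O using h1
    refine ⟨⟨L', hL'c, fun i x hx => ?_, hanti _ _ (fun i => (hL'O i).trans inter_subset_left) hOg⟩,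
      hL'⟩
    rw [hGU i]
    rcases (hL'O i hx.1).2 with h2 | h2
    · exact ⟨h2, hx.2⟩
    · exact absurd hx.2 h2
  choose next hnext using step
  let L : ℕ → {L // Inv L} := fun n => Nat.rec ⟨C, hC, hCA, hCg⟩ next n
  have hL : ∀ n i, (L n).1 i ∪ D i n ⊆ interior ((L (n + 1)).1 i) := fun n => hnext n (L n)
  refine ⟨fun i => ⋃ n, interior ((L n).1 i), fun i => isOpen_iUnion fun n => isOpen_interior,
    fun i => ?_, fun i => ?_, hunion _ (fun n i => isOpen_interior) (fun i => ?_) fun n =>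
      hanti _ _ (fun i => interior_subset) (L n).2.2.2⟩
  · apply Subset.antisymm
    · rintro x ⟨hx, hxA⟩
      obtain ⟨n, hn⟩ := mem_iUnion.1 hx
      exact (L n).2.2.1 i ⟨interior_subset hn, hxA⟩
    · intro x hx
      refine ⟨?_, hUA i hx⟩
      rw [← hDU i] at hx
      obtain ⟨n, hn⟩ := mem_iUnion.1 hx
      exact mem_iUnion.2 ⟨n + 1, hL n i (Or.inr hn)⟩
  · exact fun x hx => mem_iUnion.2 ⟨1, hL 0 i (Or.inl hx)⟩
  · exact monotone_nat_of_le_succ fun n => interior_subset.trans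
      (subset_union_left.trans (hL n i))

/-! ### Closed strata and closed points of stratified spaces. -/

namespace StratifiedSpace

variable {B : Type u} [TopologicalSpace B]

section

variable (S : StratifiedSpace B)

theorem isAttaching (i : ℕ) : IsAttaching (S.A i) (S.attach i) (S.char i)
    (inclusion (S.skel_subset i)) :=
  (S.isPushout i).isAttaching (Y := TopCat.of (S.skel i)) (Z := TopCat.of (S.skel (i + 1)))

theorem isClosed_A (i : ℕ) : IsClosed (S.A i) := by
  obtain ⟨_, _, K, hK⟩ := S.cwPair i
  exact hK ▸ CWComplex.Subcomplex.closed K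

theorem skel_mono : Monotone S.skel := monotone_nat_of_le_succ S.skel_subset

theorem char_mem_skel_iff {i : ℕ} (m : S.M i) : (S.char i m : B) ∈ S.skel i ↔ m ∈ S.A i := by
  refine ⟨fun h => by_contra fun hm => ?_, fun h => ?_⟩
  · exact (S.isAttaching i).notMem m hm ⟨⟨_, h⟩, Subtype.ext rfl⟩
  · have h1 := (S.isAttaching i).comm ⟨m, h⟩
    have h2 : S.char i m = inclusion (S.skel_subset i) (S.attach i ⟨m, h⟩) := h1
    rw [h2]
    exact (S.attach i ⟨m, h⟩).2

theorem exists_char_eq {i : ℕ} {b : B} (hb : b ∈ S.skel (i + 1)) (hb' : b ∉ S.skel i) :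
    ∃ m ∉ S.A i, (S.char i m : B) = b := by
  rcases (S.isAttaching i).surj ⟨b, hb⟩ with ⟨y, hy⟩ | ⟨m, hm, h⟩
  · have h : (y : B) = b := congrArg Subtype.val hy
    exact absurd (h ▸ y.2) hb'
  · exact ⟨m, hm, congrArg Subtype.val h⟩

theorem isClosed_skel_of_succ (i : ℕ) :
    IsClosed ((↑) ⁻¹' S.skel i : Set (S.skel (i + 1))) := by
  convert (S.isAttaching i).isClosed_range (S.isClosed_A i)
  ext x
  exact ⟨fun h => ⟨⟨x, h⟩, rfl⟩, by rintro ⟨y, rfl⟩; exact y.2⟩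

/-- Closedness is tested on each `skel n`. For `n ≤ i` the trace is everything; beyond that it is
carried along the closed embeddings `skel n ⊆ skel (n + 1)`. -/
theorem isClosed_skel (i : ℕ) : IsClosed (S.skel i) := by
  refine S.coherent.isClosed_iff.2 ?_
  rintro _ ⟨n, rfl⟩
  induction n with
  | zero =>
    convert isClosed_univ
    exact eq_univ_of_forall fun x => S.skel_mono (Nat.zero_le i) x.2
  | succ n ih =>
    rcases Nat.lt_or_ge i (n + 1) with h | h
    · have h1 : S.skel i ⊆ S.skel n := S.skel_mono (Nat.lt_succ_iff.1 h)
      have h2 : IsClosedEmbedding (inclusion (S.skel_subset n)) := by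
        refine ⟨IsEmbedding.inclusion _, ?_⟩
        rw [range_inclusion]
        exact S.isClosed_skel_of_succ n
      convert h2.isClosedMap _ ih
      ext x
      constructor
      · intro hx
        exact ⟨⟨x, h1 hx⟩, hx, rfl⟩
      · rintro ⟨y, hy, rfl⟩
        exact hy
    · convert isClosed_univ
      exact eq_univ_of_forall fun x => S.skel_mono h x.2

end

/-- The preimage of a point in `M n` is either the copy of a closed subset of `A n` or has at most
one element, so closedness of points survives each attachment. This makes the fibres of diagrams
over `B` closed, as the charts of the coend require. -/
theorem t1Space (S : StratifiedSpace B) : T1Space B := by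
  have hM : ∀ i, T2Space (S.M i) := fun i => (S.cwPair i).1
  have h : ∀ (n : ℕ) (b : B), IsClosed ((↑) ⁻¹' {b} : Set (S.skel n)) := by
    intro n b
    induction n with
    | zero =>
      have : T2Space (S.skel 0) := S.cw_zero.1
      exact Set.Subsingleton.isClosed fun x hx y hy =>
        Subtype.ext ((show x.1 = b from hx).trans (show y.1 = b from hy).symm)
    | succ n ih =>
      refine (S.isAttaching n).isClosed _ ?_ ?_
      · by_cases hb : b ∈ S.skel n
        · have h1 := (S.isClosed_A n).isClosedEmbedding_subtypeVal.isClosedMap _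
            (ih.preimage (S.attach n).continuous)
          convert h1
          ext m
          constructor
          · intro hm
            have hm : (S.char n m : B) = b := hm
            have hmA : m ∈ S.A n := (S.char_mem_skel_iff m).1 (hm ▸ hb)
            refine ⟨⟨m, hmA⟩, ?_, rfl⟩
            rw [← hm]
            exact (congrArg Subtype.val ((S.isAttaching n).comm ⟨m, hmA⟩)).symm
          · rintro ⟨a, ha, rfl⟩
            have ha : (S.attach n a : B) = b := ha
            exact (congrArg Subtype.val ((S.isAttaching n).comm a)).trans ha
        · refine Set.Subsingleton.isClosed fun m hm m' hm' => ?_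
          have hm : (S.char n m : B) = b := hm
          have hm' : (S.char n m' : B) = b := hm'
          refine (S.isAttaching n).injOn ?_ ?_ (Subtype.ext (hm.trans hm'.symm))
          · exact fun h => hb (hm ▸ (S.char_mem_skel_iff m).2 h)
          · exact fun h => hb (hm' ▸ (S.char_mem_skel_iff m').2 h)
      · exact ih
  refine ⟨fun b => S.coherent.isClosed_iff.2 ?_⟩
  rintro _ ⟨n, rfl⟩
  exact h n b

end StratifiedSpace

end StratBundle

/-! ### Trivializations of families -/

namespace StratBundle

variable {F : Type u} [SmallCategory F]

namespace Family

variable {φ : F ⥤ TopCat.{u}} {X B X' B' : Type u} [TopologicalSpace X] [TopologicalSpace B]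
  [TopologicalSpace X'] [TopologicalSpace B']

theorem incl_chart (E : Family φ X B) (b : B) (x : (E.proj ⁻¹' {b} : Set X)) :
    E.incl b (E.chart b x) = x := by
  change ((E.chart b).symm (E.chart b x) : X) = x
  rw [Homeomorph.symm_apply_apply]

theorem exists_incl (E : Family φ X B) (x : X) : ∃ y, E.incl (E.proj x) y = x :=
  ⟨E.chart (E.proj x) ⟨x, rfl⟩, E.incl_chart _ ⟨x, rfl⟩⟩

theorem incl_injective (E : Family φ X B) (b : B) : Function.Injective (E.incl b) :=
  (E.isEmbedding_incl b).injective

/-- The map `k` trivializes the family `E` over the subset `U` of the base. -/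
structure IsTrivialization (E : Family φ X B) (U : Set B) (W : F) (k : C(U × φ.obj W, X)) :
    Prop where
  isEmbedding : IsEmbedding k
  fibre : ∀ u : U, ∃ (g : W ⟶ E.fib u) (g' : E.fib u ⟶ W),
    (∀ y, k (u, y) = E.incl u (φ.map g y)) ∧ φ.map g ≫ φ.map g' = 𝟙 _ ∧
      φ.map g' ≫ φ.map g = 𝟙 _

namespace IsTrivialization

variable {E : Family φ X B} {U : Set B} {W : F} {k : C(U × φ.obj W, X)}

theorem proj_apply (h : E.IsTrivialization U W k) (z : U × φ.obj W) : E.proj (k z) = z.1 := by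
  obtain ⟨g, -, hg, -⟩ := h.fibre z.1
  rw [show z = (z.1, z.2) from rfl, hg, E.proj_incl]

theorem exists_eq (h : E.IsTrivialization U W k) {x : X} (hx : E.proj x ∈ U) :
    ∃ y, k (⟨E.proj x, hx⟩, y) = x := by
  obtain ⟨g, g', hg, -, hgg⟩ := h.fibre ⟨E.proj x, hx⟩
  obtain ⟨y, hy⟩ := E.exists_incl x
  refine ⟨φ.map g' y, ?_⟩
  rw [hg]
  have h1 : φ.map g (φ.map g' y) = y := ConcreteCategory.congr_hom hgg y
  rw [h1]
  exact hy

theorem range_eq (h : E.IsTrivialization U W k) : range k = E.proj ⁻¹' U := by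
  apply Subset.antisymm
  · rintro _ ⟨z, rfl⟩
    change E.proj (k z) ∈ U
    rw [h.proj_apply]
    exact z.1.2
  · intro x hx
    obtain ⟨y, hy⟩ := h.exists_eq hx
    exact ⟨_, hy⟩

theorem isOpenEmbedding (h : E.IsTrivialization U W k) (hU : IsOpen U) : IsOpenEmbedding k :=
  ⟨h.isEmbedding, h.range_eq ▸ hU.preimage E.proj.continuous⟩

theorem mono (h : E.IsTrivialization U W k) {U' : Set B} (hU : U' ⊆ U) :
    E.IsTrivialization U' W
      (k.comp ((ContinuousMap.inclusion hU).prodMap (ContinuousMap.id (φ.obj W)))) where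
  isEmbedding := h.isEmbedding.comp ((IsEmbedding.inclusion hU).prodMap IsEmbedding.id)
  fibre u := h.fibre ⟨u.1, hU u.2⟩

end IsTrivialization

/-- Replaces isomorphisms with a product family by embeddings into the fixed space `X`, which are
easier to restrict and compose. Since `φ` need not be faithful here, mutual inverses are recorded
only after applying `φ`. -/
theorem exists_isTrivialization_iff (E : Family φ X B) (U : Set B) (W : F) :
    (∃ e : (E.proj ⁻¹' U : Set X) ≃ₜ U × φ.obj W,
      (E.restrict U).IsIso (productFamily φ W U) e (Homeomorph.refl U)) ↔
    ∃ k, E.IsTrivialization U W k := by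
  constructor
  · rintro ⟨e, he, he'⟩
    refine ⟨⟨fun z => (e.symm z : X), by fun_prop⟩,
      IsEmbedding.subtypeVal.comp e.symm.isEmbedding, fun u => ?_⟩
    obtain ⟨g, hg⟩ := he'.fibre u
    obtain ⟨g', hg'⟩ := he.fibre u
    have hg : ∀ y, e.symm (u, y) = (E.restrict U).incl u (φ.map g y) := hg
    have hg' : ∀ y, e ((E.restrict U).incl u y) = (u, φ.map g' y) := hg'
    refine ⟨g, g', fun y => congrArg Subtype.val (hg y), ?_, ?_⟩
    · ext y
      have h1 := hg' (φ.map g y)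
      rw [← hg, Homeomorph.apply_symm_apply] at h1
      exact (congrArg Prod.snd h1).symm
    · ext y
      have h1 := hg (φ.map g' y)
      exact ((E.restrict U).incl_injective u
        ((e.symm_apply_apply _).symm.trans ((congrArg e.symm (hg' y)).trans h1))).symm
  · rintro ⟨k, hk⟩
    let e : (E.proj ⁻¹' U : Set X) ≃ₜ U × φ.obj W :=
      ((hk.isEmbedding.toHomeomorph).trans (Homeomorph.setCongr hk.range_eq)).symm
    have he : ∀ z, (e.symm z : X) = k z := fun z => rfl
    have he2 : ∀ x z, k z = x.1 → e x = z := fun x z h =>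
      e.symm.injective (Subtype.ext (by rw [e.symm_apply_apply, he, h]))
    refine ⟨e, ⟨fun x => ?_, fun u => ?_⟩, ⟨fun z => ?_, fun u => ?_⟩⟩
    · obtain ⟨y, hy⟩ := hk.exists_eq x.2
      change (e x).1 = _
      rw [he2 x _ hy]
      rfl
    · obtain ⟨g, g', hg, -, hgg⟩ := hk.fibre u
      refine ⟨g', fun y => he2 _ _ ?_⟩
      refine (hg _).trans ?_
      have h1 : φ.map g (φ.map g' y) = y := ConcreteCategory.congr_hom hgg y
      exact congrArg (E.incl u) h1
    · exact Subtype.ext (hk.proj_apply z)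
    · obtain ⟨g, g', hg, -, hgg⟩ := hk.fibre u
      exact ⟨g, fun y => Subtype.ext (hg y)⟩

theorem isBundle_iff (E : Family φ X B) :
    E.IsBundle ↔ ∀ b, ∃ U, IsOpen U ∧ b ∈ U ∧ ∃ W k, E.IsTrivialization U W k := by
  constructor
  · intro h b
    obtain ⟨U, hU, W, e, he⟩ := h b
    obtain ⟨k, hk⟩ := (E.exists_isTrivialization_iff U W).1 ⟨e, he⟩
    obtain ⟨U', hU', hU'o, hb⟩ := mem_nhds_iff.1 hU
    exact ⟨U', hU'o, hb, W, _, hk.mono hU'⟩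
  · intro h b
    obtain ⟨U, hU, hb, W, hk⟩ := h b
    exact ⟨U, hU.mem_nhds hb, W, (E.exists_isTrivialization_iff U W).2 hk⟩

/-- Lets the local trivializations of a restricted family take values in `X` itself, over sets `U ∩
Y` of the original base. -/
theorem isBundle_restrict_iff (E : Family φ X B) (Y : Set B) :
    (E.restrict Y).IsBundle ↔
      ∀ b ∈ Y, ∃ U, IsOpen U ∧ b ∈ U ∧ ∃ W k, E.IsTrivialization (U ∩ Y) W k := by
  rw [isBundle_iff]
  constructor
  · intro h b hb
    obtain ⟨U, hU, hbU, W, k, hk⟩ := h ⟨b, hb⟩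
    obtain ⟨O, hO, rfl⟩ := isOpen_induced_iff.1 hU
    let i : C((O ∩ Y : Set B), ((↑) ⁻¹' O : Set Y)) :=
      ⟨fun u => ⟨⟨u.1, u.2.2⟩, u.2.1⟩, by fun_prop⟩
    have hi : IsEmbedding i := IsEmbedding.of_comp i.continuous
      (g := fun v => (v.1.1 : B)) (by fun_prop) IsEmbedding.subtypeVal
    refine ⟨O, hO, hbU, W, (valMap _).comp (k.comp (i.prodMap (ContinuousMap.id _))), ?_, ?_⟩
    · exact IsEmbedding.subtypeVal.comp (hk.isEmbedding.comp (hi.prodMap IsEmbedding.id))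
    · intro u
      obtain ⟨g, g', hg, hgg⟩ := hk.fibre (i u)
      exact ⟨g, g', fun y => congrArg Subtype.val (hg y), hgg⟩
  · rintro h ⟨b, hb⟩
    obtain ⟨O, hO, hbO, W, k, hk⟩ := h b hb
    let i : C(((↑) ⁻¹' O : Set Y), (O ∩ Y : Set B)) :=
      ⟨fun u => ⟨u.1.1, u.2, u.1.2⟩, by fun_prop⟩
    have hv : IsEmbedding fun u : ((↑) ⁻¹' O : Set Y) => (u.1.1 : B) :=
      IsEmbedding.subtypeVal.comp IsEmbedding.subtypeVal
    have hi : IsEmbedding i := IsEmbedding.of_comp i.continuous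
      continuous_subtype_val hv
    refine ⟨Subtype.val ⁻¹' O, hO.preimage continuous_subtype_val, hbO, W,
      ⟨fun z => ⟨k (i z.1, z.2), ?_⟩, ?_⟩, ?_, ?_⟩
    · change E.proj _ ∈ Y
      rw [hk.proj_apply]
      exact z.1.1.2
    · exact Continuous.subtype_mk (k.continuous.comp (by fun_prop)) _
    · refine IsEmbedding.of_comp (ContinuousMap.continuous _) continuous_subtype_val ?_
      exact hk.isEmbedding.comp (hi.prodMap IsEmbedding.id)
    · intro u
      obtain ⟨g, g', hg, hgg⟩ := hk.fibre (i u)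
      exact ⟨g, g', fun y => Subtype.ext (hg y), hgg⟩

theorem IsBundle.restrict {E : Family φ X B} (h : E.IsBundle) (Y : Set B) :
    (E.restrict Y).IsBundle := by
  rw [isBundle_restrict_iff]
  intro b _
  obtain ⟨U, hU, hb, W, k, hk⟩ := E.isBundle_iff.1 h b
  exact ⟨U, hU, hb, W, _, hk.mono inter_subset_left⟩

theorem IsBundle.t2Space {E : Family φ X B} (h : E.IsBundle) (hφ : IsFibreFunctor φ)
    [T2Space B] : T2Space X := by
  refine ⟨fun x x' hxx => ?_⟩
  by_cases hb : E.proj x = E.proj x'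
  · obtain ⟨U, hU, hbU, W, k, hk⟩ := E.isBundle_iff.1 h (E.proj x)
    obtain ⟨y, hy⟩ := hk.exists_eq hbU
    obtain ⟨y', hy'⟩ := hk.exists_eq (hb ▸ hbU)
    have := hφ.t2 W
    have hne : (⟨E.proj x, hbU⟩, y) ≠ ((⟨E.proj x', hb ▸ hbU⟩, y') : U × φ.obj W) := by
      intro h0
      exact hxx (hy.symm.trans ((congrArg k h0).trans hy'))
    obtain ⟨O, O', hO, hO', hyO, hyO', hd⟩ := t2_separation hne
    have hko := hk.isOpenEmbedding hU
    exact ⟨k '' O, k '' O', hko.isOpenMap _ hO, hko.isOpenMap _ hO', ⟨_, hyO, hy⟩,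
      ⟨_, hyO', hy'⟩, (disjoint_image_iff hko.injective).2 hd⟩
  · obtain ⟨O, O', hO, hO', h1, h2, hd⟩ := t2_separation hb
    exact ⟨_, _, hO.preimage E.proj.continuous, hO'.preimage E.proj.continuous, h1, h2,
      hd.preimage _⟩

theorem IsBundle.locallyCompactSpace {E : Family φ X B} (h : E.IsBundle) (hφ : IsFibreFunctor φ)
    [LocallyCompactSpace B] : LocallyCompactSpace X := by
  refine ⟨fun x n hn => ?_⟩
  obtain ⟨U, hU, hbU, W, k, hk⟩ := E.isBundle_iff.1 h (E.proj x)
  obtain ⟨y, hy⟩ := hk.exists_eq hbU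
  have := hφ.locallyCompact W
  have := hU.locallyCompactSpace
  have hko := hk.isOpenEmbedding hU
  obtain ⟨s, hs, hsn, hsc⟩ := local_compact_nhds
    (k.continuous.continuousAt.preimage_mem_nhds (hy.symm ▸ hn))
  refine ⟨k '' s, ?_, image_subset_iff.2 hsn, hsc.image k.continuous⟩
  rw [← hy]
  exact hko.isOpenMap.image_mem_nhds hs

theorem IsBundle.secondCountableTopology {E : Family φ X B} (h : E.IsBundle)
    (hφ : IsFibreFunctor φ) [CompactSpace B] [SecondCountableTopology B] :
    SecondCountableTopology X := by
  choose U hU hbU W k hk using E.isBundle_iff.1 h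
  obtain ⟨t, ht⟩ := isCompact_univ.elim_finite_subcover U hU
    fun b _ => mem_iUnion.2 ⟨b, hbU b⟩
  have hsc : ∀ b : t, SecondCountableTopology (E.proj ⁻¹' U b : Set X) := by
    intro b
    have := hφ.secondCountable (W b)
    have h1 : SecondCountableTopology (range (k b)) :=
      (hk b).isEmbedding.toHomeomorph.symm.secondCountableTopology
    rwa [(hk b).range_eq] at h1
  refine TopologicalSpace.secondCountableTopology_of_countable_cover
    (U := fun b : t => E.proj ⁻¹' U b) (fun b => (hU b).preimage E.proj.continuous) ?_
  refine eq_univ_of_forall fun x => ?_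
  obtain ⟨b, hb, hx⟩ := mem_iUnion₂.1 (ht (mem_univ (E.proj x)))
  exact mem_iUnion.2 ⟨⟨b, hb⟩, hx⟩

/-- The total space of a bundle over a space `Y` is determined by a closed cover of `Y` which
determines the topology of `Y`. -/
theorem IsBundle.isClosed_of_cover {E : Family φ X B} (h : E.IsBundle) (hφ : IsFibreFunctor φ)
    {Y : Set B} (hY : IsClosed Y) {ι : Type*} {C : ι → Set B} (hYC : Y ⊆ ⋃ i, C i)
    (hC : ∀ Z ⊆ Y, (∀ i, IsClosed (Z ∩ C i)) → IsClosed Z) (hCc : ∀ i, IsClosed (C i))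
    {Z : Set X} (hZY : Z ⊆ E.proj ⁻¹' Y) (hZ : ∀ i, IsClosed (Z ∩ E.proj ⁻¹' C i)) :
    IsClosed Z := by
  rw [← isOpen_compl_iff, isOpen_iff_mem_nhds]
  intro x hx
  by_cases hxY : E.proj x ∈ Y
  swap
  · exact Filter.mem_of_superset ((hY.preimage E.proj.continuous).isOpen_compl.mem_nhds hxY)
      (compl_subset_compl.2 hZY)
  obtain ⟨U, hU, hbU, W, k, hk⟩ := E.isBundle_iff.1 h (E.proj x)
  obtain ⟨y, hy⟩ := hk.exists_eq hbU
  obtain ⟨i, hi⟩ := mem_iUnion.1 (hYC hxY)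
  have := hφ.locallyCompact W
  have := hφ.t2 W
  have hko := hk.isOpenEmbedding hU
  let s : C(φ.obj W, X) := ⟨fun y' => k (⟨E.proj x, hbU⟩, y'), by fun_prop⟩
  -- In the fibre through `x` the set `Z` is already closed, since it is closed over some `C i`
  -- containing the base point. So a compact neighbourhood `L` in this fibre misses `Z`.
  obtain ⟨L, hL, hLZ, hLc⟩ := local_compact_nhds (x := y)
    (n := (s ⁻¹' (Z ∩ E.proj ⁻¹' C i))ᶜ) (((hZ i).preimage s.continuous).isOpen_compl.mem_nhds
      fun h0 => hx (hy ▸ h0.1))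
  -- `Q` collects the base points over which `Z` meets the slice `L`. Projection along the compact
  -- `L` is closed, so `Q` is relatively closed in `U` over each `C j`; adding `Y \ U` makes it
  -- closed over each `C j` in the whole base. Its complement times `L` is then a neighbourhood of
  -- `x` missing `Z`.
  let Q : Set B := {b | ∃ hb : b ∈ U, ∃ y' ∈ L, k (⟨b, hb⟩, y') ∈ Z}
  have hQ : ∀ j, IsClosed ((Q ∪ (Y \ U)) ∩ C j) := by
    intro j
    have := isCompact_iff_compactSpace.1 hLc
    let t : U × L → X := fun z => k (z.1, z.2)
    have ht : Continuous t := by fun_prop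
    have h1 : IsClosed (Prod.fst '' (t ⁻¹' (Z ∩ E.proj ⁻¹' C j))) :=
      isClosedMap_fst_of_compactSpace _ ((hZ j).preimage ht)
    obtain ⟨R, hR, hRe⟩ := isClosed_induced_iff.1 h1
    have h2 : (Q ∪ (Y \ U)) ∩ C j = (R ∪ Uᶜ) ∩ (Y ∩ C j) := by
      ext b
      by_cases hb : b ∈ U
      · have h3 : b ∈ R ↔ b ∈ Q ∧ b ∈ C j := by
          change (⟨b, hb⟩ : U) ∈ Subtype.val ⁻¹' R ↔ _
          rw [hRe]
          constructor
          · rintro ⟨⟨u, y'⟩, ⟨h4, h5⟩, rfl⟩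
            refine ⟨⟨hb, y', y'.2, h4⟩, ?_⟩
            have h5 : E.proj (k (⟨b, hb⟩, y')) ∈ C j := h5
            rwa [hk.proj_apply] at h5
          · rintro ⟨⟨_, y', hy', h4⟩, h5⟩
            refine ⟨(⟨b, hb⟩, ⟨y', hy'⟩), ⟨h4, ?_⟩, rfl⟩
            change E.proj (k (⟨b, hb⟩, y')) ∈ C j
            rwa [hk.proj_apply]
        have h6 : b ∈ Q → b ∈ Y := by
          rintro ⟨_, y', hy', h4⟩
          have h7 := hZY h4
          change E.proj (k (⟨b, hb⟩, y')) ∈ Y at h7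
          rwa [hk.proj_apply] at h7
        simp only [mem_inter_iff, mem_union, h3, mem_compl_iff, Set.mem_sdiff, hb]
        tauto
      · have h3 : b ∉ Q := fun ⟨h4, _⟩ => hb h4
        simp only [mem_inter_iff, mem_union, mem_compl_iff, Set.mem_sdiff, hb, h3]
        tauto
    rw [h2]
    exact (hR.union hU.isClosed_compl).inter (hY.inter (hCc j))
  have hQc : IsClosed (Q ∪ (Y \ U)) := by
    refine hC _ (union_subset ?_ sdiff_subset) hQ
    rintro b ⟨hb, y', hy', h4⟩
    have h7 := hZY h4
    change E.proj (k (⟨b, hb⟩, y')) ∈ Y at h7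
    rwa [hk.proj_apply] at h7
  have hxQ : E.proj x ∉ Q ∪ (Y \ U) := by
    rintro (⟨hb, y', hy', h4⟩ | h4)
    · refine hLZ hy' ⟨h4, ?_⟩
      change E.proj (k (⟨E.proj x, hbU⟩, y')) ∈ C i
      rwa [hk.proj_apply]
    · exact h4.2 hbU
  have hn : k '' (((↑) ⁻¹' (Q ∪ (Y \ U))ᶜ) ×ˢ L) ∈ 𝓝 x := by
    rw [← hy]
    refine hko.isOpenMap.image_mem_nhds (prod_mem_nhds ?_ hL)
    exact (hQc.isOpen_compl.preimage continuous_subtype_val).mem_nhds hxQ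
  refine Filter.mem_of_superset hn ?_
  rintro _ ⟨⟨u, y'⟩, ⟨hu, hy'⟩, rfl⟩ hZ'
  exact hu (Or.inl ⟨u.2, y', hy', hZ'⟩)

end Family

end StratBundle

/-! ### Function spaces of bundles -/

namespace StratBundle

variable {F : Type u} [SmallCategory F]

/-- The compact sets `K` which occur in the NKC property. -/
structure IsProperSet (φ : F ⥤ TopCat.{u}) (V : F) (K : Set (φ.obj V)) : Prop where
  nonempty : K.Nonempty
  isCompact : IsCompact K
  isCompact_hom : ∀ (W : F) (C : Set (φ.obj W)), IsCompact C →
    IsCompact {g : HomSpace φ V W | MapsTo (φ.map g.hom) K C}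

namespace Family

variable {φ : F ⥤ TopCat.{u}} {X B X' B' X'' B'' : Type u} [TopologicalSpace X]
  [TopologicalSpace B] [TopologicalSpace X'] [TopologicalSpace B'] [TopologicalSpace X'']
  [TopologicalSpace B'']

theorem IsMap.comp {E : Family φ X B} {E' : Family φ X' B'} {E'' : Family φ X'' B''}
    {f : C(X, X')} {fbar : C(B, B')} {f' : C(X', X'')} {fbar' : C(B', B'')}
    (h : E.IsMap E' f fbar) (h' : E'.IsMap E'' f' fbar') :
    E.IsMap E'' (f'.comp f) (fbar'.comp fbar) where
  comm x := by
    rw [ContinuousMap.comp_apply, h'.comm, h.comm, ContinuousMap.comp_apply]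
  fibre b := by
    obtain ⟨g, hg⟩ := h.fibre b
    obtain ⟨g', hg'⟩ := h'.fibre (fbar b)
    refine ⟨g ≫ g', fun y => ?_⟩
    rw [ContinuousMap.comp_apply, hg, hg']
    simp

theorem isMap_restrict (E : Family φ X B) (U : Set B) :
    (E.restrict U).IsMap E (valMap _) (valMap U) where
  comm _ := rfl
  fibre b := by
    refine ⟨𝟙 _, fun y => ?_⟩
    exact (congrArg (E.incl b) (ConcreteCategory.congr_hom (φ.map_id (E.fib b)) y)).symm

theorem IsMap.comp_mapSpace {E : Family φ X B} {E' : Family φ X' B'} {f : C(X, X')}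
    {fbar : C(B, B')} (h : E.IsMap E' f fbar) {V : F} (a : E.MapSpace V) :
    ∃ abar : C(PUnit.{u + 1}, B'), (pointFamily φ V).IsMap E' (f.comp a.1) abar := by
  obtain ⟨b, g, hg⟩ := (E.mapSpace_iff a.1).1 a.2
  obtain ⟨g', hg'⟩ := h.fibre b
  refine (E'.mapSpace_iff _).2 ⟨fbar b, g ≫ g', fun y => ?_⟩
  rw [ContinuousMap.comp_apply, hg, hg']
  simp

/-- The map of function spaces induced by a map of families. -/
def mapSpaceMap {E : Family φ X B} {E' : Family φ X' B'} {f : C(X, X')} {fbar : C(B, B')}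
    (h : E.IsMap E' f fbar) (V : F) : C(E.MapSpace V, E'.MapSpace V) where
  toFun a := ⟨f.comp a.1, h.comp_mapSpace a⟩
  continuous_toFun := Continuous.subtype_mk
    ((ContinuousMap.continuous_postcomp _).comp continuous_subtype_val) _

/-- The tuple `U` of subsets of the total space avoids `S` if no `F`-map in `S` maps every `K i`
into `U i`. -/
def Avoids (E : Family φ X B) {V : F} {I : Type*} (K : I → Set (φ.obj V))
    (S : Set (E.MapSpace V)) (U : I → Set X) : Prop :=
  ∀ s ∈ S, ∃ i, ¬ MapsTo s.1 (K i) (U i)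

/-! ### Tuples of sets avoiding a set of `F`-maps. -/

section Avoids

variable {E : Family φ X B} {V : F} {I : Type*} {K : I → Set (φ.obj V)}
  {S : Set (E.MapSpace V)} {U U' : I → Set X}

theorem Avoids.mono (h : E.Avoids K S U') (hU : ∀ i, U i ⊆ U' i) : E.Avoids K S U := by
  intro s hs
  obtain ⟨i, hi⟩ := h s hs
  exact ⟨i, fun h' => hi (h'.mono_right (hU i))⟩

/-- Each `K i` is compact, so a map carrying it into the increasing union carries it into a finite
stage, and finitely many `i` share one stage. -/
theorem Avoids.iUnion [Finite I] (hK : ∀ i, IsCompact (K i)) {O : ℕ → I → Set X}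
    (hO : ∀ n i, IsOpen (O n i)) (hmono : ∀ i, Monotone fun n => O n i)
    (h : ∀ n, E.Avoids K S (O n)) : E.Avoids K S fun i => ⋃ n, O n i := by
  intro s hs
  by_contra! hcon
  have h1 : ∀ i, ∃ n, K i ⊆ s.1 ⁻¹' O n i := fun i =>
    (hK i).elim_directed_cover _ (fun n => (hO n i).preimage s.1.continuous)
      (fun y hy => by simpa using hcon i hy)
      (Monotone.directed_le fun n m hnm => preimage_mono (hmono i hnm))
  choose n hn using h1
  have := Fintype.ofFinite I
  obtain ⟨i, hi⟩ := h (Finset.univ.sup n) s hs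
  exact hi fun y hy => hmono i (Finset.le_sup (Finset.mem_univ i)) (hn i hy)

theorem isOpen_setOf_mapsTo {K : Set (φ.obj V)} (hK : IsCompact K) {O : Set X} (hO : IsOpen O) :
    IsOpen {s : E.MapSpace V | MapsTo s.1 K O} :=
  (ContinuousMap.isOpen_setOfPred_mapsTo hK hO).preimage continuous_subtype_val

theorem isClosed_setOf_mapsTo {K : Set (φ.obj V)} {L : Set X} (hL : IsClosed L) :
    IsClosed {s : E.MapSpace V | MapsTo s.1 K L} :=
  (ContinuousMap.isClosed_setOfPred_mapsTo hL K).preimage continuous_subtype_val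

theorem continuous_mapSpace_eval (y : φ.obj V) : Continuous fun s : E.MapSpace V => s.1 y :=
  (continuous_eval_const y).comp continuous_subtype_val

/-- Choose compact neighbourhoods `L' i` of `L i`. The members of `S` mapping every `K i` into `L'
i` form a compact set, thanks to the single index `i₀`. Each of them sends some `y ∈ K i` outside `L
i`, and this is witnessed by disjoint open sets around the value and around `L i`. Finitely many
such witnesses cover the compact set, and they cut the interiors of the `L' i` down to the required
open tuple. -/
theorem Avoids.exists_isOpen [Nonempty (φ.obj V)] [LocallyCompactSpace X] [T2Space X] [Finite I]
    (hS : IsClosed S) {i₀ : I}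
    (hK₀ : ∀ L : Set X, IsCompact L → IsCompact {s : E.MapSpace V | MapsTo s.1 (K i₀) L})
    {L : I → Set X} (hL : ∀ i, IsCompact (L i)) (h : E.Avoids K S L) :
    ∃ O : I → Set X, (∀ i, IsOpen (O i) ∧ L i ⊆ O i) ∧ E.Avoids K S O := by
  choose L' hL' hLL' using fun i => exists_compact_superset (hL i)
  have hcpt : IsCompact (S ∩ {s : E.MapSpace V | ∀ i, MapsTo s.1 (K i) (L' i)}) := by
    refine (hK₀ _ (hL' i₀)).of_isClosed_subset (hS.inter ?_) fun s hs => hs.2 i₀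
    simp only [ofPred_forall]
    exact isClosed_iInter fun i => isClosed_setOf_mapsTo (hL' i).isClosed
  have h1 : ∀ s ∈ S ∩ {s : E.MapSpace V | ∀ i, MapsTo s.1 (K i) (L' i)}, ∃ (i : I)
      (y : φ.obj V) (G G' : Set X), y ∈ K i ∧ IsOpen G ∧ IsOpen G' ∧ s.1 y ∈ G ∧ L i ⊆ G' ∧
        Disjoint G G' := by
    intro s hs
    obtain ⟨i, hi⟩ := h s hs.1
    simp only [MapsTo, not_forall] at hi
    obtain ⟨y, hy, hyL⟩ := hi
    obtain ⟨G, G', hG, hG', hsG, hLG, hd⟩ := SeparatedNhds.of_isCompact_isCompact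
      isCompact_singleton (hL i) (disjoint_singleton_left.2 hyL)
    exact ⟨i, y, G, G', hy, hG, hG', hsG rfl, hLG, hd⟩
  have : Nonempty I := ⟨i₀⟩
  choose! i y G G' hy hG hG' hsG hLG hd using h1
  obtain ⟨t, htS, ht⟩ := hcpt.elim_nhds_subcover (fun s => {s' : E.MapSpace V | s'.1 (y s) ∈ G s})
    fun s hs => ((hG s hs).preimage (continuous_mapSpace_eval (y s))).mem_nhds (hsG s hs)
  refine ⟨fun j => interior (L' j) ∩ ⋂ s ∈ t, {x | i s = j → x ∈ G' s}, fun j => ⟨?_, ?_⟩, ?_⟩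
  · refine isOpen_interior.inter (isOpen_biInter_finset fun s hs => ?_)
    by_cases hj : i s = j
    · simpa [hj] using hG' s (htS s hs)
    · simp [hj]
  · refine subset_inter (hLL' j) (subset_iInter₂ fun s hs x hx hj => ?_)
    exact hLG s (htS s hs) (hj ▸ hx)
  · intro s hs
    by_contra! hcon
    obtain ⟨s', hs't, hs'⟩ := mem_iUnion₂.1 (ht ⟨hs, fun j z hz => interior_subset (hcon j hz).1⟩)
    have h2 := mem_iInter₂.1 (hcon (i s') (hy s' (htS s' hs't))).2 s' hs't rfl
    exact (hd s' (htS s' hs't)).le_bot ⟨hs', h2⟩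

end Avoids

/-! ### Function spaces over trivializing sets. -/

section Trivialization

variable {E : Family φ X B} {U : Set B} {W : F} {k : C(U × φ.obj W, X)}

theorem IsTrivialization.comp_mapSpace (h : E.IsTrivialization U W k) {V : F}
    (z : U × HomSpace φ V W) : ∃ abar : C(PUnit.{u + 1}, B), (pointFamily φ V).IsMap E
      (k.comp ((ContinuousMap.const _ z.1).prodMk (φ.map z.2.hom).hom)) abar := by
  obtain ⟨g, -, hg, -⟩ := h.fibre z.1
  refine (E.mapSpace_iff _).2 ⟨z.1, z.2.hom ≫ g, fun y => ?_⟩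
  refine (hg _).trans ?_
  simp

/-- The map `U × Hom(V, W) → E^V` induced by a trivialization of `E` over `U`. -/
def IsTrivialization.mapSpace (h : E.IsTrivialization U W k) (V : F) :
    C(U × HomSpace φ V W, E.MapSpace V) where
  toFun z := ⟨k.comp ((ContinuousMap.const _ z.1).prodMk (φ.map z.2.hom).hom),
    h.comp_mapSpace z⟩
  continuous_toFun := Continuous.subtype_mk ((ContinuousMap.continuous_postcomp k).comp
    (ContinuousMap.continuous_prodMk_const.comp
      (continuous_id.prodMap (continuous_hom_map φ V W)))) _

theorem IsTrivialization.mapSpace_apply (h : E.IsTrivialization U W k) {V : F}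
    (z : U × HomSpace φ V W) (y : φ.obj V) :
    (h.mapSpace V z).1 y = k (z.1, φ.map z.2.hom y) := rfl

variable [∀ V : F, Nonempty (φ.obj V)]

theorem IsTrivialization.mapSpaceProj_mapSpace (h : E.IsTrivialization U W k) {V : F}
    (z : U × HomSpace φ V W) : E.mapSpaceProj V (h.mapSpace V z) = z.1 :=
  h.proj_apply _

theorem IsTrivialization.exists_mapSpace_eq (h : E.IsTrivialization U W k) {V : F}
    {a : E.MapSpace V} (ha : E.mapSpaceProj V a ∈ U) : ∃ z, h.mapSpace V z = a := by
  obtain ⟨b, g₀, hg₀⟩ := (E.mapSpace_iff a.1).1 a.2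
  have hb : E.mapSpaceProj V a = b := by
    rw [← E.mapSpaceProj_eq a (Classical.arbitrary _), hg₀, E.proj_incl]
  rw [hb] at ha
  obtain ⟨g, g', hg, -, hgg⟩ := h.fibre ⟨b, ha⟩
  refine ⟨(⟨b, ha⟩, ⟨g₀ ≫ g'⟩), Subtype.ext ?_⟩
  ext y
  rw [hg₀, h.mapSpace_apply, hg]
  have h1 : φ.map g (φ.map g' (φ.map g₀ y)) = φ.map g₀ y := ConcreteCategory.congr_hom hgg _
  simp [h1]

/-- Evaluation at a point of the nonempty `φ V` recovers the base coordinate, and faithfulness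
embeds `Hom(V, W)` in the mapping space; composition with the embedding `k` does the rest. -/
theorem IsTrivialization.isEmbedding_mapSpace [φ.Faithful] (h : E.IsTrivialization U W k)
    (V : F) : IsEmbedding (h.mapSpace V) := by
  have h1 : IsEmbedding fun p : U × C(φ.obj V, φ.obj W) =>
      (ContinuousMap.const (φ.obj V) p.1).prodMk p.2 := by
    refine Function.LeftInverse.isEmbedding (f := fun c : C(φ.obj V, U × φ.obj W) =>
      ((c (Classical.arbitrary _)).1, ContinuousMap.snd.comp c)) (fun _ => rfl) ?_
      ContinuousMap.continuous_prodMk_const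
    exact (continuous_fst.comp (continuous_eval_const _)).prodMk
      (ContinuousMap.continuous_postcomp _)
  have h2 : IsEmbedding fun g : HomSpace φ V W => (φ.map g.hom).hom :=
    ⟨⟨rfl⟩, fun g g' hg => HomSpace.ext (φ.map_injective (TopCat.hom_ext hg))⟩
  have h3 := (ContinuousMap.isEmbedding_postcomp k h.isEmbedding).comp
    (h1.comp (IsEmbedding.id.prodMap h2))
  exact IsEmbedding.of_comp (h.mapSpace V).continuous continuous_subtype_val h3

/-- Globalizes NKC (ii). The projection of `L` is a finite union of compact sets `Z b` inside
trivializing open sets. Over `Z b`, the maps in question come from the compact set `Z b × N_{K,C}`,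
with `C` the compact fibre coordinate image of `L`. The set is closed in the finite union of these;
`K` is nonempty, which locates the base point of each map in the projection of `L`. -/
theorem IsBundle.isCompact_setOf_mapsTo (h : E.IsBundle) (hφ : IsFibreFunctor φ) [T2Space B]
    {V : F} {K : Set (φ.obj V)} (hK : IsProperSet φ V K) {L : Set X} (hL : IsCompact L) :
    IsCompact {s : E.MapSpace V | MapsTo s.1 K L} := by
  have := h.t2Space hφ
  choose U hU hbU W k hk using E.isBundle_iff.1 h
  have hpL := hL.image E.proj.continuous
  obtain ⟨t, ht⟩ := hpL.elim_finite_subcover U hU fun b _ => mem_iUnion.2 ⟨b, hbU b⟩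
  obtain ⟨Z, hZc, hZU, hZ⟩ := hpL.finite_compact_cover t U (fun b _ => hU b) ht
  have hC : ∀ b, IsCompact (Prod.snd '' (k b ⁻¹' (L ∩ E.proj ⁻¹' Z b))) := by
    intro b
    refine ((hk b).isEmbedding.isInducing.isCompact_preimage' ?_ ?_).image continuous_snd
    · exact hL.inter_right ((hZc b).isClosed.preimage E.proj.continuous)
    · rw [(hk b).range_eq]
      exact fun x hx => hZU b hx.2
  have hQ : ∀ b, IsCompact ((hk b).mapSpace V '' (((↑) ⁻¹' Z b) ×ˢ {g : HomSpace φ V (W b) |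
      MapsTo (φ.map g.hom) K (Prod.snd '' (k b ⁻¹' (L ∩ E.proj ⁻¹' Z b)))})) := by
    intro b
    refine (IsCompact.prod ?_ (hK.isCompact_hom _ _ (hC b))).image (ContinuousMap.continuous _)
    exact IsInducing.subtypeVal.isCompact_preimage' (hZc b) (by simpa using hZU b)
  refine (t.isCompact_biUnion fun b _ => hQ b).of_isClosed_subset
    (isClosed_setOf_mapsTo hL.isClosed) fun s hs => ?_
  obtain ⟨y₀, hy₀⟩ := hK.nonempty
  have h1 : E.proj (s.1 y₀) ∈ E.proj '' L := mem_image_of_mem _ (hs hy₀)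
  rw [hZ] at h1
  obtain ⟨b, hbt, hb⟩ := mem_iUnion₂.1 h1
  rw [E.mapSpaceProj_eq] at hb
  obtain ⟨z, hz⟩ := (hk b).exists_mapSpace_eq (hZU b hb)
  refine mem_iUnion₂.2 ⟨b, hbt, z, ⟨?_, fun y hy => ⟨(z.1, φ.map z.2.hom y), ⟨?_, ?_⟩, rfl⟩⟩, hz⟩
  · change (z.1 : B) ∈ Z b
    rwa [← (hk b).mapSpaceProj_mapSpace z, hz]
  · rw [← (hk b).mapSpace_apply, hz]
    exact hs hy
  · rw [← (hk b).mapSpace_apply, hz]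
    change E.proj _ ∈ Z b
    rwa [E.mapSpaceProj_eq]

end Trivialization

/-- An `F`-map lies over a single point: if that point is in `A`, only `U` matters, otherwise only
`L` does. -/
theorem avoids_union {E : Family φ X B} [∀ V : F, Nonempty (φ.obj V)] {V : F} {I : Type*}
    {K : I → Set (φ.obj V)} {S : Set (E.MapSpace V)} {A : Set B} {U L : I → Set X}
    (hUA : ∀ i, U i ⊆ E.proj ⁻¹' A) (hU : E.Avoids K S U) (hLA : ∀ i, L i ∩ E.proj ⁻¹' A ⊆ U i)
    (hL : E.Avoids K S L) : E.Avoids K S fun i => L i ∪ U i := by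
  intro s hs
  by_contra! hcon
  by_cases hsA : E.mapSpaceProj V s ∈ A
  · obtain ⟨i, hi⟩ := hU s hs
    refine hi fun y hy => (hcon i hy).elim (fun h => hLA i ⟨h, ?_⟩) id
    change E.proj _ ∈ A
    rwa [E.mapSpaceProj_eq]
  · obtain ⟨i, hi⟩ := hL s hs
    refine hi fun y hy => (hcon i hy).elim id fun h => absurd (hUA i h) ?_
    change E.proj _ ∉ A
    rwa [E.mapSpaceProj_eq]

/-- Over such a base the total space satisfies the hypotheses of `exists_open_extension`, applied
with goodness meaning avoidance of `S`. -/
theorem IsBundle.exists_extension_of_compactSpace {N : Family φ X B} (h : N.IsBundle)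
    (hφ : IsFibreFunctor φ) [∀ V : F, Nonempty (φ.obj V)] [CompactSpace B] [T2Space B]
    [SecondCountableTopology B] {V : F} {I : Type*} [Finite I] {K : I → Set (φ.obj V)}
    (hK : ∀ i, IsCompact (K i)) {i₀ : I} (hK₀ : IsProperSet φ V (K i₀))
    {S : Set (N.MapSpace V)} (hS : IsClosed S) {A : Set B} (hA : IsClosed A) {U : I → Set X}
    (hU : ∀ i, ∃ O, IsOpen O ∧ U i = O ∩ N.proj ⁻¹' A) (hUS : N.Avoids K S U)
    {C : I → Set X} (hC : ∀ i, IsCompact (C i)) (hCU : ∀ i, C i ∩ N.proj ⁻¹' A ⊆ U i)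
    (hCS : N.Avoids K S C) :
    ∃ W : I → Set X, (∀ i, IsOpen (W i)) ∧ (∀ i, W i ∩ N.proj ⁻¹' A = U i) ∧
      (∀ i, C i ⊆ W i) ∧ N.Avoids K S W := by
  have := h.t2Space hφ
  have := h.locallyCompactSpace hφ
  have := h.secondCountableTopology hφ
  refine exists_open_extension (N.Avoids K S) (fun U U' hUU h' => h'.mono hUU)
    (fun L hL hLS => hLS.exists_isOpen hS (fun L => h.isCompact_setOf_mapsTo hφ hK₀) hL)
    (fun O hO hmono h' => Avoids.iUnion hK hO hmono h') (hA.preimage N.proj.continuous) U hU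
    (fun L hL hLS => avoids_union (fun i => ?_) hUS hL hLS) C hC hCU hCS
  obtain ⟨O, -, hO⟩ := hU i
  rw [hO]
  exact inter_subset_right

end Family

end StratBundle

/-! ### Extension over CW-pairs -/

namespace StratBundle

theorem exists_seq_of_step {α : Type*} {P : ℕ → α → Prop} {R : ℕ → α → α → Prop} {a₀ : α}
    (h₀ : P 0 a₀) (step : ∀ k a, P k a → ∃ a', P (k + 1) a' ∧ R k a a') :
    ∃ f : ℕ → α, f 0 = a₀ ∧ (∀ k, P k (f k)) ∧ ∀ k, R k (f k) (f (k + 1)) := by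
  choose! next hP hR using step
  let f : ℕ → α := fun n => Nat.rec a₀ next n
  have hf : ∀ k, P k (f k) := fun k => by
    induction k with
    | zero => exact h₀
    | succ k ih => exact hP k _ ih
  exact ⟨f, rfl, hf, fun k => hR k _ (hf k)⟩

/-- Successive extensions never alter what was chosen earlier, so the union has the prescribed trace
at each stage. -/
theorem iUnion_inter_eq_of_succ {X : Type*} {Y U : ℕ → Set X} (hY : Monotone Y)
    (hUY : ∀ k, U k ⊆ Y k) (hU : ∀ k, U (k + 1) ∩ Y k = U k) (k : ℕ) :
    (⋃ n, U n) ∩ Y k = U k := by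
  have hmono : Monotone U := monotone_nat_of_le_succ fun n => by
    rw [← hU n]
    exact inter_subset_left
  have h1 : ∀ n, U (k + n) ∩ Y k = U k := by
    intro n
    induction n with
    | zero => exact inter_eq_left.2 (hUY k)
    | succ n ih =>
      rw [← ih, ← add_assoc, ← hU (k + n), inter_assoc,
        inter_eq_right.2 (hY (Nat.le_add_right k n))]
  apply Subset.antisymm
  · rintro x ⟨hx, hxY⟩
    obtain ⟨n, hn⟩ := mem_iUnion.1 hx
    rw [← h1 n]
    exact ⟨hmono (Nat.le_add_left n k) hn, hxY⟩
  · exact fun x hx => ⟨mem_iUnion.2 ⟨k, hx⟩, hUY k hx⟩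

/-- A closed cell is the image of a closed ball under a closed map with compact fibres. -/
theorem CWComplex.secondCountableTopology_closedCell {M : Type u} [TopologicalSpace M] [T2Space M]
    [CWComplex (univ : Set M)] (n : ℕ) (j : RelCWComplex.cell (univ : Set M) n) :
    SecondCountableTopology (RelCWComplex.closedCell n j : Set M) := by
  have hc : IsCompact (Metric.closedBall (0 : Fin n → ℝ) 1) := isCompact_closedBall _ _
  have := isCompact_iff_compactSpace.1 hc
  let f : Metric.closedBall (0 : Fin n → ℝ) 1 → (RelCWComplex.closedCell n j : Set M) :=
    fun x => ⟨RelCWComplex.map n j x, mem_image_of_mem _ x.2⟩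
  have hf : Continuous f := Continuous.subtype_mk
    (continuousOn_iff_continuous_domRestrict.1 (RelCWComplex.continuousOn n j)) _
  refine secondCountableTopology_of_isClosedMap hf hf.isClosedMap ?_ fun y =>
    (isClosed_singleton.preimage hf).isCompact
  rintro ⟨_, x, hx, rfl⟩
  exact ⟨⟨x, hx⟩, rfl⟩

variable {F : Type u} [SmallCategory F]

namespace Family

variable {φ : F ⥤ TopCat.{u}} {X B : Type u} [TopologicalSpace X] [TopologicalSpace B]
  [∀ V : F, Nonempty (φ.obj V)]

theorem mapSpaceProj_mapSpaceMap {X' B' : Type u} [TopologicalSpace X'] [TopologicalSpace B']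
    {E : Family φ X B} {E' : Family φ X' B'} {f : C(X, X')} {fbar : C(B, B')}
    (h : E.IsMap E' f fbar) {V : F} (a : E.MapSpace V) :
    E'.mapSpaceProj V (mapSpaceMap h V a) = fbar (E.mapSpaceProj V a) :=
  h.comm _

theorem exists_mapSpaceMap_restrict_eq (E : Family φ X B) {Y : Set B} {V : F} {a : E.MapSpace V}
    (ha : E.mapSpaceProj V a ∈ Y) : ∃ a', mapSpaceMap (E.isMap_restrict Y) V a' = a := by
  obtain ⟨b, g, hg⟩ := (E.mapSpace_iff a.1).1 a.2
  have hb : E.mapSpaceProj V a = b := by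
    rw [← E.mapSpaceProj_eq a (Classical.arbitrary _), hg, E.proj_incl]
  rw [hb] at ha
  refine ⟨⟨((E.restrict Y).incl ⟨b, ha⟩).comp (φ.map g).hom,
    (mapSpace_iff _ _).2 ⟨⟨b, ha⟩, g, fun _ => rfl⟩⟩, Subtype.ext ?_⟩
  ext y
  exact (hg y).symm

variable {V : F} {I : Type*} {K : I → Set (φ.obj V)}

omit [∀ V : F, Nonempty (φ.obj V)] in
theorem Avoids.preimage {X' B' : Type u} [TopologicalSpace X'] [TopologicalSpace B']
    {E : Family φ X B} {E' : Family φ X' B'} {f : C(X, X')} {fbar : C(B, B')}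
    (h : E.IsMap E' f fbar) {S : Set (E'.MapSpace V)} {U : I → Set X'} (hU : E'.Avoids K S U) :
    E.Avoids K (mapSpaceMap h V ⁻¹' S) fun i => f ⁻¹' U i :=
  fun _ hs => hU _ hs

theorem mapSpaceProj_mem {E : Family φ X B} {i₀ : I} (hK₀ : (K i₀).Nonempty) {s : E.MapSpace V}
    {U : I → Set X} (hs : ∀ i, MapsTo s.1 (K i) (U i)) {Y : Set B}
    (hU : U i₀ ⊆ E.proj ⁻¹' Y) : E.mapSpaceProj V s ∈ Y := by
  obtain ⟨y, hy⟩ := hK₀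
  rw [← E.mapSpaceProj_eq s y]
  exact hU (hs i₀ hy)

theorem mapsTo_of_inter {E : Family φ X B} {s : E.MapSpace V} {K : Set (φ.obj V)} {U U' : Set X}
    {Y : Set B} (hs : MapsTo s.1 K U) (hY : E.mapSpaceProj V s ∈ Y)
    (hU : U ∩ E.proj ⁻¹' Y ⊆ U') : MapsTo s.1 K U' := by
  refine fun y hy => hU ⟨hs hy, ?_⟩
  change E.proj _ ∈ Y
  rwa [E.mapSpaceProj_eq]

variable [Finite I] (hK : ∀ i, IsCompact (K i)) {i₀ : I} (hK₀ : IsProperSet φ V (K i₀))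

include hK hK₀

theorem IsBundle.exists_extension_of_isCompact {N : Family φ X B} (h : N.IsBundle)
    (hφ : IsFibreFunctor φ) [T2Space B] {S : Set (N.MapSpace V)} (hS : IsClosed S)
    {c A : Set B} (hc : IsCompact c) [SecondCountableTopology c] (hA : IsClosed A) (hAc : A ⊆ c)
    {U : I → Set X} (hU : ∀ i, ∃ O, IsOpen O ∧ U i = O ∩ N.proj ⁻¹' A) (hUS : N.Avoids K S U)
    {C : I → Set X} (hC : ∀ i, IsCompact (C i)) (hCU : ∀ i, C i ∩ N.proj ⁻¹' A ⊆ U i)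
    (hCS : N.Avoids K S C) :
    ∃ W : I → Set X, (∀ i, ∃ O, IsOpen O ∧ W i = O ∩ N.proj ⁻¹' c) ∧
      (∀ i, W i ∩ N.proj ⁻¹' A = U i) ∧ (∀ i, C i ∩ N.proj ⁻¹' c ⊆ W i) ∧ N.Avoids K S W := by
  have := isCompact_iff_compactSpace.1 hc
  have hcl : IsClosedEmbedding (valMap (N.proj ⁻¹' c)) :=
    (hc.isClosed.preimage N.proj.continuous).isClosedEmbedding_subtypeVal
  have hU' : ∀ i, ∃ O : Set (N.proj ⁻¹' c : Set X), IsOpen O ∧ valMap (N.proj ⁻¹' c) ⁻¹' U i =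
      O ∩ (N.restrict c).proj ⁻¹' (Subtype.val ⁻¹' A) := fun i => by
    obtain ⟨O, hO, hOU⟩ := hU i
    refine ⟨Subtype.val ⁻¹' O, hO.preimage continuous_subtype_val, ?_⟩
    rw [hOU]
    rfl
  obtain ⟨W, hWo, hWA, hWC, hWS⟩ := (h.restrict c).exists_extension_of_compactSpace hφ hK hK₀
    (hS.preimage (mapSpaceMap (N.isMap_restrict c) V).continuous)
    (hA.preimage continuous_subtype_val) (U := fun i => valMap (N.proj ⁻¹' c) ⁻¹' U i)
    hU' (hUS.preimage (N.isMap_restrict c))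
    (C := fun i => valMap (N.proj ⁻¹' c) ⁻¹' C i) (fun i => hcl.isCompact_preimage (hC i))
    (fun i x hx => hCU i hx) (hCS.preimage (N.isMap_restrict c))
  refine ⟨fun i => valMap (N.proj ⁻¹' c) '' W i, fun i => ?_, fun i => ?_, fun i => ?_, ?_⟩
  · obtain ⟨O, hO, hOW⟩ := isOpen_induced_iff.1 (hWo i)
    refine ⟨O, hO, ?_⟩
    change Subtype.val '' W i = _
    rw [← hOW, Subtype.image_preimage_coe, inter_comm]
  · apply Subset.antisymm
    · rintro _ ⟨⟨x, hx, rfl⟩, hxA⟩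
      have h1 : x ∈ valMap (N.proj ⁻¹' c) ⁻¹' U i := by
        rw [← hWA i]
        exact ⟨hx, hxA⟩
      exact h1
    · intro x hx
      have hxA : x ∈ N.proj ⁻¹' A := by
        obtain ⟨O, -, hO⟩ := hU i
        rw [hO] at hx
        exact hx.2
      have h1 : (⟨x, hAc hxA⟩ : (N.proj ⁻¹' c : Set X)) ∈ valMap (N.proj ⁻¹' c) ⁻¹' U i := hx
      rw [← hWA i] at h1
      exact ⟨⟨_, h1.1, rfl⟩, hxA⟩
  · rintro x ⟨hx, hxc⟩
    exact ⟨⟨x, hxc⟩, hWC i hx, rfl⟩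
  · intro s hs
    by_contra! hcon
    -- A map sending the nonempty `K i₀` into a set over `c` lies over `c`, so it comes from the
    -- restricted bundle.
    have hsc : N.mapSpaceProj V s ∈ c := by
      refine mapSpaceProj_mem hK₀.nonempty hcon ?_
      rintro _ ⟨x, -, rfl⟩
      exact x.2
    obtain ⟨s', rfl⟩ := N.exists_mapSpaceMap_restrict_eq hsc
    obtain ⟨i, hi⟩ := hWS s' hs
    refine hi fun y hy => ?_
    obtain ⟨x, hx, hxy⟩ := hcon i hy
    have h1 : x = s'.1 y := Subtype.ext hxy
    exact h1 ▸ hx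

/-- Induction over the skeleta relative to the subcomplex. Over each new cell the tuple is extended
from the frontier, independently of the other cells. The result still avoids `S` because an `F`-map
lies over one point, which belongs to the old part or to one cell. Openness holds because the total
space over the skeleton has the topology determined by its parts over the cells. -/
theorem IsBundle.exists_extension_of_isCWPair {N : Family φ X B} (h : N.IsBundle)
    (hφ : IsFibreFunctor φ) {A : Set B} (hA : IsCWPair B A) {S : Set (N.MapSpace V)}
    (hS : IsClosed S) {U : I → Set X}
    (hU : ∀ i, ∃ O, IsOpen O ∧ U i = O ∩ N.proj ⁻¹' A) (hUS : N.Avoids K S U)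
    {C : I → Set X} (hC : ∀ i, IsCompact (C i)) (hCU : ∀ i, C i ∩ N.proj ⁻¹' A ⊆ U i)
    (hCS : N.Avoids K S C) :
    ∃ W : I → Set X, (∀ i, IsOpen (W i)) ∧ (∀ i, W i ∩ N.proj ⁻¹' A = U i) ∧
      (∀ i, C i ⊆ W i) ∧ N.Avoids K S W := by
  obtain ⟨_, _, Kc, rfl⟩ := hA
  -- `skeletonLT k` contains the cells of dimension less than `k`, so `M 0` is the subcomplex itself
  -- and passing from `M k` to `M (k + 1)` adds the `k`-cells.
  let M : ℕ → Set B := fun k => Kc ∪ (RelCWComplex.skeletonLT (univ : Set B) k : Set B)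
  have hMc : ∀ k, IsClosed (M k) := fun k =>
    (CWComplex.Subcomplex.closed Kc).union (CWComplex.Subcomplex.closed _)
  have hMs : ∀ k, M (k + 1) = M k ∪ ⋃ j, RelCWComplex.closedCell (C := univ) k j := by
    intro k
    have h1 := CWComplex.skeletonLT_union_iUnion_closedCell_eq_skeletonLT_succ
      (C := (univ : Set B)) k
    change _ ∪ _ = _ ∪ _ ∪ _
    rw [union_assoc]
    congr 1
    rw [Nat.cast_succ]
    exact h1.symm
  have hMmono : Monotone M := monotone_nat_of_le_succ fun k => by
    rw [hMs]
    exact subset_union_left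
  have hM0 : M 0 = Kc := by
    change (Kc : Set B) ∪ _ = _
    rw [Nat.cast_zero, CWComplex.skeletonLT_zero_eq_empty, union_empty]
  have hfr : ∀ k (j : RelCWComplex.cell (univ : Set B) k), RelCWComplex.cellFrontier k j ⊆ M k :=
    fun k j => (RelCWComplex.cellFrontier_subset_skeletonLT k j).trans subset_union_right
  have hcc : ∀ k m (j : RelCWComplex.cell (univ : Set B) m), m < k →
      RelCWComplex.closedCell m j ⊆ M k := fun k m j hm => by
    refine Subset.trans ?_ (hMmono (Nat.succ_le_of_lt hm))
    rw [Nat.succ_eq_add_one, hMs]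
    exact (subset_iUnion _ j).trans subset_union_right
  have hop : ∀ k m (j : RelCWComplex.cell (univ : Set B) m), k ≤ m → j ∉ Kc.I m →
      Disjoint (RelCWComplex.openCell m j) (M k) := by
    intro k m j hkm hj
    refine (CWComplex.Subcomplex.disjoint_openCell_subcomplex_of_not_mem Kc hj).union_right ?_
    rw [← CWComplex.iUnion_openCell_eq_skeletonLT]
    simp only [disjoint_iUnion_right]
    intro n hn j'
    refine RelCWComplex.disjoint_openCell_of_ne fun h0 => ?_
    have h1 : m = n := congrArg Sigma.fst h0
    have h2 : n < k := by exact_mod_cast hn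
    omega
  let P : ℕ → (I → Set X) → Prop := fun k U =>
    (∀ i, ∃ O, IsOpen O ∧ U i = O ∩ N.proj ⁻¹' M k) ∧ N.Avoids K S U ∧
      ∀ i, C i ∩ N.proj ⁻¹' M k ⊆ U i
  have step : ∀ k U, P k U → ∃ U', P (k + 1) U' ∧ ∀ i, U' i ∩ N.proj ⁻¹' M k = U i := by
    clear! U
    rintro k U ⟨hU, hUS, hCU⟩
    have hUM : ∀ i, U i ⊆ N.proj ⁻¹' M k := fun i => by
      obtain ⟨O, -, hO⟩ := hU i
      rw [hO]
      exact inter_subset_right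
    have hcell : ∀ j : RelCWComplex.cell (univ : Set B) k, ∃ W : I → Set X,
        (∀ i, ∃ O, IsOpen O ∧ W i = O ∩ N.proj ⁻¹' RelCWComplex.closedCell k j) ∧
        (∀ i, W i ∩ N.proj ⁻¹' RelCWComplex.cellFrontier k j =
          U i ∩ N.proj ⁻¹' RelCWComplex.cellFrontier k j) ∧
        (∀ i, C i ∩ N.proj ⁻¹' RelCWComplex.closedCell k j ⊆ W i) ∧ N.Avoids K S W := by
      intro j
      have := CWComplex.secondCountableTopology_closedCell k j
      refine h.exists_extension_of_isCompact hK hK₀ hφ hS RelCWComplex.isCompact_closedCell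
        RelCWComplex.isClosed_cellFrontier (RelCWComplex.cellFrontier_subset_closedCell k j)
        (fun i => ?_) (hUS.mono fun i => inter_subset_left) hC (fun i x hx => ?_) hCS
      · obtain ⟨O, hO, hOU⟩ := hU i
        refine ⟨O, hO, ?_⟩
        rw [hOU, inter_assoc, inter_eq_right.2 (preimage_mono (hfr k j))]
      · exact ⟨hCU i ⟨hx.1, hfr k j hx.2⟩, hx.2⟩
    choose W hWo hWf hWC hWS using hcell
    have hWsub : ∀ j i, W j i ⊆ N.proj ⁻¹' RelCWComplex.closedCell k j := fun j i => by
      obtain ⟨O, -, hO⟩ := hWo j i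
      rw [hO]
      exact inter_subset_right
    have hWU : ∀ j i x, x ∈ W j i → N.proj x ∈ RelCWComplex.cellFrontier k j → x ∈ U i :=
      fun j i x hx hxf => ((hWf j i).subset ⟨hx, hxf⟩).1
    have hUW : ∀ j i x, x ∈ U i → N.proj x ∈ RelCWComplex.cellFrontier k j → x ∈ W j i :=
      fun j i x hx hxf => ((hWf j i).symm.subset ⟨hx, hxf⟩).1
    let U' : I → Set X := fun i => U i ∪ ⋃ j ∉ Kc.I k, W j i
    have hopM : ∀ j ∉ Kc.I k, ∀ b ∈ M k, b ∈ RelCWComplex.closedCell k j →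
        b ∈ RelCWComplex.cellFrontier k j := by
      intro j hj b hb hbj
      rw [← RelCWComplex.cellFrontier_union_openCell_eq_closedCell] at hbj
      exact hbj.resolve_right fun h0 => (hop k k j le_rfl hj).le_bot ⟨h0, hb⟩
    have ha : ∀ i, U' i ∩ N.proj ⁻¹' M k = U i := by
      refine fun i => Subset.antisymm ?_ fun x hx => ⟨Or.inl hx, hUM i hx⟩
      rintro x ⟨hx | hx, hxM⟩
      · exact hx
      · obtain ⟨j, hj, hxj⟩ := mem_iUnion₂.1 hx
        exact hWU j i x hxj (hopM j hj _ hxM (hWsub j i hxj))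
    -- Distinct open cells are disjoint, so away from `M k` only the extension `W j` contributes
    -- over the cell `j`; over the frontier `W j` agrees with `U`.
    have hb : ∀ j ∉ Kc.I k, ∀ i,
        U' i ∩ N.proj ⁻¹' RelCWComplex.closedCell k j = W j i := by
      refine fun j hj i => Subset.antisymm ?_ fun x hx =>
        ⟨Or.inr (mem_iUnion₂.2 ⟨j, hj, hx⟩), hWsub j i hx⟩
      rintro x ⟨hx, hxj⟩
      by_cases hxM : N.proj x ∈ M k
      · exact hUW j i x ((ha i).subset ⟨hx, hxM⟩) (hopM j hj _ hxM hxj)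
      · obtain ⟨j', hj', hxj'⟩ := mem_iUnion₂.1 (hx.resolve_left fun h0 => hxM (hUM i h0))
        have h1 : ∀ l : RelCWComplex.cell (univ : Set B) k,
            N.proj x ∈ RelCWComplex.closedCell k l → N.proj x ∈ RelCWComplex.openCell k l := by
          intro l hl
          rw [← RelCWComplex.cellFrontier_union_openCell_eq_closedCell] at hl
          exact hl.resolve_left fun h0 => hxM (hfr k l h0)
        by_cases hjj : j' = j
        · exact hjj ▸ hxj'
        · have h2 : Disjoint (RelCWComplex.openCell k j') (RelCWComplex.openCell k j) :=
            RelCWComplex.disjoint_openCell_of_ne fun h0 => hjj (by simpa using h0)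
          exact (h2.le_bot ⟨h1 j' (hWsub j' i hxj'), h1 j hxj⟩).elim
    have hMs' : ∀ x ∈ M (k + 1), x ∈ M k ∨ ∃ j ∉ Kc.I k, x ∈ RelCWComplex.closedCell k j := by
      intro x hx
      rw [hMs] at hx
      rcases hx with hx | hx
      · exact Or.inl hx
      · obtain ⟨j, hj⟩ := mem_iUnion.1 hx
        by_cases hjK : j ∈ Kc.I k
        · exact Or.inl (Or.inl (CWComplex.Subcomplex.closedCell_subset_of_mem Kc hjK hj))
        · exact Or.inr ⟨j, hjK, hj⟩
    have hcM : ∀ j, RelCWComplex.closedCell k j ⊆ M (k + 1) := fun j =>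
      hcc (k + 1) k j (Nat.lt_succ_self k)
    have hU'M : ∀ i, U' i ⊆ N.proj ⁻¹' M (k + 1) := by
      rintro i x (hx | hx)
      · exact hMmono (Nat.le_succ k) (hUM i hx)
      · obtain ⟨j, -, hxj⟩ := mem_iUnion₂.1 hx
        exact hcM j (hWsub j i hxj)
    refine ⟨U', ⟨fun i => ?_, fun s hs => ?_, fun i x hx => ?_⟩, ha⟩
    · have hcl : IsClosed (N.proj ⁻¹' M (k + 1) \ U' i) := by
        -- Cover `M (k + 1)` by `M k` (index `none`) and the new closed `k`-cells; over each of
        -- these the trace of `U'` is known to be relatively open.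
        refine h.isClosed_of_cover hφ (hMc (k + 1)) (ι := Option {j // j ∉ Kc.I k})
          (C := fun o => o.elim (M k) fun j => RelCWComplex.closedCell k j.1) ?_ ?_ ?_
          sdiff_subset ?_
        · intro x hx
          rcases hMs' x hx with h1 | ⟨j, hj, hxj⟩
          · exact mem_iUnion.2 ⟨none, h1⟩
          · exact mem_iUnion.2 ⟨some ⟨j, hj⟩, hxj⟩
        · intro Z hZM hZ
          have hZk : IsClosed (Z ∩ M k) := hZ none
          -- Cells of the subcomplex or of dimension less than `k` lie in `M k`, the new `k`-cells
          -- belong to the cover, and the remaining higher open cells miss `M (k + 1)`.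
          refine CWComplex.isClosed_of_disjoint_openCell_or_isClosed_inter_closedCell
            (C := univ) (subset_univ _) fun n _ j => ?_
          by_cases hjK : j ∈ Kc.I n
          · right
            have h1 := hZk.inter (RelCWComplex.isClosed_closedCell (n := n) (i := j))
            rwa [inter_assoc, inter_eq_right.2 ((CWComplex.Subcomplex.closedCell_subset_of_mem
              Kc hjK).trans subset_union_left)] at h1
          · rcases lt_trichotomy n k with hn | rfl | hn
            · right
              have h1 := hZk.inter (RelCWComplex.isClosed_closedCell (n := n) (i := j))
              rwa [inter_assoc, inter_eq_right.2 (hcc k n j hn)] at h1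
            · exact Or.inr (hZ (some ⟨j, hjK⟩))
            · exact Or.inl ((hop (k + 1) n j hn hjK).symm.mono_left hZM)
        · rintro (_ | j)
          · exact hMc k
          · exact RelCWComplex.isClosed_closedCell
        · rintro (_ | ⟨j, hj⟩)
          · obtain ⟨O, hO, hOU⟩ := hU i
            convert hO.isClosed_compl.inter ((hMc k).preimage N.proj.continuous) using 1
            ext x
            have h1 := Set.ext_iff.1 ((ha i).trans hOU) x
            have h2 : x ∈ N.proj ⁻¹' M k → x ∈ N.proj ⁻¹' M (k + 1) :=
              fun h0 => hMmono (Nat.le_succ k) h0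
            simp only [mem_inter_iff, mem_compl_iff, Set.mem_sdiff, Option.elim] at h1 h2 ⊢
            tauto
          · obtain ⟨O, hO, hOW⟩ := hWo j i
            convert hO.isClosed_compl.inter ((RelCWComplex.isClosed_closedCell (n := k)
              (i := j)).preimage N.proj.continuous) using 1
            ext x
            have h1 := Set.ext_iff.1 ((hb j hj i).trans hOW) x
            have h2 : x ∈ N.proj ⁻¹' RelCWComplex.closedCell k j → x ∈ N.proj ⁻¹' M (k + 1) :=
              fun h0 => hcM j h0
            simp only [mem_inter_iff, mem_compl_iff, Set.mem_sdiff, Option.elim] at h1 h2 ⊢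
            tauto
      refine ⟨_, hcl.isOpen_compl, ?_⟩
      ext x
      have h1 := @hU'M i x
      simp only [mem_inter_iff, mem_compl_iff, Set.mem_sdiff] at h1 ⊢
      exact ⟨fun h0 => ⟨fun h2 => h2.2 h0, h1 h0⟩, fun h0 => by_contra fun h2 => h0.1 ⟨h0.2, h2⟩⟩
    · by_contra! hcon
      rcases hMs' _ (mapSpaceProj_mem hK₀.nonempty hcon (hU'M i₀)) with h1 | ⟨j, hj, hsj⟩
      · obtain ⟨i, hi⟩ := hUS s hs
        exact hi (mapsTo_of_inter (hcon i) h1 (ha i).subset)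
      · obtain ⟨i, hi⟩ := hWS j s hs
        exact hi (mapsTo_of_inter (hcon i) hsj (hb j hj i).subset)
    · rcases hMs' _ hx.2 with h1 | ⟨j, hj, hxj⟩
      · exact Or.inl (hCU i ⟨hx.1, h1⟩)
      · exact Or.inr (mem_iUnion₂.2 ⟨j, hj, hWC j i ⟨hx.1, hxj⟩⟩)
  obtain ⟨W, hW0, hWP, hWR⟩ := exists_seq_of_step (P := P)
    (R := fun k U U' => ∀ i, U' i ∩ N.proj ⁻¹' M k = U i) (a₀ := U)
    ⟨by rwa [hM0], hUS, by rwa [hM0]⟩ (fun k U hU => step k U hU)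
  have hWM : ∀ k i, (⋃ n, W n i) ∩ N.proj ⁻¹' M k = W k i := fun k i =>
    iUnion_inter_eq_of_succ (Y := fun k => N.proj ⁻¹' M k) (U := fun k => W k i)
      (fun _ _ hkl => preimage_mono (hMmono hkl)) (fun k => by
        obtain ⟨O, -, hO⟩ := (hWP k).1 i
        rw [hO]
        exact inter_subset_right) (fun k => hWR k i) k
  have hMuniv : ∀ x, ∃ k, x ∈ M k := by
    intro x
    have hx : x ∈ (univ : Set B) := mem_univ x
    rw [← CWComplex.union (C := (univ : Set B))] at hx
    obtain ⟨n, j, hj⟩ := mem_iUnion₂.1 hx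
    exact ⟨n + 1, hcc (n + 1) n j (Nat.lt_succ_self n) hj⟩
  refine ⟨fun i => ⋃ k, W k i, fun i => ?_, fun i => ?_, fun i x hx => ?_, fun s hs => ?_⟩
  · rw [← isClosed_compl_iff]
    refine h.isClosed_of_cover hφ isClosed_univ (C := M) (fun x _ => mem_iUnion.2 (hMuniv x))
      (fun Z _ hZ => ?_) hMc (fun _ _ => mem_univ _) fun k => ?_
    · refine CWComplex.isClosed_of_disjoint_openCell_or_isClosed_inter_closedCell
        (C := univ) (subset_univ _) fun n _ j => Or.inr ?_
      have h1 := (hZ (n + 1)).inter (RelCWComplex.isClosed_closedCell (n := n) (i := j))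
      rwa [inter_assoc, inter_eq_right.2 (hcc (n + 1) n j (Nat.lt_succ_self n))] at h1
    · obtain ⟨O, hO, hOW⟩ := (hWP k).1 i
      convert hO.isClosed_compl.inter ((hMc k).preimage N.proj.continuous) using 1
      ext x
      have h1 := Set.ext_iff.1 ((hWM k i).trans hOW) x
      simp only [mem_inter_iff, mem_compl_iff] at h1 ⊢
      tauto
  · have h1 := hWM 0 i
    rw [hW0, hM0] at h1
    exact h1
  · obtain ⟨k, hk⟩ := hMuniv (N.proj x)
    exact mem_iUnion.2 ⟨k, (hWP k).2.2 i ⟨hx, hk⟩⟩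
  · by_contra! hcon
    obtain ⟨k, hk⟩ := hMuniv (N.mapSpaceProj V s)
    obtain ⟨i, hi⟩ := (hWP k).2.1 s hs
    exact hi (mapsTo_of_inter (hcon i) hk (hWM k i).subset)

end Family

end StratBundle

/-! ### Function spaces of stratified bundles -/

namespace StratBundle

theorem IsCWSpace.isCWPair_empty {M : Type u} [TopologicalSpace M] (h : IsCWSpace M) :
    IsCWPair M (∅ : Set M) := by
  obtain ⟨hT, ⟨hc⟩⟩ := h
  exact ⟨hT, hc, RelCWComplex.skeletonLT univ 0, CWComplex.skeletonLT_zero_eq_empty⟩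

theorem StratifiedSpace.mem_skel_cases {B : Type u} [TopologicalSpace B] (S : StratifiedSpace B)
    {n : ℕ} {b : B} (hb : b ∈ S.skel n) :
    b ∈ S.skel 0 ∨ ∃ i < n, b ∈ S.skel (i + 1) ∧ b ∉ S.skel i := by
  induction n with
  | zero => exact Or.inl hb
  | succ n ih =>
    by_cases h : b ∈ S.skel n
    · exact (ih h).imp_right fun ⟨i, hi, h'⟩ => ⟨i, by omega, h'⟩
    · exact Or.inr ⟨n, Nat.lt_succ_self n, hb, h⟩

theorem StratifiedSpace.exists_mem_skel {B : Type u} [TopologicalSpace B] (S : StratifiedSpace B)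
    (b : B) : ∃ n, b ∈ S.skel n :=
  mem_iUnion.1 (S.iUnion_skel ▸ mem_univ b)

/-- The map from `M i` to `B`. -/
def StratifiedSpace.charMap {B : Type u} [TopologicalSpace B] (S : StratifiedSpace B) (i : ℕ) :
    C(S.M i, B) := (valMap _).comp (S.char i)

variable {F : Type u} [SmallCategory F]

namespace Family

variable {φ : F ⥤ TopCat.{u}} {X B X' B' : Type u} [TopologicalSpace X] [TopologicalSpace B]
  [TopologicalSpace X'] [TopologicalSpace B']

theorem IsFibreIso.injective {N : Family φ X' B'} {E : Family φ X B} {f : C(X', X)}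
    {fbar : C(B', B)} {m : B'} (h : N.IsFibreIso E f fbar m) {t t' : X'} (ht : N.proj t = m)
    (ht' : N.proj t' = m) (htt : f t = f t') : t = t' := by
  obtain ⟨g, g', hg, hgg, -⟩ := h
  obtain ⟨y, rfl⟩ : ∃ y, N.incl m y = t := ht ▸ N.exists_incl t
  obtain ⟨y', rfl⟩ : ∃ y, N.incl m y = t' := ht' ▸ N.exists_incl t'
  rw [hg, hg] at htt
  have h1 := E.incl_injective _ htt
  have h2 : ∀ z, φ.map g' (φ.map g z) = z := fun z => ConcreteCategory.congr_hom hgg z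
  rw [← h2 y, h1, h2]

theorem IsFibreIso.surjective {N : Family φ X' B'} {E : Family φ X B} {f : C(X', X)}
    {fbar : C(B', B)} {m : B'} (h : N.IsFibreIso E f fbar m) {x : X} (hx : E.proj x = fbar m) :
    ∃ t, N.proj t = m ∧ f t = x := by
  obtain ⟨g, g', hg, -, hgg⟩ := h
  obtain ⟨y, rfl⟩ : ∃ y, E.incl (fbar m) y = x := hx ▸ E.exists_incl x
  have h2 : ∀ z, φ.map g (φ.map g' z) = z := fun z => ConcreteCategory.congr_hom hgg z
  exact ⟨N.incl m (φ.map g' y), N.proj_incl _ _, by rw [hg, h2]⟩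

theorem isFibreIso_restrict (E : Family φ X B) (U : Set B) (u : U) :
    (E.restrict U).IsFibreIso E (valMap _) (valMap U) u := by
  refine ⟨𝟙 _, 𝟙 _, fun y => ?_, ?_, ?_⟩
  · exact (congrArg (E.incl u) (ConcreteCategory.congr_hom (φ.map_id (E.fib u)) y)).symm
  · exact (φ.map_comp _ _).symm.trans ((congrArg φ.map (Category.id_comp _)).trans (φ.map_id _))
  · exact (φ.map_comp _ _).symm.trans ((congrArg φ.map (Category.id_comp _)).trans (φ.map_id _))

section MapSpace

variable [∀ V : F, Nonempty (φ.obj V)] {V : F}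

theorem exists_hom_eq (E : Family φ X B) (a : E.MapSpace V) :
    ∃ g : V ⟶ E.fib (E.mapSpaceProj V a), ∀ y, a.1 y = E.incl _ (φ.map g y) := by
  obtain ⟨b, g, hg⟩ := (E.mapSpace_iff a.1).1 a.2
  obtain rfl : E.mapSpaceProj V a = b := by
    rw [← E.mapSpaceProj_eq a (Classical.arbitrary _), hg, E.proj_incl]
  exact ⟨g, hg⟩

theorem IsFibreIso.exists_mapSpaceMap_eq {N : Family φ X' B'} {E : Family φ X B} {f : C(X', X)}
    {fbar : C(B', B)} {m : B'} (h : N.IsFibreIso E f fbar m) (hf : N.IsMap E f fbar)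
    {a : E.MapSpace V} (ha : E.mapSpaceProj V a = fbar m) :
    ∃ a' : N.MapSpace V, N.mapSpaceProj V a' = m ∧ mapSpaceMap hf V a' = a := by
  obtain ⟨g, g', hg, -, hgg⟩ := h
  obtain ⟨g₀, hg₀⟩ : ∃ g : V ⟶ E.fib (fbar m), ∀ y, a.1 y = E.incl (fbar m) (φ.map g y) :=
    ha ▸ E.exists_hom_eq a
  refine ⟨⟨(N.incl m).comp (φ.map (g₀ ≫ g')).hom, (mapSpace_iff _ _).2 ⟨m, _, fun _ => rfl⟩⟩,
    N.proj_incl _ _, Subtype.ext ?_⟩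
  ext y
  have h2 : ∀ z, φ.map g (φ.map g' z) = z := fun z => ConcreteCategory.congr_hom hgg z
  change f (N.incl m (φ.map (g₀ ≫ g') y)) = a.1 y
  rw [hg, hg₀]
  simp [h2]

/-- The inverse fibre isomorphism `g'` gives a continuous lift `σ` of the fibre `Hom(V, E_b)` of
`E^V` into `N^V`. Pulling the closed preimage of `s` back along `σ` shows that `s` is closed in this
one fibre. -/
theorem IsFibreIso.exists_isOpen_of_notMem [φ.Faithful] {N : Family φ X' B'} {E : Family φ X B}
    {f : C(X', X)} {fbar : C(B', B)} {m : B'} (h : N.IsFibreIso E f fbar m)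
    (hf : N.IsMap E f fbar) {s : Set (E.MapSpace V)} (hs : IsClosed (mapSpaceMap hf V ⁻¹' s))
    {a : E.MapSpace V} (ha : E.mapSpaceProj V a = fbar m) (has : a ∉ s) :
    ∃ G, IsOpen G ∧ a ∈ G ∧ ∀ a' ∈ G, E.mapSpaceProj V a' = E.mapSpaceProj V a → a' ∉ s := by
  obtain ⟨g, g', hg, -, hgg⟩ := h
  let σ : (E.mapSpaceProj V ⁻¹' {fbar m} : Set (E.MapSpace V)) → N.MapSpace V := fun x =>
    (N.homFibre m V (HomSpace.postcomp φ V g' ((E.homFibre (fbar m) V).symm x))).1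
  have hσ : Continuous σ := by fun_prop
  have hfσ : ∀ x, mapSpaceMap hf V (σ x) = x.1 := by
    intro x
    obtain ⟨g₀, rfl⟩ := (E.homFibre (fbar m) V).surjective x
    refine Subtype.ext ?_
    ext y
    have h2 : ∀ z, φ.map g (φ.map g' z) = z := fun z => ConcreteCategory.congr_hom hgg z
    change f (N.incl m (φ.map (((E.homFibre (fbar m) V).symm
      (E.homFibre (fbar m) V g₀)).hom ≫ g') y)) = E.incl (fbar m) (φ.map g₀.hom y)
    rw [Homeomorph.symm_apply_apply, hg]
    simp [h2]
  obtain ⟨G, hG, hGe⟩ := isOpen_induced_iff.1 (hs.isOpen_compl.preimage hσ)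
  have hmem : ∀ x : (E.mapSpaceProj V ⁻¹' {fbar m} : Set (E.MapSpace V)), x.1 ∈ G ↔ x.1 ∉ s := by
    intro x
    rw [← hfσ x]
    have h3 : x ∈ Subtype.val ⁻¹' G ↔ x ∈ σ ⁻¹' (mapSpaceMap hf V ⁻¹' s)ᶜ := by rw [hGe]
    rw [hfσ x]
    refine h3.trans ?_
    change mapSpaceMap hf V (σ x) ∉ s ↔ _
    rw [hfσ]
  exact ⟨G, hG, (hmem ⟨a, ha⟩).2 has, fun a' ha' hp => (hmem ⟨a', hp.trans ha⟩).1 ha'⟩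

end MapSpace

/-- A bundle `N` over `M i` which is attached to the part of `E` over `skel i` to give the part
over `skel (i + 1)`. -/
structure AttachedBundle (S : StratifiedSpace B) (E : Family φ X B) (i : ℕ) where
  T : TopCat.{u}
  N : Family φ T (S.M i)
  h : C((N.proj ⁻¹' S.A i : Set T), (E.proj ⁻¹' S.skel i : Set X))
  Φ : C(T, (E.proj ⁻¹' S.skel (i + 1) : Set X))
  isBundle : N.IsBundle
  isMap : N.IsMap (E.restrict (S.skel (i + 1))) Φ (S.char i)
  isAttaching : IsAttaching (N.proj ⁻¹' S.A i) h Φ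
    (inclusion (preimage_mono (f := E.proj) (S.skel_subset i)))
  isFibreIso : ∀ m ∉ S.A i, N.IsFibreIso (E.restrict (S.skel (i + 1))) Φ (S.char i) m

theorem IsStratifiedBundle.nonempty_attachedBundle {S : StratifiedSpace B} {E : Family φ X B}
    (hE : E.IsStratifiedBundle S) (i : ℕ) : Nonempty (AttachedBundle S E i) := by
  obtain ⟨T, N, h, Φ, h1, -, h3, h4, h5⟩ := hE.2.2 i
  exact ⟨⟨T, N, h, Φ, h1, h3, h4.isAttaching (Y := TopCat.of _) (Z := TopCat.of _)
    (M := TopCat.of _), h5⟩⟩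

namespace AttachedBundle

variable {S : StratifiedSpace B} {E : Family φ X B} {i : ℕ} (D : AttachedBundle S E i)

/-- The map from the total space of the attached bundle to `X`. -/
def map : C(D.T, X) := (valMap _).comp D.Φ

theorem isMap_map : D.N.IsMap E D.map (S.charMap i) :=
  D.isMap.comp (E.isMap_restrict _)

theorem proj_map (t : D.T) : E.proj (D.map t) = S.char i (D.N.proj t) :=
  D.isMap_map.comm t

theorem isFibreIso_map {m : S.M i} (hm : m ∉ S.A i) : D.N.IsFibreIso E D.map (S.charMap i) m := by
  obtain ⟨g, g', hg, hgg⟩ := D.isFibreIso m hm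
  exact ⟨g, g', fun y => congrArg Subtype.val (hg y), hgg⟩

theorem map_mem_iff (t : D.T) : D.map t ∈ E.proj ⁻¹' S.skel i ↔ t ∈ D.N.proj ⁻¹' S.A i := by
  change E.proj (D.map t) ∈ S.skel i ↔ _
  rw [D.proj_map]
  exact S.char_mem_skel_iff _

theorem map_mem (t : D.T) : D.map t ∈ E.proj ⁻¹' S.skel (i + 1) := (D.Φ t).2

theorem map_injOn {t t' : D.T} (ht : t ∉ D.N.proj ⁻¹' S.A i) (htt : D.map t = D.map t') :
    t = t' := by
  have ht' : t' ∉ D.N.proj ⁻¹' S.A i := by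
    rwa [← D.map_mem_iff, ← htt, D.map_mem_iff]
  exact D.isAttaching.injOn ht ht' (Subtype.ext htt)

theorem exists_map_eq {x : X} (hx : x ∈ E.proj ⁻¹' S.skel (i + 1))
    (hx' : x ∉ E.proj ⁻¹' S.skel i) : ∃ t, t ∉ D.N.proj ⁻¹' S.A i ∧ D.map t = x := by
  rcases D.isAttaching.surj ⟨x, hx⟩ with ⟨y, hy⟩ | ⟨t, ht, h⟩
  · have h1 : (y : X) = x := congrArg Subtype.val hy
    exact absurd (h1 ▸ y.2) hx'
  · exact ⟨t, ht, congrArg Subtype.val h⟩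

variable [∀ V : F, Nonempty (φ.obj V)] {V : F}

theorem exists_mapSpaceMap_eq {a : E.MapSpace V} (ha : E.mapSpaceProj V a ∈ S.skel (i + 1))
    (ha' : E.mapSpaceProj V a ∉ S.skel i) :
    ∃ a' : D.N.MapSpace V, D.N.mapSpaceProj V a' ∉ S.A i ∧ mapSpaceMap D.isMap_map V a' = a := by
  obtain ⟨m, hm, hb⟩ := S.exists_char_eq ha ha'
  obtain ⟨a', rfl, h⟩ := (D.isFibreIso_map hm).exists_mapSpaceMap_eq D.isMap_map hb.symm
  exact ⟨a', hm, h⟩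

end AttachedBundle

/-- The inductive hypothesis in the construction of neighbourhoods: `U` is a tuple of relatively
open subsets of the part over `skel k` which contain the part of the compact sets `C` over `skel k`
and avoid `s`. -/
structure IsPartialNhd (S : StratifiedSpace B) (E : Family φ X B) {V : F} {I : Type*}
    (K : I → Set (φ.obj V)) (s : Set (E.MapSpace V)) (C : I → Set X) (k : ℕ) (U : I → Set X) :
    Prop where
  exists_isOpen : ∀ i, ∃ O, IsOpen O ∧ U i = O ∩ E.proj ⁻¹' S.skel k
  avoids : E.Avoids K s U
  subset : ∀ i, C i ∩ E.proj ⁻¹' S.skel k ⊆ U i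

theorem IsPartialNhd.subset_preimage {S : StratifiedSpace B} {E : Family φ X B} {V : F}
    {I : Type*} {K : I → Set (φ.obj V)} {s : Set (E.MapSpace V)} {C : I → Set X} {k : ℕ}
    {U : I → Set X} (h : IsPartialNhd S E K s C k U) (i : I) : U i ⊆ E.proj ⁻¹' S.skel k := by
  obtain ⟨O, -, hO⟩ := h.exists_isOpen i
  rw [hO]
  exact inter_subset_right

/-! ### Extending avoiding neighbourhoods over the strata. -/

section Extension

variable [∀ V : F, Nonempty (φ.obj V)] {V : F} {I : Type*} [Finite I] {K : I → Set (φ.obj V)}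
  {S : StratifiedSpace B} {E : Family φ X B} {s : Set (E.MapSpace V)} {a : E.MapSpace V}

/-- The extension over CW-pairs, applied to `skel 0` with the empty subcomplex. -/
theorem exists_isPartialNhd_zero (hφ : IsFibreFunctor φ) (hK : ∀ i, IsCompact (K i)) {i₀ : I}
    (hK₀ : IsProperSet φ V (K i₀)) (hE : (E.restrict (S.skel 0)).IsBundle)
    (hs : IsClosed (mapSpaceMap (E.isMap_restrict (S.skel 0)) V ⁻¹' s))
    (has : E.Avoids K s fun i => a.1 '' K i) :
    ∃ U, IsPartialNhd S E K s (fun i => a.1 '' K i) 0 U := by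
  have hcl : IsClosedEmbedding (valMap (E.proj ⁻¹' S.skel 0)) :=
    ((S.isClosed_skel 0).preimage E.proj.continuous).isClosedEmbedding_subtypeVal
  obtain ⟨W, hWo, -, hWC, hWS⟩ := hE.exists_extension_of_isCWPair hK hK₀ hφ
    S.cw_zero.isCWPair_empty hs (U := fun _ => ∅) (fun i => ⟨∅, isOpen_empty, by simp⟩)
    (fun s' _ => ⟨i₀, fun h => by
      obtain ⟨y, hy⟩ := hK₀.nonempty
      exact h hy⟩)
    (C := fun i => valMap (E.proj ⁻¹' S.skel 0) ⁻¹' (a.1 '' K i))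
    (fun i => hcl.isCompact_preimage ((hK i).image a.1.continuous)) (fun i => by simp)
    (has.preimage (E.isMap_restrict (S.skel 0)))
  refine ⟨fun i => valMap (E.proj ⁻¹' S.skel 0) '' W i, fun i => ?_, fun s' hs' => ?_,
    fun i x hx => ?_⟩
  · obtain ⟨O, hO, hOW⟩ := isOpen_induced_iff.1 (hWo i)
    refine ⟨O, hO, ?_⟩
    change Subtype.val '' W i = _
    rw [← hOW, Subtype.image_preimage_coe, inter_comm]
  · by_contra! hcon
    have hsc : E.mapSpaceProj V s' ∈ S.skel 0 := by
      refine mapSpaceProj_mem hK₀.nonempty hcon ?_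
      rintro _ ⟨x, -, rfl⟩
      exact x.2
    obtain ⟨s'', rfl⟩ := E.exists_mapSpaceMap_restrict_eq hsc
    obtain ⟨i, hi⟩ := hWS s'' hs'
    refine hi fun y hy => ?_
    obtain ⟨x, hx, hxy⟩ := hcon i hy
    have h1 : x = s''.1 y := Subtype.ext hxy
    exact h1 ▸ hx
  · exact ⟨⟨x, hx.2⟩, hWC i hx.1, rfl⟩

/-- Pull `U` back to a relatively open tuple over `A k`, extend it to an open tuple `W` over `M k`,
and glue `U` with the image of `W`. Maps over `skel k` are handled by `U`, those over the new
stratum lift to the attached bundle and are handled by `W`. -/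
theorem IsPartialNhd.exists_succ (hφ : IsFibreFunctor φ) (hK : ∀ i, IsCompact (K i)) {i₀ : I}
    (hK₀ : IsProperSet φ V (K i₀)) {k : ℕ} (D : AttachedBundle S E k)
    (hs : IsClosed (mapSpaceMap D.isMap_map V ⁻¹' s)) (has : E.Avoids K s fun i => a.1 '' K i)
    {U : I → Set X} (hU : IsPartialNhd S E K s (fun i => a.1 '' K i) k U) :
    ∃ U', IsPartialNhd S E K s (fun i => a.1 '' K i) (k + 1) U' ∧
      ∀ i, U' i ∩ E.proj ⁻¹' S.skel k = U i := by
  have hUA : ∀ i, D.map ⁻¹' U i ⊆ D.N.proj ⁻¹' S.A k := fun i t ht =>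
    (D.map_mem_iff t).1 (hU.subset_preimage i ht)
  -- The map `a` lies over one point only. If that point is in the new stratum, the compact sets to
  -- be contained are those of the lift of `a`; otherwise nothing new has to be contained and `C` is
  -- empty.
  obtain ⟨C, hC, hCA, hCS, hCa⟩ : ∃ C : I → Set D.T, (∀ i, IsCompact (C i)) ∧
      (∀ i, C i ∩ D.N.proj ⁻¹' S.A k ⊆ D.map ⁻¹' U i) ∧
      D.N.Avoids K (mapSpaceMap D.isMap_map V ⁻¹' s) C ∧
      ∀ i, ∀ t, t ∉ D.N.proj ⁻¹' S.A k → D.map t ∈ a.1 '' K i → t ∈ C i := by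
    by_cases ha : E.mapSpaceProj V a ∈ S.skel (k + 1) ∧ E.mapSpaceProj V a ∉ S.skel k
    · obtain ⟨a', ha', rfl⟩ := D.exists_mapSpaceMap_eq ha.1 ha.2
      refine ⟨fun i => a'.1 '' K i, fun i => (hK i).image a'.1.continuous, fun i => ?_, ?_, ?_⟩
      · rintro _ ⟨⟨y, -, rfl⟩, hy⟩
        refine absurd ?_ ha'
        rw [← D.N.mapSpaceProj_eq a' y]
        exact hy
      · refine (has.preimage D.isMap_map).mono fun i => ?_
        rintro _ ⟨y, hy, rfl⟩
        exact ⟨y, hy, rfl⟩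
      · rintro i t ht ⟨y, hy, hyt⟩
        exact ⟨y, hy, (D.map_injOn ht hyt.symm).symm⟩
    · refine ⟨fun _ => ∅, fun _ => isCompact_empty, fun i => by simp, fun s' _ => ⟨i₀, fun h => ?_⟩,
        fun i t ht h => ha ?_⟩
      · obtain ⟨y, hy⟩ := hK₀.nonempty
        exact h hy
      · obtain ⟨y, -, hy⟩ := h
        rw [← E.mapSpaceProj_eq a y, hy]
        exact ⟨D.map_mem t, fun h => ht ((D.map_mem_iff t).1 h)⟩
  obtain ⟨W, hWo, hWA, hWC, hWS⟩ := D.isBundle.exists_extension_of_isCWPair hK hK₀ hφ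
    (S.cwPair k) hs (U := fun i => D.map ⁻¹' U i) (fun i => by
      obtain ⟨O, hO, hOU⟩ := hU.exists_isOpen i
      refine ⟨_, hO.preimage D.map.continuous, ?_⟩
      rw [hOU]
      ext t
      exact and_congr_right fun _ => D.map_mem_iff t) (hU.avoids.preimage D.isMap_map) hC hCA hCS
  -- No points are added to `W` by gluing: the attaching map is injective off `A k`, and over `A k`
  -- both tuples are the pullback of `U`.
  have hmapU' : ∀ i, D.map ⁻¹' (U i ∪ D.map '' W i) = W i := by
    intro i
    apply Subset.antisymm
    · rintro t (ht | ⟨w, hw, hwt⟩)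
      · exact ((hWA i).symm.subset ht).1
      · by_cases hwA : w ∈ D.N.proj ⁻¹' S.A k
        · have h1 : D.map w ∈ U i := (hWA i).subset ⟨hw, hwA⟩
          rw [hwt] at h1
          exact ((hWA i).symm.subset h1).1
        · exact D.map_injOn hwA hwt ▸ hw
    · exact fun t ht => Or.inr ⟨t, ht, rfl⟩
  have hU'k : ∀ i, (U i ∪ D.map '' W i) ∩ E.proj ⁻¹' S.skel k = U i := by
    intro i
    apply Subset.antisymm
    · rintro x ⟨hx | ⟨w, hw, rfl⟩, hxk⟩
      · exact hx
      · exact (hWA i).subset ⟨hw, (D.map_mem_iff w).1 hxk⟩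
    · exact fun x hx => ⟨Or.inl hx, hU.subset_preimage i hx⟩
  have hU'sub : ∀ i, U i ∪ D.map '' W i ⊆ E.proj ⁻¹' S.skel (k + 1) := by
    rintro i x (hx | ⟨w, -, rfl⟩)
    · exact S.skel_subset k (hU.subset_preimage i hx)
    · exact D.map_mem w
  refine ⟨fun i => U i ∪ D.map '' W i, ⟨fun i => ?_, fun s' hs' => ?_, fun i x hx => ?_⟩, hU'k⟩
  · have h1 : IsClosed ((↑) ⁻¹' (U i ∪ D.map '' W i)ᶜ :
        Set (E.proj ⁻¹' S.skel (k + 1) : Set X)) := by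
      refine D.isAttaching.isClosed _ ?_ ?_
      · have h2 := (hWo i).isClosed_compl
        rwa [← hmapU' i] at h2
      · obtain ⟨O, hO, hOU⟩ := hU.exists_isOpen i
        convert hO.isClosed_compl.preimage continuous_subtype_val using 1
        ext x
        refine not_congr ?_
        have h2 := Set.ext_iff.1 ((hU'k i).trans hOU) x.1
        exact ⟨fun h3 => (h2.1 ⟨h3, x.2⟩).1, fun h3 => (h2.2 ⟨h3, x.2⟩).1⟩
    obtain ⟨O, hO, hOe⟩ := isOpen_induced_iff.1 h1.isOpen_compl
    refine ⟨O, hO, ?_⟩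
    ext x
    constructor
    · intro hx
      have h3 : (⟨x, hU'sub i hx⟩ : (E.proj ⁻¹' S.skel (k + 1) : Set X)) ∈ Subtype.val ⁻¹' O := by
        rw [hOe]
        exact fun h4 => h4 hx
      exact ⟨h3, hU'sub i hx⟩
    · rintro ⟨hx, hxk⟩
      have h3 : (⟨x, hxk⟩ : (E.proj ⁻¹' S.skel (k + 1) : Set X)) ∈ Subtype.val ⁻¹' O := hx
      rw [hOe] at h3
      exact not_not.1 h3
  · by_contra! hcon
    have h1 := mapSpaceProj_mem hK₀.nonempty hcon (hU'sub i₀)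
    by_cases h2 : E.mapSpaceProj V s' ∈ S.skel k
    · obtain ⟨i, hi⟩ := hU.avoids s' hs'
      exact hi (mapsTo_of_inter (hcon i) h2 (hU'k i).subset)
    · obtain ⟨s'', -, rfl⟩ := D.exists_mapSpaceMap_eq h1 h2
      obtain ⟨i, hi⟩ := hWS s'' hs'
      exact hi fun y hy => (hmapU' i).subset (hcon i hy)
  · by_cases h2 : x ∈ E.proj ⁻¹' S.skel k
    · exact Or.inl (hU.subset i ⟨hx.1, h2⟩)
    · obtain ⟨t, ht, rfl⟩ := D.exists_map_eq hx.2 h2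
      exact Or.inr ⟨t, hWC i (hCa i t ht hx.1), rfl⟩

/-- The finite-stage version uses only the pieces below `n`, which is all that is known about `s`
when a push-out is verified. -/
theorem exists_isPartialNhd (hφ : IsFibreFunctor φ) (hK : ∀ i, IsCompact (K i)) {i₀ : I}
    (hK₀ : IsProperSet φ V (K i₀)) (hE : (E.restrict (S.skel 0)).IsBundle)
    (D : ∀ k, AttachedBundle S E k) {n : ℕ}
    (hs₀ : IsClosed (mapSpaceMap (E.isMap_restrict (S.skel 0)) V ⁻¹' s))
    (hs : ∀ k < n, IsClosed (mapSpaceMap (D k).isMap_map V ⁻¹' s))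
    (has : E.Avoids K s fun i => a.1 '' K i) :
    ∃ U, IsPartialNhd S E K s (fun i => a.1 '' K i) n U := by
  induction n with
  | zero => exact exists_isPartialNhd_zero hφ hK hK₀ hE hs₀ has
  | succ n ih =>
    obtain ⟨U, hU⟩ := ih fun k hk => hs k (hk.trans (Nat.lt_succ_self n))
    obtain ⟨U', hU', -⟩ := hU.exists_succ hφ hK hK₀ (D n) (hs n (Nat.lt_succ_self n)) has
    exact ⟨U', hU'⟩

theorem exists_isOpen_avoids (hφ : IsFibreFunctor φ) (hK : ∀ i, IsCompact (K i)) {i₀ : I}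
    (hK₀ : IsProperSet φ V (K i₀)) (hE : E.IsStratifiedBundle S)
    (D : ∀ k, AttachedBundle S E k)
    (hs₀ : IsClosed (mapSpaceMap (E.isMap_restrict (S.skel 0)) V ⁻¹' s))
    (hs : ∀ k, IsClosed (mapSpaceMap (D k).isMap_map V ⁻¹' s))
    (has : E.Avoids K s fun i => a.1 '' K i) :
    ∃ U : I → Set X, (∀ i, IsOpen (U i)) ∧ (∀ i, a.1 '' K i ⊆ U i) ∧ E.Avoids K s U := by
  obtain ⟨U₀, hU₀⟩ := exists_isPartialNhd_zero hφ hK hK₀ hE.1 hs₀ has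
  obtain ⟨U, -, hU, hUs⟩ := exists_seq_of_step
    (P := fun k U => IsPartialNhd S E K s (fun i => a.1 '' K i) k U)
    (R := fun k U U' => ∀ i, U' i ∩ E.proj ⁻¹' S.skel k = U i) hU₀
    fun k U hU => hU.exists_succ hφ hK hK₀ (D k) (hs k) has
  have hUk : ∀ k i, (⋃ n, U n i) ∩ E.proj ⁻¹' S.skel k = U k i := fun k i =>
    iUnion_inter_eq_of_succ (Y := fun k => E.proj ⁻¹' S.skel k) (U := fun k => U k i)
      (fun _ _ hkl => preimage_mono (S.skel_mono hkl)) (fun k => (hU k).subset_preimage i)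
      (fun k => hUs k i) k
  refine ⟨fun i => ⋃ k, U k i, fun i => ?_, ?_, fun s' hs' => ?_⟩
  · refine hE.2.1.isOpen_iff.2 ?_
    rintro _ ⟨k, rfl⟩
    obtain ⟨O, hO, hOU⟩ := (hU k).exists_isOpen i
    convert hO.preimage continuous_subtype_val using 1
    ext x
    have h1 := Set.ext_iff.1 ((hUk k i).trans hOU) x.1
    exact ⟨fun h3 => (h1.1 ⟨h3, x.2⟩).1, fun h3 => (h1.2 ⟨h3, x.2⟩).1⟩
  · intro i x hx
    obtain ⟨k, hk⟩ := S.exists_mem_skel (E.proj x)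
    exact mem_iUnion.2 ⟨k, (hU k).subset i ⟨hx, hk⟩⟩
  · by_contra! hcon
    obtain ⟨k, hk⟩ := S.exists_mem_skel (E.mapSpaceProj V s')
    obtain ⟨i, hi⟩ := (hU k).avoids s' hs'
    exact hi (mapsTo_of_inter (hcon i) hk (hUk k i).subset)

end Extension

end Family

end StratBundle

/-! ### Consequences of the NKC property -/

namespace StratBundle

variable {F : Type u} [SmallCategory F] {φ : F ⥤ TopCat.{u}}

/-- If every `K` were empty, all sets `N_{K,U}` would be the whole space and every function space
indiscrete. The product family over a discrete two-point base contradicts this through its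
projection. -/
theorem IsGenerating.exists_nonempty [∀ V : F, Nonempty (φ.obj V)] {V : F}
    {𝒦 : Set (Set (φ.obj V))} (h : IsGenerating φ V 𝒦) : ∃ K ∈ 𝒦, K.Nonempty := by
  by_contra! hcon
  let E := productFamily φ V (ULift.{u} Bool)
  have htop : (inferInstance : TopologicalSpace (E.MapSpace V)) = ⊤ := by
    rw [h.2 _ _ E]
    refine le_antisymm le_top (le_generateFrom ?_)
    rintro _ ⟨K, hK, U, -, rfl⟩
    rw [hcon K hK]
    simp [mapsTo_empty]
  let a : ULift.{u} Bool → E.MapSpace V := fun b =>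
    ⟨E.incl b, (E.mapSpace_iff _).2 ⟨b, 𝟙 V, fun y =>
      (congrArg (E.incl b) (ConcreteCategory.congr_hom (φ.map_id V) y)).symm⟩⟩
  have ha : ∀ b, E.mapSpaceProj V (a b) = b := fun b => rfl
  have hopen : IsOpen (E.mapSpaceProj V ⁻¹' {⟨true⟩}) :=
    (isOpen_discrete _).preimage (ContinuousMap.continuous _)
  have hopen' : IsOpen[⊤] (E.mapSpaceProj V ⁻¹' {⟨true⟩}) := htop ▸ hopen
  rw [TopologicalSpace.isOpen_top_iff] at hopen'
  rcases hopen' with h0 | h0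
  · have h1 : a ⟨true⟩ ∈ E.mapSpaceProj V ⁻¹' {⟨true⟩} := ha ⟨true⟩
    rw [h0] at h1
    exact h1
  · have h1 : a ⟨false⟩ ∈ E.mapSpaceProj V ⁻¹' {⟨true⟩} := h0 ▸ mem_univ _
    have h2 : (⟨false⟩ : ULift.{u} Bool) = ⟨true⟩ := h1
    simp at h2

theorem IsNKC.exists_isProperSet [∀ V : F, Nonempty (φ.obj V)] (h : IsNKC φ) (V : F) :
    ∃ K, IsProperSet φ V K := by
  obtain ⟨𝒦, h𝒦, hcpt⟩ := h V
  obtain ⟨K, hK, hne⟩ := h𝒦.exists_nonempty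
  exact ⟨K, hne, h𝒦.1 K hK, hcpt K hK⟩

/-- For a compact neighbourhood `C` of the image of `K` under a morphism, `N_{K,C}` is a compact
neighbourhood of that morphism. The other two properties are inherited from the mapping space by
faithfulness. -/
theorem IsNKC.isFibreFunctor_homFunctor [φ.Faithful] [∀ V : F, Nonempty (φ.obj V)]
    (h : IsNKC φ) (hφ : IsFibreFunctor φ) (V : F) : IsFibreFunctor (homFunctor φ V) := by
  have hinj : ∀ W, Function.Injective
      (fun g : HomSpace φ V W => ((φ.map g.hom).hom : C(φ.obj V, φ.obj W))) :=
    fun W g g' hg => HomSpace.ext (φ.map_injective (TopCat.hom_ext hg))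
  have ht2 : ∀ W, T2Space (HomSpace φ V W) := fun W => by
    have := hφ.t2 W
    exact T2Space.of_injective_continuous (hinj W) (continuous_hom_map φ V W)
  refine ⟨fun W => ?_, fun W => ?_, ht2⟩
  · have := hφ.locallyCompact W
    have := ht2 W
    obtain ⟨K, hK⟩ := h.exists_isProperSet V
    have : WeaklyLocallyCompactSpace (HomSpace φ V W) := by
      refine ⟨fun g => ?_⟩
      obtain ⟨C, hC, hgC⟩ := exists_compact_superset (hK.isCompact.image (φ.map g.hom).hom.continuous)
      refine ⟨_, hK.isCompact_hom W C hC, ?_⟩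
      refine Filter.mem_of_superset (((ContinuousMap.isOpen_setOfPred_mapsTo hK.isCompact
        (isOpen_interior (s := C))).preimage (continuous_hom_map φ V W)).mem_nhds ?_) ?_
      · exact fun y hy => hgC (mem_image_of_mem _ hy)
      · exact fun g' hg' y hy => interior_subset (hg' hy)
    exact inferInstanceAs (LocallyCompactSpace (HomSpace φ V W))
  · have := hφ.locallyCompact V
    have := hφ.secondCountable V
    have := hφ.secondCountable W
    exact TopologicalSpace.secondCountableTopology_induced (HomSpace φ V W) C(φ.obj V, φ.obj W) _

namespace Family

variable {X B : Type u} [TopologicalSpace X] [TopologicalSpace B] [∀ V : F, Nonempty (φ.obj V)]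

/-- Shrink `G` to a finite intersection of sub-basic sets `N_{K,U}` containing `a`. A map sending
each of these `K` into `a(K) ⊆ U` lies in `G`, and the added nonempty `K₀` forces it into the fibre
of `a`, where `G` misses `s`. -/
theorem exists_avoids_of_isNKC (h : IsNKC φ) {E : Family φ X B} {V : F} {s : Set (E.MapSpace V)}
    {a : E.MapSpace V} {G : Set (E.MapSpace V)} (hG : IsOpen G) (ha : a ∈ G)
    (hGs : ∀ a' ∈ G, E.mapSpaceProj V a' = E.mapSpaceProj V a → a' ∉ s) :
    ∃ (I : Type u) (_ : Finite I) (K : I → Set (φ.obj V)) (i₀ : I), (∀ i, IsCompact (K i)) ∧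
      IsProperSet φ V (K i₀) ∧ E.Avoids K s fun i => a.1 '' K i := by
  obtain ⟨𝒦, h𝒦, hcpt⟩ := h V
  obtain ⟨K₀, hK₀, hne⟩ := h𝒦.exists_nonempty
  obtain ⟨_, ⟨f, ⟨hf, hfs⟩, rfl⟩, haf, hfG⟩ :=
    (TopologicalSpace.isTopologicalBasis_of_subbasis (h𝒦.2 X B E)).exists_subset_of_mem_open ha hG
  choose K hK U hU hN using fun N : f => hfs N.2
  have := hf.to_subtype
  -- The index `none` carries `K₀`, which also serves as the proper set needed for later compactness
  -- arguments, even if `f` is empty.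
  refine ⟨Option f, inferInstance, fun o => o.elim K₀ K, none, ?_, ⟨hne, h𝒦.1 K₀ hK₀, hcpt K₀ hK₀⟩,
    fun a' ha' => ?_⟩
  · rintro (_ | N)
    · exact h𝒦.1 K₀ hK₀
    · exact h𝒦.1 _ (hK N)
  · by_contra! hcon
    have hp : E.mapSpaceProj V a' = E.mapSpaceProj V a := by
      obtain ⟨y, hy⟩ := hne
      obtain ⟨y', -, hy'⟩ := hcon none hy
      rw [← E.mapSpaceProj_eq a' y, ← hy', E.mapSpaceProj_eq]
    refine hGs a' (hfG fun N hN' => ?_) hp ha'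
    have h1 : a ∈ N := haf N hN'
    have h2 := hN ⟨N, hN'⟩
    dsimp only at h2
    rw [h2] at h1 ⊢
    intro y hy
    obtain ⟨y', hy', he⟩ := hcon (some ⟨N, hN'⟩) hy
    rw [← he]
    exact h1 hy'

variable [φ.Faithful] {S : StratifiedSpace B} {E : Family φ X B} {V : F} {s : Set (E.MapSpace V)}

theorem exists_isOpen_fibre (D : ∀ k, AttachedBundle S E k) {n : ℕ}
    (hs₀ : IsClosed (mapSpaceMap (E.isMap_restrict (S.skel 0)) V ⁻¹' s))
    (hs : ∀ k < n, IsClosed (mapSpaceMap (D k).isMap_map V ⁻¹' s)) {a : E.MapSpace V}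
    (han : E.mapSpaceProj V a ∈ S.skel n) (ha : a ∉ s) :
    ∃ G, IsOpen G ∧ a ∈ G ∧ ∀ a' ∈ G, E.mapSpaceProj V a' = E.mapSpaceProj V a → a' ∉ s := by
  rcases S.mem_skel_cases han with h0 | ⟨i, hi, h1, h2⟩
  · exact (E.isFibreIso_restrict (S.skel 0) ⟨_, h0⟩).exists_isOpen_of_notMem
      (E.isMap_restrict _) hs₀ rfl ha
  · obtain ⟨m, hm, hma⟩ := S.exists_char_eq h1 h2
    exact ((D i).isFibreIso_map hm).exists_isOpen_of_notMem (D i).isMap_map (hs i hi) hma.symm ha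

/-- The core of part 1: near `a ∉ s`, the open tuple around the sets `a(K i)` that avoids `s`
defines a compact-open neighbourhood missing `s`. This is what makes the function spaces the colimit
of their parts over the strata. -/
theorem IsStratifiedBundle.isClosed_mapSpace (hE : E.IsStratifiedBundle S) (h : IsNKC φ)
    (hφ : IsFibreFunctor φ) (D : ∀ k, AttachedBundle S E k)
    (hs₀ : IsClosed (mapSpaceMap (E.isMap_restrict (S.skel 0)) V ⁻¹' s))
    (hs : ∀ k, IsClosed (mapSpaceMap (D k).isMap_map V ⁻¹' s)) : IsClosed s := by
  rw [← isOpen_compl_iff, isOpen_iff_mem_nhds]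
  intro a ha
  obtain ⟨n, hn⟩ := S.exists_mem_skel (E.mapSpaceProj V a)
  obtain ⟨G, hG, haG, hGs⟩ := exists_isOpen_fibre D hs₀ (fun k _ => hs k) hn ha
  obtain ⟨I, _, K, i₀, hK, hK₀, has⟩ := exists_avoids_of_isNKC h hG haG hGs
  obtain ⟨U, hU, haU, hUs⟩ := exists_isOpen_avoids hφ hK hK₀ hE D hs₀ hs has
  refine Filter.mem_of_superset ((isOpen_iInter_of_finite fun i =>
    isOpen_setOf_mapsTo (E := E) (hK i) (hU i)).mem_nhds (mem_iInter.2 fun i y hy =>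
      haU i (mem_image_of_mem _ hy))) fun a' ha' ha's => ?_
  obtain ⟨i, hi⟩ := hUs a' ha's
  exact hi (mem_iInter.1 ha' i)

/-- The same argument stopped at stage `n`, for a relatively open tuple over `skel n`; it supplies
the topology of the push-outs. -/
theorem IsStratifiedBundle.isClosed_mapSpace_skel (hE : E.IsStratifiedBundle S) (h : IsNKC φ)
    (hφ : IsFibreFunctor φ) (D : ∀ k, AttachedBundle S E k) {n : ℕ}
    (hs₀ : IsClosed (mapSpaceMap (E.isMap_restrict (S.skel 0)) V ⁻¹' s))
    (hs : ∀ k < n, IsClosed (mapSpaceMap (D k).isMap_map V ⁻¹' s)) :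
    IsClosed ((↑) ⁻¹' s : Set (E.mapSpaceProj V ⁻¹' S.skel n : Set (E.MapSpace V))) := by
  rw [← isOpen_compl_iff, isOpen_iff_mem_nhds]
  intro a ha
  obtain ⟨G, hG, haG, hGs⟩ := exists_isOpen_fibre D hs₀ hs a.2 ha
  obtain ⟨I, _, K, i₀, hK, hK₀, has⟩ := exists_avoids_of_isNKC h hG haG hGs
  obtain ⟨U, hU⟩ := exists_isPartialNhd hφ hK hK₀ hE.1 D hs₀ hs has
  choose O hO hOU using hU.exists_isOpen
  have h1 : IsOpen (⋂ i, {a : E.MapSpace V | MapsTo a.1 (K i) (O i)}) :=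
    isOpen_iInter_of_finite fun i => isOpen_setOf_mapsTo (E := E) (hK i) (hO i)
  have hskel : ∀ (a : (E.mapSpaceProj V ⁻¹' S.skel n : Set (E.MapSpace V))) y,
      a.1.1 y ∈ E.proj ⁻¹' S.skel n := fun a y => by
    change E.proj _ ∈ S.skel n
    rw [E.mapSpaceProj_eq]
    exact a.2
  refine Filter.mem_of_superset ((h1.preimage continuous_subtype_val).mem_nhds
    (mem_iInter.2 fun i y hy => ?_)) fun a' ha' ha's => ?_
  · have h2 := hU.subset i ⟨mem_image_of_mem _ hy, hskel a y⟩
    rw [hOU] at h2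
    exact h2.1
  · obtain ⟨i, hi⟩ := hU.avoids a' ha's
    refine hi fun y hy => ?_
    rw [hOU]
    exact ⟨mem_iInter.1 ha' i hy, hskel a' y⟩

end Family

end StratBundle

/-! ### Attaching families and diagrams, trivializations of diagrams -/

namespace StratBundle

theorem StratifiedSpace.char_eq_attach {B : Type u} [TopologicalSpace B] (S : StratifiedSpace B)
    (i : ℕ) (a : S.A i) : (S.char i a : B) = S.attach i a :=
  congrArg Subtype.val ((S.isAttaching i).comm a)

/-- The base is already attached and `Φ` is bijective on fibres off `A i`, so every set-theoretic
condition is inherited; only the topology has to be supplied. -/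
theorem StratifiedSpace.isAttaching_of_fibre {B T X : Type u} [TopologicalSpace B]
    [TopologicalSpace T] [TopologicalSpace X] (S : StratifiedSpace B) {i : ℕ} {p : T → S.M i}
    {q : X → B} {Φ : T → (q ⁻¹' S.skel (i + 1) : Set X)}
    {h : (p ⁻¹' S.A i : Set T) → (q ⁻¹' S.skel i : Set X)} (hΦ : ∀ t, (h t : X) = Φ t)
    (comm : ∀ t, q (Φ t) = S.char i (p t))
    (inj : ∀ m ∉ S.A i, ∀ t t', p t = m → p t' = m → Φ t = Φ t' → t = t')
    (surj : ∀ m ∉ S.A i, ∀ x : (q ⁻¹' S.skel (i + 1) : Set X), q x = S.char i m →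
      ∃ t, p t = m ∧ Φ t = x)
    (isClosed : ∀ s, IsClosed (Φ ⁻¹' s) →
      IsClosed (inclusion (preimage_mono (f := q) (S.skel_subset i)) ⁻¹' s) → IsClosed s) :
    IsAttaching (p ⁻¹' S.A i) h Φ (inclusion (preimage_mono (f := q) (S.skel_subset i))) where
  comm t := Subtype.ext (hΦ t).symm
  injOn t ht t' ht' htt := by
    refine inj (p t) ht t t' rfl ((S.isAttaching i).injOn ht' ht (Subtype.ext ?_)) htt
    rw [← comm, ← comm, htt]
  notMem t ht := by
    rintro ⟨y, hy⟩
    refine ht ((S.char_mem_skel_iff (p t)).1 ?_)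
    rw [← comm, ← hy]
    exact y.2
  surj x := by
    by_cases hx : q x ∈ S.skel i
    · exact Or.inl ⟨⟨x, hx⟩, rfl⟩
    · obtain ⟨m, hm, hmx⟩ := S.exists_char_eq x.2 hx
      obtain ⟨t, rfl, ht⟩ := surj m hm x hmx.symm
      exact Or.inr ⟨t, hm, ht⟩
  isClosed := isClosed

variable {F : Type u} [SmallCategory F] {φ : F ⥤ TopCat.{u}}

/-- The attaching map `h` is forced, being the restriction of `Φ` over `A i`, so a push-out of
families reduces to the closedness test. -/
theorem Family.exists_isPushout {X B : Type u} [TopologicalSpace X] [TopologicalSpace B]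
    {S : StratifiedSpace B} {E : Family φ X B} {i : ℕ} {T : TopCat.{u}} {N : Family φ T (S.M i)}
    {Φ : C(T, (E.proj ⁻¹' S.skel (i + 1) : Set X))}
    (hΦ : N.IsMap (E.restrict (S.skel (i + 1))) Φ (S.char i))
    (hiso : ∀ m ∉ S.A i, N.IsFibreIso (E.restrict (S.skel (i + 1))) Φ (S.char i) m)
    (hcl : ∀ s, IsClosed (Φ ⁻¹' s) →
      IsClosed (inclusion (preimage_mono (f := E.proj) (S.skel_subset i)) ⁻¹' s) → IsClosed s) :
    ∃ h : C((N.proj ⁻¹' S.A i : Set T), (E.proj ⁻¹' S.skel i : Set X)),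
      (N.restrict (S.A i)).IsMap (E.restrict (S.skel i)) h (S.attach i) ∧
      IsPushout (TopCat.ofHom (valMap (N.proj ⁻¹' S.A i))) (TopCat.ofHom h) (TopCat.ofHom Φ)
        (TopCat.ofHom (ContinuousMap.inclusion (preimage_mono (S.skel_subset i)))) := by
  have hcomm : ∀ t, E.proj (Φ t) = S.char i (N.proj t) := fun t =>
    congrArg Subtype.val (hΦ.comm t)
  have hmem : ∀ t : (N.proj ⁻¹' S.A i : Set T), (Φ t : X) ∈ E.proj ⁻¹' S.skel i := fun t => by
    change E.proj (Φ t) ∈ S.skel i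
    rw [hcomm]
    exact (S.char_mem_skel_iff _).2 t.2
  refine ⟨⟨fun t => ⟨Φ t, hmem t⟩, by fun_prop⟩, ⟨fun t => Subtype.ext ?_, fun a => ?_⟩, ?_⟩
  · exact (hcomm t).trans (S.char_eq_attach i ⟨_, t.2⟩)
  · obtain ⟨g, hg⟩ := hΦ.fibre a
    -- The charts depend on the base point, so the equality of the two images of `a` is transported
    -- by generalizing that point.
    have key : ∀ c, (S.char i a : B) = c → ∃ g' : N.fib a ⟶ E.fib c,
        ∀ y, (Φ (N.incl a y) : X) = E.incl c (φ.map g' y) := by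
      rintro _ rfl
      exact ⟨g, fun y => congrArg Subtype.val (hg y)⟩
    obtain ⟨g', hg'⟩ := key _ (S.char_eq_attach i a)
    exact ⟨g', fun y => Subtype.ext (hg' y)⟩
  · refine IsAttaching.isPushout (M := TopCat.of _) (Y := TopCat.of _) (Z := TopCat.of _)
      (inclusion_injective (preimage_mono (S.skel_subset i))) ?_
    exact S.isAttaching_of_fibre (fun _ => rfl) hcomm
      (fun m hm t t' ht ht' => (hiso m hm).injective ht ht')
      (fun m hm x hx => (hiso m hm).surjective (Subtype.ext hx)) hcl

namespace DiagFamily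

/-! ### Inverse charts of diagram families. -/

section Incl

variable {P : Fᵒᵖ ⥤ TopCat.{u}} {B : Type u} [TopologicalSpace B] (E : DiagFamily φ P B)

theorem proj_incl (b : B) (V : F) (g : V ⟶ E.fib b) : E.proj V (E.incl b V g) = b :=
  ((E.chart b V).symm ⟨g⟩).2

theorem incl_chart (b : B) (V : F) (x : (E.proj V ⁻¹' {b} : Set (P.obj (.op V)))) :
    E.incl b V (E.chart b V x).hom = x :=
  congrArg Subtype.val ((E.chart b V).symm_apply_apply x)

theorem chart_incl (b : B) (V : F) (g : V ⟶ E.fib b) :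
    E.chart b V ⟨E.incl b V g, E.proj_incl b V g⟩ = ⟨g⟩ :=
  (E.chart b V).apply_symm_apply ⟨g⟩

theorem exists_incl {V : F} (x : P.obj (.op V)) : ∃ g, E.incl (E.proj V x) V g = x :=
  ⟨_, E.incl_chart _ V ⟨x, rfl⟩⟩

theorem incl_injective (b : B) (V : F) : Function.Injective (E.incl b V) := fun g g' h => by
  have h1 := (E.chart b V).symm.injective (Subtype.ext h : (E.chart b V).symm ⟨g⟩ = _)
  exact congrArg HomSpace.hom h1

theorem map_incl (b : B) {V W : F} (α : V ⟶ W) (g : W ⟶ E.fib b) :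
    P.map α.op (E.incl b W g) = E.incl b V (α ≫ g) := by
  have h := E.chart_map b α ⟨_, E.proj_incl b W g⟩
  rw [E.chart_incl] at h
  exact (E.incl_chart b V ⟨_, (E.proj_map α _).trans (E.proj_incl b W g)⟩).symm.trans
    (congrArg (fun f => E.incl b V f.hom) h)

end Incl

theorem IsFibreIso.injective {P Q : Fᵒᵖ ⥤ TopCat.{u}} {B M : Type u} [TopologicalSpace B]
    [TopologicalSpace M] {N : DiagFamily φ Q M} {E : DiagFamily φ P B} {f : Q ⟶ P}
    {fbar : C(M, B)} {m : M} (h : N.IsFibreIso E f fbar m) {V : F} {t t' : Q.obj (.op V)}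
    (ht : N.proj V t = m) (ht' : N.proj V t' = m) (htt : f.app _ t = f.app _ t') : t = t' := by
  obtain ⟨g, hg⟩ := h
  obtain ⟨y, rfl⟩ : ∃ y, N.incl m V y = t := ht ▸ N.exists_incl t
  obtain ⟨y', rfl⟩ : ∃ y, N.incl m V y = t' := ht' ▸ N.exists_incl t'
  rw [hg, hg] at htt
  rw [(cancel_mono g.hom).1 (E.incl_injective _ V htt)]

theorem IsFibreIso.surjective {P Q : Fᵒᵖ ⥤ TopCat.{u}} {B M : Type u} [TopologicalSpace B]
    [TopologicalSpace M] {N : DiagFamily φ Q M} {E : DiagFamily φ P B} {f : Q ⟶ P}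
    {fbar : C(M, B)} {m : M} (h : N.IsFibreIso E f fbar m) {V : F} {x : P.obj (.op V)}
    (hx : E.proj V x = fbar m) : ∃ t, N.proj V t = m ∧ f.app _ t = x := by
  obtain ⟨g, hg⟩ := h
  obtain ⟨y, rfl⟩ : ∃ y, E.incl (fbar m) V y = x := hx ▸ E.exists_incl x
  refine ⟨N.incl m V (y ≫ g.inv), N.proj_incl _ _ _, ?_⟩
  rw [hg]
  simp

/-! ### Push-outs of diagram families. -/

section Attach

variable {P : Fᵒᵖ ⥤ TopCat.{u}} {B : Type u} [TopologicalSpace B] {S : StratifiedSpace B}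
  {E : DiagFamily φ P B}

theorem exists_isPushout {i : ℕ} {Q : Fᵒᵖ ⥤ TopCat.{u}} {N : DiagFamily φ Q (S.M i)}
    {Φ : Q ⟶ E.part (S.skel (i + 1))}
    (hΦ : N.IsMap (E.restrict (S.skel (i + 1))) Φ (S.char i))
    (hiso : ∀ m ∉ S.A i, N.IsFibreIso (E.restrict (S.skel (i + 1))) Φ (S.char i) m)
    (hcl : ∀ (V : F) (s : Set (E.proj V ⁻¹' S.skel (i + 1) : Set (P.obj (.op V)))),
      IsClosed (Φ.app (.op V) ⁻¹' s) →
      IsClosed (inclusion (preimage_mono (f := E.proj V) (S.skel_subset i)) ⁻¹' s) →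
      IsClosed s) :
    ∃ h : N.part (S.A i) ⟶ E.part (S.skel i),
      (N.restrict (S.A i)).IsMap (E.restrict (S.skel i)) h (S.attach i) ∧
      ∀ V : F, IsPushout (N.partVal (S.A i) V) (h.app (.op V)) (Φ.app (.op V))
        (E.partIncl (S.skel_subset i) V) := by
  have hcomm : ∀ (V : F) t, E.proj V (Φ.app (.op V) t).1 = S.char i (N.proj V t) := fun V t =>
    congrArg Subtype.val (hΦ.comm V t)
  have hmem : ∀ (V : F) (t : (N.proj V ⁻¹' S.A i : Set (Q.obj (.op V)))),
      (Φ.app (.op V) t.1).1 ∈ E.proj V ⁻¹' S.skel i := fun V t => by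
    change E.proj V _ ∈ S.skel i
    rw [hcomm]
    exact (S.char_mem_skel_iff _).2 t.2
  let h : N.part (S.A i) ⟶ E.part (S.skel i) :=
    { app := fun V => TopCat.ofHom ⟨fun t => ⟨(Φ.app V t.1).1, hmem V.unop t⟩,
        Continuous.subtype_mk (continuous_subtype_val.comp
          ((Φ.app V).hom.continuous.comp continuous_subtype_val)) _⟩
      naturality := fun V W α => by
        apply TopCat.ext
        intro t
        have h1 : (Φ.app W (Q.map α t.1)).1 = P.map α (Φ.app V t.1).1 :=
          congrArg Subtype.val (ConcreteCategory.congr_hom (Φ.naturality α) t.1)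
        exact Subtype.ext h1 }
  refine ⟨h, ⟨fun V t => Subtype.ext ?_, fun a => ?_⟩, fun V => ?_⟩
  · exact (hcomm V t.1).trans (S.char_eq_attach i ⟨_, t.2⟩)
  · obtain ⟨g, hg⟩ := hΦ.fibre a
    have key : ∀ c, (S.char i a : B) = c → ∃ g' : N.fib a ⟶ E.fib c,
        ∀ (V : F) (y : V ⟶ N.fib a),
          (Φ.app (.op V) (N.incl a V y)).1 = E.incl c V (y ≫ g') := by
      rintro _ rfl
      exact ⟨g, fun V y => congrArg Subtype.val (hg V y)⟩
    obtain ⟨g', hg'⟩ := key _ (S.char_eq_attach i a)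
    exact ⟨g', fun V y => Subtype.ext (hg' V y)⟩
  · refine IsAttaching.isPushout (M := Q.obj (.op V)) (Y := TopCat.of _) (Z := TopCat.of _)
      (f := (h.app (.op V)).hom) (g := (Φ.app (.op V)).hom)
      (j := ContinuousMap.inclusion (preimage_mono (S.skel_subset i)))
      (inclusion_injective (preimage_mono (S.skel_subset i))) ?_
    exact S.isAttaching_of_fibre (p := N.proj V) (q := E.proj V) (fun _ => rfl) (hcomm V)
      (fun m hm t t' ht ht' => (hiso m hm).injective ht ht')
      (fun m hm x hx => (hiso m hm).surjective (Subtype.ext hx)) (hcl V)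

end Attach

/-- The maps `k V` trivialize the diagram family `E` over the subset `U` of the base. -/
structure IsTrivialization {P : Fᵒᵖ ⥤ TopCat.{u}} {B : Type u} [TopologicalSpace B]
    (E : DiagFamily φ P B) (U : Set B) (W : F)
    (k : ∀ V : F, C(U × HomSpace φ V W, P.obj (.op V))) : Prop where
  isEmbedding : ∀ V, IsEmbedding (k V)
  fibre : ∀ u : U, ∃ g : W ≅ E.fib u, ∀ (V : F) (f : V ⟶ W),
    k V (u, ⟨f⟩) = E.incl u V (f ≫ g.hom)

/-! ### Local trivializations of diagram families. -/

section Trivialization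

variable {P : Fᵒᵖ ⥤ TopCat.{u}} {B : Type u} [TopologicalSpace B] {E : DiagFamily φ P B}
  {U : Set B} {W : F} {k : ∀ V : F, C(U × HomSpace φ V W, P.obj (.op V))}

theorem IsTrivialization.proj_apply (h : E.IsTrivialization U W k) {V : F}
    (z : U × HomSpace φ V W) : E.proj V (k V z) = z.1 := by
  obtain ⟨g, hg⟩ := h.fibre z.1
  exact (congrArg (E.proj V) (hg V z.2.hom)).trans (E.proj_incl _ _ _)

theorem IsTrivialization.exists_eq (h : E.IsTrivialization U W k) {V : F} {x : P.obj (.op V)}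
    (hx : E.proj V x ∈ U) : ∃ f : V ⟶ W, k V (⟨E.proj V x, hx⟩, ⟨f⟩) = x := by
  obtain ⟨g, hg⟩ := h.fibre ⟨E.proj V x, hx⟩
  obtain ⟨y, hy⟩ := E.exists_incl x
  refine ⟨y ≫ g.inv, ?_⟩
  rw [hg]
  simpa using hy

theorem IsTrivialization.range_eq (h : E.IsTrivialization U W k) (V : F) :
    range (k V) = E.proj V ⁻¹' U := by
  apply Subset.antisymm
  · rintro _ ⟨z, rfl⟩
    change E.proj V (k V z) ∈ U
    rw [h.proj_apply]
    exact z.1.2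
  · intro x hx
    obtain ⟨f, hf⟩ := h.exists_eq hx
    exact ⟨_, hf⟩

theorem IsTrivialization.map_apply (h : E.IsTrivialization U W k) {V V' : F} (α : V ⟶ V')
    (u : U) (f : V' ⟶ W) : P.map α.op (k V' (u, ⟨f⟩)) = k V (u, ⟨α ≫ f⟩) := by
  obtain ⟨g, hg⟩ := h.fibre u
  rw [hg, hg, E.map_incl, Category.assoc]

theorem IsTrivialization.mono (h : E.IsTrivialization U W k) {U' : Set B} (hU : U' ⊆ U) :
    E.IsTrivialization U' W fun V =>
      (k V).comp ((ContinuousMap.inclusion hU).prodMap (ContinuousMap.id (HomSpace φ V W))) where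
  isEmbedding V := (h.isEmbedding V).comp ((IsEmbedding.inclusion hU).prodMap IsEmbedding.id)
  fibre u := h.fibre ⟨u.1, hU u.2⟩

theorem exists_isTrivialization_iff (E : DiagFamily φ P B) (U : Set B) (W : F) :
    (∃ e : E.part U ≅ productDiag φ W U,
      (E.restrict U).IsIso (productDiagFamily φ W U) e (Homeomorph.refl U)) ↔
    ∃ k, E.IsTrivialization U W k := by
  constructor
  · rintro ⟨e, he, he'⟩
    have h1 : ∀ (V : F) z, e.inv.app (.op V) (e.hom.app (.op V) z) = z := fun V z =>
      ConcreteCategory.congr_hom (e.hom_inv_id_app (.op V)) z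
    have h2 : ∀ (V : F) z, e.hom.app (.op V) (e.inv.app (.op V) z) = z := fun V z =>
      ConcreteCategory.congr_hom (e.inv_hom_id_app (.op V)) z
    refine ⟨fun V => (valMap _).comp (e.inv.app (.op V)).hom, fun V => ?_, fun u => ?_⟩
    · refine IsEmbedding.subtypeVal.comp ?_
      exact (TopCat.homeoOfIso (e.app (.op V)).symm).isEmbedding
    · obtain ⟨(g : W ⟶ E.fib u), hg⟩ := he'.fibre u
      obtain ⟨(g' : E.fib u ⟶ W), hg'⟩ := he.fibre u
      have hg : ∀ (V : F) (y : V ⟶ W), e.inv.app (.op V) ((u, ⟨y⟩) : U × HomSpace φ V W) =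
        (E.restrict U).incl u V (y ≫ g) := hg
      have hg' : ∀ (V : F) (y : V ⟶ E.fib u), e.hom.app (.op V) ((E.restrict U).incl u V y) =
        ((u, ⟨y ≫ g'⟩) : U × HomSpace φ V W) := hg'
      refine ⟨⟨g, g', ?_, ?_⟩, fun V f => congrArg Subtype.val (hg V f)⟩
      -- As in the Yoneda lemma, following the identity of `W` through the two natural
      -- transformations shows that `g` and `g'` are inverse in `F` itself.
      · have h3 := (h2 W _).symm.trans ((congrArg (e.hom.app (.op W)) (hg W (𝟙 W))).trans
          (hg' W (𝟙 W ≫ g)))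
        have h4 : 𝟙 W = (𝟙 W ≫ g) ≫ g' :=
          congrArg (fun z : U × HomSpace φ W W => z.2.hom) h3
        rw [Category.id_comp] at h4
        exact h4.symm
      · have h3 := (h1 (E.fib u) _).symm.trans ((congrArg (e.inv.app (.op (E.fib u)))
          (hg' (E.fib u) (𝟙 _))).trans (hg (E.fib u) (𝟙 _ ≫ g')))
        have h4 := (E.restrict U).incl_injective u _ h3
        have h5 : 𝟙 (E.fib u) = (𝟙 (E.fib u) ≫ g') ≫ g := h4
        rw [Category.id_comp] at h5
        exact h5.symm
  · rintro ⟨k, hk⟩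
    let c : ∀ V : F, (U × HomSpace φ V W) ≃ₜ (E.proj V ⁻¹' U : Set (P.obj (.op V))) := fun V =>
      ((hk.isEmbedding V).toHomeomorph).trans (Homeomorph.setCongr (hk.range_eq V))
    have hc : ∀ V z, (c V z).1 = k V z := fun V z => rfl
    let e : productDiag φ W U ≅ E.part U :=
      NatIso.ofComponents (fun V => TopCat.isoOfHomeo (c V.unop)) (by
        intro V V' α
        apply TopCat.ext
        rintro ⟨u, f⟩
        exact Subtype.ext (hk.map_apply α.unop u f.hom).symm)
    have he : ∀ (V : F) x z, k V z = x.1 → e.inv.app (.op V) x = z := fun V x z h => by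
      have h1 : c V z = x := Subtype.ext h
      rw [← h1]
      exact (c V).symm_apply_apply z
    refine ⟨e.symm, ⟨fun V x => ?_, fun u => ?_⟩, ⟨fun V z => ?_, fun u => ?_⟩⟩
    · obtain ⟨f, hf⟩ := hk.exists_eq x.2
      exact congrArg (fun z : U × HomSpace φ V W => z.1) (he V x _ hf)
    · obtain ⟨g, hg⟩ := hk.fibre u
      refine ⟨g.inv, fun V (y : V ⟶ E.fib u) => he V _ _ ?_⟩
      refine (hg V (y ≫ g.inv)).trans ?_
      rw [Category.assoc, g.inv_hom_id, Category.comp_id]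
      rfl
    · exact Subtype.ext (hk.proj_apply z)
    · obtain ⟨g, hg⟩ := hk.fibre u
      exact ⟨g.hom, fun V y => Subtype.ext (hg V y)⟩

theorem isBundle_iff (E : DiagFamily φ P B) :
    E.IsBundle ↔ ∀ b, ∃ U, IsOpen U ∧ b ∈ U ∧ ∃ W k, E.IsTrivialization U W k := by
  constructor
  · intro h b
    obtain ⟨U, hU, W, e, he⟩ := h b
    obtain ⟨k, hk⟩ := (E.exists_isTrivialization_iff U W).1 ⟨e, he⟩
    obtain ⟨U', hU', hU'o, hb⟩ := mem_nhds_iff.1 hU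
    exact ⟨U', hU'o, hb, W, _, hk.mono hU'⟩
  · intro h b
    obtain ⟨U, hU, hb, W, hk⟩ := h b
    exact ⟨U, hU.mem_nhds hb, W, (E.exists_isTrivialization_iff U W).2 hk⟩

theorem isBundle_restrict_iff (E : DiagFamily φ P B) (Y : Set B) :
    (E.restrict Y).IsBundle ↔
      ∀ b ∈ Y, ∃ U, IsOpen U ∧ b ∈ U ∧ ∃ W k, E.IsTrivialization (U ∩ Y) W k := by
  rw [isBundle_iff]
  constructor
  · intro h b hb
    obtain ⟨U, hU, hbU, W, k, hk⟩ := h ⟨b, hb⟩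
    obtain ⟨O, hO, rfl⟩ := isOpen_induced_iff.1 hU
    let i : C((O ∩ Y : Set B), ((↑) ⁻¹' O : Set Y)) :=
      ⟨fun u => ⟨⟨u.1, u.2.2⟩, u.2.1⟩, by fun_prop⟩
    have hi : IsEmbedding i := IsEmbedding.of_comp i.continuous
      (g := fun v => (v.1.1 : B)) (by fun_prop) IsEmbedding.subtypeVal
    refine ⟨O, hO, hbU, W,
      fun V => (valMap _).comp ((k V).comp (i.prodMap (ContinuousMap.id _))), fun V => ?_, ?_⟩
    · exact IsEmbedding.subtypeVal.comp ((hk.isEmbedding V).comp (hi.prodMap IsEmbedding.id))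
    · intro u
      obtain ⟨g, hg⟩ := hk.fibre (i u)
      exact ⟨g, fun V f => congrArg Subtype.val (hg V f)⟩
  · rintro h ⟨b, hb⟩
    obtain ⟨O, hO, hbO, W, k, hk⟩ := h b hb
    let i : C(((↑) ⁻¹' O : Set Y), (O ∩ Y : Set B)) :=
      ⟨fun u => ⟨u.1.1, u.2, u.1.2⟩, by fun_prop⟩
    have hv : IsEmbedding fun u : ((↑) ⁻¹' O : Set Y) => (u.1.1 : B) :=
      IsEmbedding.subtypeVal.comp IsEmbedding.subtypeVal
    have hi : IsEmbedding i := IsEmbedding.of_comp i.continuous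
      continuous_subtype_val hv
    refine ⟨Subtype.val ⁻¹' O, hO.preimage continuous_subtype_val, hbO, W,
      fun V => ⟨fun z => ⟨k V (i z.1, z.2), ?_⟩, ?_⟩, fun V => ?_, ?_⟩
    · change E.proj V _ ∈ Y
      rw [hk.proj_apply]
      exact z.1.1.2
    · exact Continuous.subtype_mk ((k V).continuous.comp (by fun_prop)) _
    · refine IsEmbedding.of_comp (ContinuousMap.continuous _) continuous_subtype_val ?_
      exact (hk.isEmbedding V).comp (hi.prodMap IsEmbedding.id)
    · intro u
      obtain ⟨g, hg⟩ := hk.fibre (i u)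
      exact ⟨g, fun V f => Subtype.ext (hg V f)⟩

end Trivialization

end DiagFamily

end StratBundle

/-! ### The associated diagram of a stratified bundle -/

namespace StratBundle

variable {F : Type u} [SmallCategory F] {φ : F ⥤ TopCat.{u}}

namespace Family

variable {X B X' B' : Type u} [TopologicalSpace X] [TopologicalSpace B] [TopologicalSpace X']
  [TopologicalSpace B']

theorem IsBundle.continuous_of_comp {E : Family φ X B} (h : E.IsBundle) {Z : Type*}
    [TopologicalSpace Z] {f : X → Z}
    (hf : ∀ (U : Set B) (W : F) (k : C(U × φ.obj W, X)), E.IsTrivialization U W k →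
      Continuous (f ∘ k)) : Continuous f := by
  rw [continuous_iff_continuousAt]
  intro x
  obtain ⟨U, hU, hb, W, k, hk⟩ := E.isBundle_iff.1 h (E.proj x)
  obtain ⟨y, hy⟩ := hk.exists_eq hb
  rw [← hy]
  exact (hk.isOpenEmbedding hU).continuousAt_iff.1 (hf U W k hk).continuousAt

theorem IsStratifiedBundle.isClosed {S : StratifiedSpace B} {E : Family φ X B}
    (hE : E.IsStratifiedBundle S) (D : ∀ k, AttachedBundle S E k) {s : Set X}
    (hs₀ : IsClosed ((↑) ⁻¹' s : Set (E.proj ⁻¹' S.skel 0 : Set X)))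
    (hs : ∀ k, IsClosed ((D k).map ⁻¹' s)) : IsClosed s := by
  refine hE.2.1.isClosed_iff.2 ?_
  rintro _ ⟨n, rfl⟩
  induction n with
  | zero => exact hs₀
  | succ n ih => exact (D n).isAttaching.isClosed _ (hs n) ih

/-- The evaluation map `[a, y] ↦ a y`. -/
def evalMap [∀ V : F, LocallyCompactSpace (φ.obj V)] (E : Family φ X B) :
    C(Coend E.assocDiag φ, X) where
  toFun := Quot.lift (fun z => (z.2.1 : E.MapSpace z.1).1 z.2.2) (by
    rintro _ _ ⟨α, x, y⟩
    rfl)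
  continuous_toFun := by
    refine continuous_quot_lift _ (continuous_sigma fun V => ?_)
    exact continuous_eval.comp ((continuous_subtype_val.comp continuous_fst).prodMk continuous_snd)

variable [∀ V : F, Nonempty (φ.obj V)]

theorem AttachedBundle.mapSpaceProj_map_mem {S : StratifiedSpace B} {E : Family φ X B} {i : ℕ}
    (D : AttachedBundle S E i) {V : F} (a : D.N.MapSpace V) :
    mapSpaceMap D.isMap_map V a ∈ E.mapSpaceProj V ⁻¹' S.skel (i + 1) := by
  change E.mapSpaceProj V _ ∈ S.skel (i + 1)
  rw [mapSpaceProj_mapSpaceMap]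
  exact (S.char i _).2

theorem mapSpaceMap_restrict_mem (E : Family φ X B) (Y : Set B) {V : F}
    (a : (E.restrict Y).MapSpace V) :
    mapSpaceMap (E.isMap_restrict Y) V a ∈ E.mapSpaceProj V ⁻¹' Y := by
  change E.mapSpaceProj V _ ∈ Y
  rw [mapSpaceProj_mapSpaceMap]
  exact Subtype.property _

variable [φ.Faithful]

/-- Faithfulness turns the inverses after `φ` into isomorphisms of `F`, as fibre maps of diagrams
require. -/
theorem IsTrivialization.assoc {E : Family φ X B} {U : Set B} {W : F} {k : C(U × φ.obj W, X)}
    (h : E.IsTrivialization U W k) : E.assoc.IsTrivialization U W fun V => h.mapSpace V where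
  isEmbedding V := h.isEmbedding_mapSpace V
  fibre u := by
    obtain ⟨(g : W ⟶ E.fib u), (g' : E.fib u ⟶ W), hg, h1, h2⟩ := h.fibre u
    refine ⟨⟨g, g', φ.map_injective ?_, φ.map_injective ?_⟩, fun V f => Subtype.ext ?_⟩
    · exact (φ.map_comp _ _).trans (h1.trans (φ.map_id _).symm)
    · exact (φ.map_comp _ _).trans (h2.trans (φ.map_id _).symm)
    · ext y
      refine (hg _).trans (congrArg (E.incl u) ?_)
      exact (ConcreteCategory.congr_hom (φ.map_comp f g) y).symm

theorem IsBundle.assoc {E : Family φ X B} (h : E.IsBundle) : E.assoc.IsBundle := by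
  rw [DiagFamily.isBundle_iff]
  intro b
  obtain ⟨U, hU, hb, W, k, hk⟩ := E.isBundle_iff.1 h b
  exact ⟨U, hU, hb, W, _, hk.assoc⟩

theorem IsBundle.assoc_restrict {E : Family φ X B} {Y : Set B} (h : (E.restrict Y).IsBundle) :
    (E.assoc.restrict Y).IsBundle := by
  rw [DiagFamily.isBundle_restrict_iff]
  intro b hb
  obtain ⟨U, hU, hbU, W, k, hk⟩ := (E.isBundle_restrict_iff Y).1 h b hb
  exact ⟨U, hU, hbU, W, _, hk.assoc⟩

theorem isMap_assoc {N : Family φ X' B'} {E : Family φ X B} {f : C(X', X)} {fbar : C(B', B)}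
    (hf : N.IsMap E f fbar) : N.assoc.IsMap E.assoc
      { app := fun V => TopCat.ofHom (mapSpaceMap hf V.unop) } fbar where
  comm V a := mapSpaceProj_mapSpaceMap hf a
  fibre b := by
    obtain ⟨g, hg⟩ := hf.fibre b
    refine ⟨g, fun V y => Subtype.ext ?_⟩
    ext z
    refine (hg (φ.map y z)).trans (congrArg (E.incl (fbar b)) ?_)
    exact (ConcreteCategory.congr_hom (φ.map_comp y g) z).symm

namespace AttachedBundle

variable {S : StratifiedSpace B} {E : Family φ X B} {i : ℕ} (D : AttachedBundle S E i)

/-- The map of diagrams induced by the map from the attached bundle to `E`. -/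
noncomputable def diagMap : D.N.assocDiag ⟶ E.assoc.part (S.skel (i + 1)) where
  app V := TopCat.ofHom ⟨fun a => ⟨mapSpaceMap D.isMap_map V.unop a, D.mapSpaceProj_map_mem a⟩,
    Continuous.subtype_mk (ContinuousMap.continuous _) _⟩

theorem isMap_diagMap : D.N.assoc.IsMap (E.assoc.restrict (S.skel (i + 1))) D.diagMap (S.char i)
    where
  comm V a := Subtype.ext (mapSpaceProj_mapSpaceMap D.isMap_map a)
  fibre b := by
    obtain ⟨g, hg⟩ := (isMap_assoc D.isMap_map).fibre b
    exact ⟨g, fun V y => Subtype.ext (hg V y)⟩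

theorem isFibreIso_diagMap {m : S.M i} (hm : m ∉ S.A i) :
    D.N.assoc.IsFibreIso (E.assoc.restrict (S.skel (i + 1))) D.diagMap (S.char i) m := by
  obtain ⟨(g : D.N.fib m ⟶ E.fib (S.char i m)), (g' : E.fib (S.char i m) ⟶ D.N.fib m), hg, h1, h2⟩ :=
    D.isFibreIso m hm
  refine ⟨⟨g, g', φ.map_injective ?_, φ.map_injective ?_⟩, fun V y =>
    Subtype.ext (Subtype.ext ?_)⟩
  · exact (φ.map_comp _ _).trans (h1.trans (φ.map_id _).symm)
  · exact (φ.map_comp _ _).trans (h2.trans (φ.map_id _).symm)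
  · ext z
    refine (congrArg Subtype.val (hg (φ.map y z))).trans (congrArg (E.incl (S.char i m)) ?_)
    exact (ConcreteCategory.congr_hom (φ.map_comp y g) z).symm

end AttachedBundle

theorem IsStratifiedBundle.isCoherentWith_mapSpace {S : StratifiedSpace B} {E : Family φ X B}
    (hE : E.IsStratifiedBundle S) (h : IsNKC φ) (hφ : IsFibreFunctor φ) (V : F) :
    IsCoherentWith (range fun i => E.mapSpaceProj V ⁻¹' S.skel i) := by
  have D := fun i => (hE.nonempty_attachedBundle i).some
  refine IsCoherentWith.of_isClosed fun s hs => ?_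
  have hs : ∀ i, IsClosed ((↑) ⁻¹' s : Set (E.mapSpaceProj V ⁻¹' S.skel i : Set (E.MapSpace V))) :=
    fun i => hs _ ⟨i, rfl⟩
  refine hE.isClosed_mapSpace h hφ D ?_ fun k => ?_
  · exact (hs 0).preimage (f := fun a => ⟨mapSpaceMap (E.isMap_restrict (S.skel 0)) V a,
      E.mapSpaceMap_restrict_mem _ a⟩) (Continuous.subtype_mk (ContinuousMap.continuous _) _)
  · exact (hs (k + 1)).preimage (f := fun a => ⟨mapSpaceMap (D k).isMap_map V a,
      (D k).mapSpaceProj_map_mem a⟩) (Continuous.subtype_mk (ContinuousMap.continuous _) _)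

theorem IsStratifiedBundle.assoc {S : StratifiedSpace B} {E : Family φ X B}
    (hE : E.IsStratifiedBundle S) (h : IsNKC φ) (hφ : IsFibreFunctor φ) :
    E.assoc.IsPrincipalStratifiedBundle S := by
  have D := fun i => (hE.nonempty_attachedBundle i).some
  refine ⟨hE.1.assoc_restrict, fun V => hE.isCoherentWith_mapSpace h hφ V, fun i => ?_⟩
  obtain ⟨η, hη, hη'⟩ := DiagFamily.exists_isPushout (D i).isMap_diagMap
    (fun m hm => (D i).isFibreIso_diagMap hm) fun V s hs hs' => by
      have h1 : ∀ a (ha : a ∈ E.mapSpaceProj V ⁻¹' S.skel (i + 1)),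
          a ∈ Subtype.val '' s ↔ ⟨a, ha⟩ ∈ s := fun a ha =>
        ⟨by rintro ⟨a', ha', rfl⟩; exact ha', fun h => ⟨_, h, rfl⟩⟩
      -- View `s` as a set of maps into the whole of `X`. The pieces below `i` factor through the
      -- part over `skel i`, where `hs'` applies; the piece `i` is the hypothesis `hs`.
      have h2 := hE.isClosed_mapSpace_skel h hφ D (V := V) (s := Subtype.val '' s) (n := i + 1)
        ?_ fun k hk => ?_
      · exact (preimage_image_eq s Subtype.val_injective) ▸ h2
      · convert hs'.preimage (f := fun a => ⟨mapSpaceMap (E.isMap_restrict (S.skel 0)) V a,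
          S.skel_mono (Nat.zero_le i) (E.mapSpaceMap_restrict_mem _ a)⟩)
          (Continuous.subtype_mk (ContinuousMap.continuous _) _) using 1
        ext a
        exact h1 _ _
      · rcases Nat.lt_succ_iff_lt_or_eq.1 hk with hk | rfl
        · convert hs'.preimage (f := fun a => ⟨mapSpaceMap (D k).isMap_map V a,
            S.skel_mono hk ((D k).mapSpaceProj_map_mem a)⟩)
            (Continuous.subtype_mk (ContinuousMap.continuous _) _) using 1
          ext a
          exact h1 _ _
        · convert hs using 1
          ext a
          exact h1 _ _
  exact ⟨_, _, η, _, (D i).isBundle.assoc, hη, (D i).isMap_diagMap, hη',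
    fun m hm => (D i).isFibreIso_diagMap hm⟩

end Family

end StratBundle

/-! ### Coends of principal stratified bundle diagrams -/

namespace StratBundle

/-- Curry the indicator of the complement of `s` to a map from `X` to `C(Y, Prop)` with the
Sierpiński topology on `Prop`. It is continuous because it is so on every `Z i`, and local
compactness of `Y` allows uncurrying. -/
theorem isClosed_prod_of_jointly {ι : Type*} {X : Type*} {Z : ι → Type*} {Y : Type*}
    [TopologicalSpace X] [∀ i, TopologicalSpace (Z i)] [TopologicalSpace Y]
    [LocallyCompactSpace Y] {f : ∀ i, Z i → X} (hsurj : ∀ x, ∃ i z, f i z = x)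
    (hf : ∀ s : Set X, (∀ i, IsClosed (f i ⁻¹' s)) → IsClosed s) {s : Set (X × Y)}
    (hs : ∀ i, IsClosed ((fun z : Z i × Y => (f i z.1, z.2)) ⁻¹' s)) : IsClosed s := by
  have hc : ∀ i, Continuous fun z : Z i × Y => (f i z.1, z.2) ∉ s := fun i =>
    continuous_Prop.2 (hs i).isOpen_compl
  have hx : ∀ x : X, Continuous fun y : Y => (x, y) ∉ s := fun x => by
    obtain ⟨i, z, rfl⟩ := hsurj x
    exact (hc i).comp (continuous_const.prodMk continuous_id)
  let c : X → C(Y, Prop) := fun x => ⟨_, hx x⟩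
  have hcc : Continuous c := by
    refine continuous_iff_isClosed.2 fun t ht => hf _ fun i => ?_
    exact ht.preimage (ContinuousMap.curry ⟨_, hc i⟩).continuous
  have h1 := ContinuousMap.continuous_uncurry_of_continuous ⟨c, hcc⟩
  exact isOpen_compl_iff.1 (continuous_Prop.1 h1)

variable {F : Type u} [SmallCategory F] {φ ψ : F ⥤ TopCat.{u}}

namespace Coend

variable {P : Fᵒᵖ ⥤ TopCat.{u}}

theorem mk_map {V W : F} (α : V ⟶ W) (x : P.obj (.op W)) (y : ψ.obj V) :
    mk (P.map α.op x) y = mk x (ψ.map α y) :=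
  Quot.sound (CoendRel.rel α x y)

theorem exists_mk (z : Coend P ψ) : ∃ (V : F) (x : P.obj (.op V)) (y : ψ.obj V), mk x y = z := by
  obtain ⟨⟨V, x, y⟩, rfl⟩ := Quot.exists_rep z
  exact ⟨V, x, y, rfl⟩

theorem continuous_mk (V : F) :
    Continuous fun z : P.obj (.op V) × ψ.obj V => (mk z.1 z.2 : Coend P ψ) :=
  (continuous_quot_mk (r := CoendRel P ψ)).comp
    (continuous_sigmaMk (σ := fun V : F => P.obj (.op V) × ψ.obj V))

theorem isClosed_iff {s : Set (Coend P ψ)} : IsClosed s ↔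
    ∀ V, IsClosed {z : P.obj (.op V) × ψ.obj V | mk z.1 z.2 ∈ s} := by
  refine ⟨fun h V => h.preimage (continuous_mk V), fun h => ?_⟩
  exact (isQuotientMap_quot_mk (r := CoendRel P ψ)).isClosed_preimage.1 (isClosed_sigma_iff.2 h)

end Coend

namespace DiagFamily

variable {P : Fᵒᵖ ⥤ TopCat.{u}} {B : Type u} [TopologicalSpace B] (E : DiagFamily φ P B)

/-- The map from `ψ (fib b)` onto the fibre of the coend over `b`. -/
def coendIncl (ψ : F ⥤ TopCat.{u}) (b : B) : C(ψ.obj (E.fib b), Coend P ψ) where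
  toFun y := Coend.mk (E.incl b (E.fib b) (𝟙 _)) y
  continuous_toFun := (Coend.continuous_mk _).comp (continuous_const.prodMk continuous_id)

theorem mk_incl (b : B) {V : F} (g : V ⟶ E.fib b) (y : ψ.obj V) :
    Coend.mk (E.incl b V g) y = E.coendIncl ψ b (ψ.map g y) := by
  have h := E.map_incl b g (𝟙 _)
  rw [Category.comp_id] at h
  rw [← h]
  exact Coend.mk_map _ _ _

theorem coendProj_mk {V : F} (x : P.obj (.op V)) (y : ψ.obj V) :
    E.coendProj ψ (Coend.mk x y) = E.proj V x := rfl

theorem coendProj_coendIncl (b : B) (y : ψ.obj (E.fib b)) :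
    E.coendProj ψ (E.coendIncl ψ b y) = b := E.proj_incl b _ _

theorem exists_coendIncl_eq {z : Coend P ψ} {b : B} (hz : E.coendProj ψ z = b) :
    ∃ y, E.coendIncl ψ b y = z := by
  subst hz
  obtain ⟨V, x, y, rfl⟩ := Coend.exists_mk z
  obtain ⟨g, hg⟩ := E.exists_incl x
  exact ⟨ψ.map g y, (E.mk_incl _ g y).symm.trans (congrArg (fun x' => Coend.mk x' y) hg)⟩

/-- The inverse of the maps `coendIncl`, on the union of all fibres. -/
def coendRetract (ψ : F ⥤ TopCat.{u}) : Coend P ψ → Σ b, ψ.obj (E.fib b) :=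
  Quot.lift (fun z => ⟨E.proj z.1 z.2.1, ψ.map (E.chart _ z.1 ⟨z.2.1, rfl⟩).hom z.2.2⟩) (by
    rintro _ _ ⟨α, x, y⟩
    -- The two representatives have only propositionally equal base points; generalizing `b` moves
    -- the first value into the fibre of the second.
    have key : ∀ b (hb : E.proj _ (P.map α.op x) = b) (hb' : E.proj _ x = b),
        (⟨E.proj _ (P.map α.op x), ψ.map (E.chart _ _ ⟨P.map α.op x, rfl⟩).hom y⟩ :
          Σ b, ψ.obj (E.fib b)) = ⟨b, ψ.map (E.chart b _ ⟨P.map α.op x, hb⟩).hom y⟩ := by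
      rintro _ rfl _
      rfl
    refine (key _ (E.proj_map α x) rfl).trans ?_
    have h := E.chart_map _ α ⟨x, rfl⟩
    refine congrArg (Sigma.mk (β := fun b => ψ.obj (E.fib b)) (E.proj _ x)) ?_
    refine (congrArg (fun f => ψ.map f.hom y) h).trans ?_
    exact ConcreteCategory.congr_hom (ψ.map_comp _ _) y)

theorem coendRetract_mk {V : F} {x : P.obj (.op V)} {b : B} (hx : E.proj V x = b)
    (y : ψ.obj V) :
    E.coendRetract ψ (Coend.mk x y) = ⟨b, ψ.map (E.chart b V ⟨x, hx⟩).hom y⟩ := by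
  subst hx
  rfl

theorem coendIncl_injective (b : B) : Function.Injective (E.coendIncl ψ b) := by
  have h : ∀ y, E.coendRetract ψ (E.coendIncl ψ b y) = ⟨b, y⟩ := fun y => by
    refine (E.coendRetract_mk (E.proj_incl b _ _) y).trans ?_
    rw [E.chart_incl]
    exact congrArg (Sigma.mk (β := fun b => ψ.obj (E.fib b)) b)
      (ConcreteCategory.congr_hom (ψ.map_id _) y)
  intro y y' hy
  have h1 := (h y).symm.trans ((congrArg (E.coendRetract ψ) hy).trans (h y'))
  simpa using h1

/-- The preimage in `P V × ψ V` of the image of a closed `C` lies over the closed fibre at `b`,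
where it is the condition `ψ (Φ_b x) y ∈ C`. That condition is closed because `ψ` is continuous and
`ψ V` is locally compact. -/
theorem isClosedEmbedding_coendIncl [T1Space B] [∀ V : F, LocallyCompactSpace (ψ.obj V)]
    (hψ : ∀ V W : F, Continuous
      (fun g : HomSpace φ V W => ((ψ.map g.hom).hom : C(ψ.obj V, ψ.obj W)))) (b : B) :
    IsClosedEmbedding (E.coendIncl ψ b) := by
  refine IsClosedEmbedding.of_continuous_injective_isClosedMap (ContinuousMap.continuous _)
    (E.coendIncl_injective b) fun C hC => Coend.isClosed_iff.2 fun V => ?_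
  have hb : IsClosed (E.proj V ⁻¹' {b}) := isClosed_singleton.preimage (E.proj V).continuous
  have hcl : IsClosedEmbedding fun z : (E.proj V ⁻¹' {b} : Set (P.obj (.op V))) × ψ.obj V =>
      (z.1.1, z.2) := hb.isClosedEmbedding_subtypeVal.prodMap IsClosedEmbedding.id
  have hc : Continuous fun z : (E.proj V ⁻¹' {b} : Set (P.obj (.op V))) × ψ.obj V =>
      ψ.map (E.chart b V z.1).hom z.2 :=
    continuous_eval.comp (((hψ _ _).comp ((E.chart b V).continuous.comp continuous_fst)).prodMk
      continuous_snd)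
  convert hcl.isClosedMap _ (hC.preimage hc) using 1
  ext ⟨x, y⟩
  constructor
  · rintro ⟨y', hy', h⟩
    have hx : E.proj V x = b := by
      rw [← E.coendProj_mk x y, ← h, E.coendProj_coendIncl]
    obtain ⟨g, rfl⟩ : ∃ g, E.incl b V g = x := hx ▸ E.exists_incl x
    refine ⟨(⟨_, hx⟩, y), ?_, rfl⟩
    change ψ.map (E.chart b V ⟨_, hx⟩).hom y ∈ C
    rw [E.chart_incl]
    have h1 := E.coendIncl_injective b (h.trans (E.mk_incl b g y))
    exact h1 ▸ hy'
  · rintro ⟨⟨x', y'⟩, hz, h⟩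
    obtain ⟨rfl, rfl⟩ := Prod.mk.inj h
    refine ⟨_, hz, ?_⟩
    rw [← E.mk_incl, E.incl_chart]

theorem exists_isCoendChart [T1Space B] [∀ V : F, LocallyCompactSpace (ψ.obj V)]
    (hψ : ∀ V W : F, Continuous
      (fun g : HomSpace φ V W => ((ψ.map g.hom).hom : C(ψ.obj V, ψ.obj W)))) :
    ∃ chart : ∀ b : B, (E.coendProj ψ ⁻¹' {b} : Set (Coend P ψ)) ≃ₜ ψ.obj (E.fib b),
      E.IsCoendChart ψ chart := by
  have hr : ∀ b, range (E.coendIncl ψ b) = E.coendProj ψ ⁻¹' {b} := fun b =>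
    Subset.antisymm (by rintro _ ⟨y, rfl⟩; exact E.coendProj_coendIncl b y)
      fun z hz => E.exists_coendIncl_eq hz
  refine ⟨fun b => ((E.isClosedEmbedding_coendIncl hψ b).isEmbedding.toHomeomorph.trans
    (Homeomorph.setCongr (hr b))).symm, fun b V x y => ?_⟩
  rw [Homeomorph.symm_apply_eq]
  refine Subtype.ext ?_
  change Coend.mk x.1 y = E.coendIncl ψ b _
  rw [← E.mk_incl, E.incl_chart]

theorem IsCoendChart.coendFamily_incl {E : DiagFamily φ P B}
    {chart : ∀ b : B, (E.coendProj ψ ⁻¹' {b} : Set (Coend P ψ)) ≃ₜ ψ.obj (E.fib b)}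
    (h : E.IsCoendChart ψ chart) (b : B) (y : ψ.obj (E.fib b)) :
    (E.coendFamily ψ chart).incl b y = E.coendIncl ψ b y := by
  have h1 := h b _ ⟨_, E.proj_incl b _ (𝟙 _)⟩ y
  rw [E.chart_incl] at h1
  have h2 : chart b ⟨E.coendIncl ψ b y, E.coendProj_coendIncl b y⟩ = y :=
    h1.trans (ConcreteCategory.congr_hom (ψ.map_id _) y)
  have h3 := (chart b).symm_apply_eq.2 h2.symm
  exact congrArg Subtype.val h3

end DiagFamily

end StratBundle

/-! ### The coend of a principal stratified bundle diagram is a stratified bundle -/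

namespace StratBundle

variable {F : Type u} [SmallCategory F] {φ ψ : F ⥤ TopCat.{u}}

namespace DiagFamily

variable {P : Fᵒᵖ ⥤ TopCat.{u}} {B : Type u} [TopologicalSpace B] {E : DiagFamily φ P B}

/-! ### Local trivializations of the coend. -/

section Trivialization

variable {chart : ∀ b : B, (E.coendProj ψ ⁻¹' {b} : Set (Coend P ψ)) ≃ₜ ψ.obj (E.fib b)}
  {U : Set B} {W : F} {k : ∀ V : F, C(U × HomSpace φ V W, P.obj (.op V))}

/-- The map `U × ψ W → P ⊗ ψ` induced by a trivialization of `P` over `U`. -/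
def coendTriv (k : ∀ V : F, C(U × HomSpace φ V W, P.obj (.op V))) (ψ : F ⥤ TopCat.{u}) :
    C(U × ψ.obj W, Coend P ψ) where
  toFun z := Coend.mk (k W (z.1, ⟨𝟙 W⟩)) z.2
  continuous_toFun := (Coend.continuous_mk W).comp
    (((k W).continuous.comp (continuous_fst.prodMk continuous_const)).prodMk continuous_snd)

theorem IsTrivialization.mk_apply (h : E.IsTrivialization U W k) {V : F} (u : U) (f : V ⟶ W)
    (y : ψ.obj V) : Coend.mk (k V (u, ⟨f⟩)) y = coendTriv k ψ (u, ψ.map f y) := by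
  have h1 := h.map_apply f u (𝟙 W)
  rw [Category.comp_id] at h1
  rw [← h1]
  exact Coend.mk_map _ _ _

theorem IsTrivialization.coendProj_coendTriv (h : E.IsTrivialization U W k)
    (z : U × ψ.obj W) : E.coendProj ψ (coendTriv k ψ z) = z.1 :=
  h.proj_apply _

theorem IsTrivialization.coendTriv_injective (h : E.IsTrivialization U W k) :
    Function.Injective (coendTriv k ψ) := by
  rintro ⟨u, y⟩ ⟨u', y'⟩ hz
  obtain rfl : u = u' := Subtype.ext <| by
    have h1 := congrArg (E.coendProj ψ) hz
    rwa [h.coendProj_coendTriv, h.coendProj_coendTriv] at h1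
  obtain ⟨g, hg⟩ := h.fibre u
  have h2 : ∀ y, coendTriv k ψ (u, y) = E.coendIncl ψ u (ψ.map g.hom y) := fun y => by
    change Coend.mk (k W (u, ⟨𝟙 W⟩)) y = _
    rw [hg, Category.id_comp, E.mk_incl]
  have h3 := E.coendIncl_injective u ((h2 y).symm.trans (hz.trans (h2 y')))
  have h4 : ∀ y, ψ.map g.inv (ψ.map g.hom y) = y := fun y => by
    rw [← ConcreteCategory.comp_apply, ← ψ.map_comp, g.hom_inv_id, ψ.map_id]
    rfl
  rw [← h4 y, h3, h4]

/-- With `U = O ∩ Y`, the image of a closed set becomes closed in the coend after adding everything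
over the complement of `O`, and this does not change its trace over `U`. Locally closed `U` occur
because the bundle over the closed `skel 0` is trivialized over sets open in `skel 0`. -/
theorem IsTrivialization.isEmbedding_coendTriv (h : E.IsTrivialization U W k)
    [∀ V : F, LocallyCompactSpace (ψ.obj V)]
    (hψ : ∀ V W : F, Continuous
      (fun g : HomSpace φ V W => ((ψ.map g.hom).hom : C(ψ.obj V, ψ.obj W))))
    (hU : IsLocallyClosed U) : IsEmbedding (coendTriv k ψ) := by
  obtain ⟨O, Y, hO, hY, rfl⟩ := hU
  have key : ∀ C : Set ((O ∩ Y : Set B) × ψ.obj W), IsClosed C →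
      IsClosed (coendTriv k ψ '' C ∪ E.coendProj ψ ⁻¹' Oᶜ) := by
    refine fun C hC => Coend.isClosed_iff.2 fun V => ?_
    have hc : Continuous fun z : ((O ∩ Y : Set B) × HomSpace φ V W) × ψ.obj V =>
        (z.1.1, ψ.map z.1.2.hom z.2) :=
      (continuous_fst.comp continuous_fst).prodMk (continuous_eval.comp
        (((hψ V W).comp (continuous_snd.comp continuous_fst)).prodMk continuous_snd))
    -- The closed condition lives on the trivialized part of `P V × ψ V`; it is the trace of a
    -- closed `G` of the whole product, since `k V` is an embedding.
    obtain ⟨G, hG, hGC⟩ := ((h.isEmbedding V).prodMap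
      (IsEmbedding.id (X := ψ.obj V))).isInducing.isClosed_iff.1 (hC.preimage hc)
    have hp : Continuous fun z : P.obj (.op V) × ψ.obj V => E.proj V z.1 :=
      (E.proj V).continuous.comp continuous_fst
    convert (hO.isClosed_compl.preimage hp).union (hG.inter (hY.preimage hp)) using 1
    ext ⟨x, y⟩
    by_cases hxO : E.proj V x ∈ O
    · by_cases hxY : E.proj V x ∈ Y
      · obtain ⟨f, hf⟩ := h.exists_eq (x := x) ⟨hxO, hxY⟩
        have h1 : Coend.mk x y ∈ coendTriv k ψ '' C ↔ (x, y) ∈ G := by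
          have h2 := Set.ext_iff.1 hGC ((⟨_, hxO, hxY⟩, ⟨f⟩), y)
          rw [← hf, h.mk_apply, h.coendTriv_injective.mem_set_image]
          rw [hf]
          refine Iff.trans h2.symm ?_
          change (k V (⟨_, hxO, hxY⟩, ⟨f⟩), y) ∈ G ↔ _
          rw [hf]
        have h3 : Coend.mk x y ∉ E.coendProj ψ ⁻¹' Oᶜ := fun h => h hxO
        exact ⟨fun h4 => Or.inr ⟨h1.1 (h4.resolve_right h3), hxY⟩,
          fun h4 => Or.inl (h1.2 (h4.resolve_left fun h5 => h5 hxO).1)⟩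
      · have h1 : Coend.mk x y ∉ coendTriv k ψ '' C := by
          rintro ⟨z, -, hz⟩
          have h2 := h.coendProj_coendTriv z
          rw [hz, E.coendProj_mk] at h2
          exact hxY (h2 ▸ z.1.2.2)
        have h3 : Coend.mk x y ∉ E.coendProj ψ ⁻¹' Oᶜ := fun h => h hxO
        exact ⟨fun h4 => (h4.elim h1 h3).elim,
          fun h4 => h4.elim (fun h5 => (h5 hxO).elim) fun h5 => (hxY h5.2).elim⟩
    · exact ⟨fun _ => Or.inl hxO, fun _ => Or.inr hxO⟩
  refine ⟨⟨le_antisymm (ContinuousMap.continuous _).le_induced fun C hC => ?_⟩,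
    h.coendTriv_injective⟩
  refine isOpen_induced_iff.2 ⟨_, (key Cᶜ (IsOpen.isClosed_compl hC)).isOpen_compl, ?_⟩
  ext z
  have h1 : coendTriv k ψ z ∉ E.coendProj ψ ⁻¹' Oᶜ := fun hz => hz <| by
    rw [h.coendProj_coendTriv]
    exact z.1.2.1
  change ¬ (coendTriv k ψ z ∈ coendTriv k ψ '' Cᶜ ∨ _) ↔ _
  rw [h.coendTriv_injective.mem_set_image]
  exact ⟨fun h2 => by_contra fun h3 => h2 (Or.inl h3), fun h2 h3 => h3.elim (· h2) h1⟩

theorem IsTrivialization.coend (h : E.IsTrivialization U W k)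
    [∀ V : F, LocallyCompactSpace (ψ.obj V)]
    (hψ : ∀ V W : F, Continuous
      (fun g : HomSpace φ V W => ((ψ.map g.hom).hom : C(ψ.obj V, ψ.obj W))))
    (hU : IsLocallyClosed U) (hchart : E.IsCoendChart ψ chart) :
    (E.coendFamily ψ chart).IsTrivialization U W (coendTriv k ψ) where
  isEmbedding := h.isEmbedding_coendTriv hψ hU
  fibre u := by
    obtain ⟨g, hg⟩ := h.fibre u
    refine ⟨g.hom, g.inv, fun y => ?_, ?_, ?_⟩
    · refine Eq.trans ?_ (hchart.coendFamily_incl u _).symm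
      change Coend.mk (k W (u, ⟨𝟙 W⟩)) y = _
      rw [hg, Category.id_comp, E.mk_incl]
      rfl
    · exact (ψ.map_comp _ _).symm.trans ((congrArg ψ.map g.hom_inv_id).trans (ψ.map_id _))
    · exact (ψ.map_comp _ _).symm.trans ((congrArg ψ.map g.inv_hom_id).trans (ψ.map_id _))

theorem IsBundle.coend (h : E.IsBundle) [∀ V : F, LocallyCompactSpace (ψ.obj V)]
    (hψ : ∀ V W : F, Continuous
      (fun g : HomSpace φ V W => ((ψ.map g.hom).hom : C(ψ.obj V, ψ.obj W))))
    (hchart : E.IsCoendChart ψ chart) : (E.coendFamily ψ chart).IsBundle := by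
  rw [Family.isBundle_iff]
  intro b
  obtain ⟨U, hU, hb, W, k, hk⟩ := E.isBundle_iff.1 h b
  exact ⟨U, hU, hb, W, _, hk.coend hψ hU.isLocallyClosed hchart⟩

theorem IsBundle.coend_restrict {Y : Set B} (h : (E.restrict Y).IsBundle) (hY : IsClosed Y)
    [∀ V : F, LocallyCompactSpace (ψ.obj V)]
    (hψ : ∀ V W : F, Continuous
      (fun g : HomSpace φ V W => ((ψ.map g.hom).hom : C(ψ.obj V, ψ.obj W))))
    (hchart : E.IsCoendChart ψ chart) : ((E.coendFamily ψ chart).restrict Y).IsBundle := by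
  rw [Family.isBundle_restrict_iff]
  intro b hb
  obtain ⟨U, hU, hbU, W, k, hk⟩ := (E.isBundle_restrict_iff Y).1 h b hb
  exact ⟨U, hU, hbU, W, _, hk.coend hψ ⟨U, Y, hU, hY, rfl⟩ hchart⟩

end Trivialization

/-! ### Maps of coends induced by maps of diagrams. -/

section Map

variable {M : Type u} [TopologicalSpace M] {Q : Fᵒᵖ ⥤ TopCat.{u}} {N : DiagFamily φ Q M}
  {U : Set B}

/-- The map of coends induced by a map of diagrams into the part of `E` over `U`. -/
def coendMap (ψ : F ⥤ TopCat.{u}) (f : Q ⟶ E.part U) :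
    C(Coend Q ψ, (E.coendProj ψ ⁻¹' U : Set (Coend P ψ))) where
  toFun := Quot.lift (fun z => ⟨Coend.mk (f.app (.op z.1) z.2.1).1 z.2.2,
    (f.app (.op z.1) z.2.1).2⟩) (by
      rintro _ _ ⟨α, x, y⟩
      refine Subtype.ext ?_
      have h := congrArg Subtype.val (ConcreteCategory.congr_hom (f.naturality α.op) x)
      exact (congrArg (fun x' => Coend.mk x' y) h).trans (Coend.mk_map _ _ _))
  continuous_toFun := by
    refine continuous_quot_lift _ (continuous_sigma fun V => Continuous.subtype_mk ?_ _)
    exact (Coend.continuous_mk V).comp ((continuous_subtype_val.comp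
      ((f.app (.op V)).hom.continuous.comp continuous_fst)).prodMk continuous_snd)

variable {chart : ∀ b : B, (E.coendProj ψ ⁻¹' {b} : Set (Coend P ψ)) ≃ₜ ψ.obj (E.fib b)}
  {chart' : ∀ b : M, (N.coendProj ψ ⁻¹' {b} : Set (Coend Q ψ)) ≃ₜ ψ.obj (N.fib b)}

theorem coendMap_incl (hchart : E.IsCoendChart ψ chart) (hchart' : N.IsCoendChart ψ chart')
    {f : Q ⟶ E.part U} {m : M} {c : U} {g : N.fib m ⟶ E.fib c}
    (hg : ∀ (V : F) (y : V ⟶ N.fib m), f.app (.op V) (N.incl m V y) =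
      (E.restrict U).incl c V (y ≫ g)) (y : ψ.obj (N.fib m)) :
    coendMap ψ f ((N.coendFamily ψ chart').incl m y) =
      ((E.coendFamily ψ chart).restrict U).incl c (ψ.map g y) := by
  refine Subtype.ext ?_
  refine Eq.trans ?_ (hchart.coendFamily_incl _ _).symm
  rw [hchart'.coendFamily_incl]
  exact (congrArg (fun x => Coend.mk x.1 y) (hg _ (𝟙 _))).trans
    ((E.mk_incl (c : B) (𝟙 _ ≫ g) y).trans
      (congrArg (fun g' => E.coendIncl ψ c (ψ.map g' y)) (Category.id_comp g)))

theorem IsMap.coend {f : Q ⟶ E.part U} {fbar : C(M, U)} (h : N.IsMap (E.restrict U) f fbar)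
    (hchart : E.IsCoendChart ψ chart) (hchart' : N.IsCoendChart ψ chart') :
    (N.coendFamily ψ chart').IsMap ((E.coendFamily ψ chart).restrict U) (coendMap ψ f) fbar where
  comm z := by
    obtain ⟨V, x, y, rfl⟩ := Coend.exists_mk z
    exact h.comm V x
  fibre m := by
    obtain ⟨g, hg⟩ := h.fibre m
    exact ⟨g, coendMap_incl hchart hchart' hg⟩

theorem IsFibreIso.coend {f : Q ⟶ E.part U} {fbar : C(M, U)} {m : M}
    (h : N.IsFibreIso (E.restrict U) f fbar m)
    (hchart : E.IsCoendChart ψ chart) (hchart' : N.IsCoendChart ψ chart') :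
    (N.coendFamily ψ chart').IsFibreIso ((E.coendFamily ψ chart).restrict U) (coendMap ψ f)
      fbar m := by
  obtain ⟨g, hg⟩ := h
  refine ⟨g.hom, g.inv, coendMap_incl hchart hchart' hg, ?_, ?_⟩
  · exact (ψ.map_comp _ _).symm.trans ((congrArg ψ.map g.hom_inv_id).trans (ψ.map_id _))
  · exact (ψ.map_comp _ _).symm.trans ((congrArg ψ.map g.inv_hom_id).trans (ψ.map_id _))

end Map

/-! ### Colimits and push-outs of coends. -/

section Stratified

variable {S : StratifiedSpace B}

theorem IsPrincipalStratifiedBundle.isCoherentWith_coend (hE : E.IsPrincipalStratifiedBundle S)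
    [∀ V : F, LocallyCompactSpace (ψ.obj V)] :
    IsCoherentWith (range fun i => E.coendProj ψ ⁻¹' S.skel i) := by
  refine IsCoherentWith.of_isClosed fun s hs => Coend.isClosed_iff.2 fun V => ?_
  refine isClosed_prod_of_jointly
    (Z := fun i => (E.proj V ⁻¹' S.skel i : Set (P.obj (.op V)))) (f := fun _ => Subtype.val)
    (fun x => ?_) (fun t ht => ?_) fun i => ?_
  · obtain ⟨n, hn⟩ := S.exists_mem_skel (E.proj V x)
    exact ⟨n, ⟨x, hn⟩, rfl⟩
  · refine (hE.2.1 V).isClosed_iff.2 ?_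
    rintro _ ⟨i, rfl⟩
    exact ht i
  · exact (hs _ ⟨i, rfl⟩).preimage (f := fun z : (E.proj V ⁻¹' S.skel i : Set _) × ψ.obj V =>
      (⟨Coend.mk z.1.1 z.2, z.1.2⟩ : (E.coendProj ψ ⁻¹' S.skel i : Set (Coend P ψ))))
      (Continuous.subtype_mk ((Coend.continuous_mk V).comp
        ((continuous_subtype_val.comp continuous_fst).prodMk continuous_snd)) _)

/-- Closedness in the coend is tested on each product with `ψ V`, and by `isClosed_prod_of_jointly`
the push-out description of `P V` over `skel (i + 1)` survives this product. -/
theorem isClosed_coend_of_isPushout [∀ V : F, LocallyCompactSpace (ψ.obj V)] {i : ℕ}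
    {Q : Fᵒᵖ ⥤ TopCat.{u}} {N : DiagFamily φ Q (S.M i)} {h : N.part (S.A i) ⟶ E.part (S.skel i)}
    {Φ : Q ⟶ E.part (S.skel (i + 1))}
    (hpush : ∀ V : F, IsPushout (N.partVal (S.A i) V) (h.app (.op V)) (Φ.app (.op V))
      (E.partIncl (S.skel_subset i) V))
    {s : Set (E.coendProj ψ ⁻¹' S.skel (i + 1) : Set (Coend P ψ))}
    (hs : IsClosed (coendMap ψ Φ ⁻¹' s))
    (hs' : IsClosed (inclusion (preimage_mono (f := E.coendProj ψ) (S.skel_subset i)) ⁻¹' s)) :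
    IsClosed s := by
  have hcl : IsClosed (E.coendProj ψ ⁻¹' S.skel (i + 1)) :=
    (S.isClosed_skel _).preimage (E.coendProj ψ).continuous
  refine hcl.isClosedEmbedding_subtypeVal.isClosed_iff_image_isClosed.2
    (Coend.isClosed_iff.2 fun V => ?_)
  let p : (E.proj V ⁻¹' S.skel (i + 1) : Set (P.obj (.op V))) × ψ.obj V →
      (E.coendProj ψ ⁻¹' S.skel (i + 1) : Set (Coend P ψ)) := fun z => ⟨Coend.mk z.1.1 z.2, z.1.2⟩
  let p' : (E.proj V ⁻¹' S.skel i : Set (P.obj (.op V))) × ψ.obj V →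
      (E.coendProj ψ ⁻¹' S.skel i : Set (Coend P ψ)) := fun z => ⟨Coend.mk z.1.1 z.2, z.1.2⟩
  have hp' : Continuous p' := Continuous.subtype_mk ((Coend.continuous_mk V).comp
    ((continuous_subtype_val.comp continuous_fst).prodMk continuous_snd)) _
  have hatt := (hpush V).isAttaching (M := Q.obj (.op V)) (Y := TopCat.of _) (Z := TopCat.of _)
    (f := (h.app (.op V)).hom) (g := (Φ.app (.op V)).hom)
  have hps : IsClosed (p ⁻¹' s) := by
    refine isClosed_prod_of_jointly (ι := Bool)
      (Z := fun b => ((bif b then Q.obj (.op V) else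
        TopCat.of (E.proj V ⁻¹' S.skel i : Set (P.obj (.op V))) : TopCat.{u}) : Type u))
      (f := fun b => match b with
        | true => (Φ.app (.op V)).hom
        | false => inclusion (preimage_mono (S.skel_subset i))) (fun x => ?_) (fun t ht => ?_) ?_
    · rcases hatt.surj x with ⟨y, hy⟩ | ⟨m, -, hm⟩
      · exact ⟨false, y, hy⟩
      · exact ⟨true, m, hm⟩
    · exact hatt.isClosed t (ht true) (ht false)
    · rintro (_ | _)
      · exact hs'.preimage hp'
      · exact hs.preimage (Coend.continuous_mk V)
  have hclV : IsClosedEmbedding fun z : (E.proj V ⁻¹' S.skel (i + 1) : Set (P.obj (.op V))) ×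
      ψ.obj V => (z.1.1, z.2) :=
    (((S.isClosed_skel (i + 1)).preimage (E.proj V).continuous).isClosedEmbedding_subtypeVal).prodMap
      IsClosedEmbedding.id
  convert hclV.isClosedMap _ hps using 1
  ext ⟨x, y⟩
  constructor
  · rintro ⟨z, hz, hzx⟩
    have hx : E.coendProj ψ (Coend.mk x y) ∈ S.skel (i + 1) := hzx ▸ z.2
    refine ⟨(⟨x, hx⟩, y), ?_, rfl⟩
    have h1 : z = p (⟨x, hx⟩, y) := Subtype.ext hzx
    have h2 : p (⟨x, hx⟩, y) ∈ s := h1 ▸ hz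
    exact h2
  · rintro ⟨⟨x', y'⟩, hz, hzx⟩
    obtain ⟨rfl, rfl⟩ := Prod.mk.inj hzx
    exact ⟨_, hz, rfl⟩

theorem IsPrincipalStratifiedBundle.coend (hE : E.IsPrincipalStratifiedBundle S)
    [∀ V : F, LocallyCompactSpace (ψ.obj V)]
    (hψ : ∀ V W : F, Continuous
      (fun g : HomSpace φ V W => ((ψ.map g.hom).hom : C(ψ.obj V, ψ.obj W))))
    {chart : ∀ b : B, (E.coendProj ψ ⁻¹' {b} : Set (Coend P ψ)) ≃ₜ ψ.obj (E.fib b)}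
    (hchart : E.IsCoendChart ψ chart) : (E.coendFamily ψ chart).IsStratifiedBundle S := by
  refine ⟨hE.1.coend_restrict (S.isClosed_skel 0) hψ hchart, hE.isCoherentWith_coend,
    fun i => ?_⟩
  obtain ⟨Q, N, h, Φ, hN, -, hΦ, hpush, hiso⟩ := hE.2.2 i
  -- Points of the Hausdorff space `M i` are closed, so the coend of `N` has charts.
  have := (S.cwPair i).1
  obtain ⟨chart', hchart'⟩ := N.exists_isCoendChart (ψ := ψ) hψ
  obtain ⟨η, hη, hη'⟩ := Family.exists_isPushout (T := TopCat.of (Coend Q ψ))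
    (N := N.coendFamily ψ chart') (hΦ.coend hchart hchart')
    (fun m hm => (hiso m hm).coend hchart hchart') fun s hs hs' =>
      isClosed_coend_of_isPushout hpush hs hs'
  exact ⟨_, _, η, _, hN.coend hψ hchart', hη, hΦ.coend hchart hchart', hη',
    fun m hm => (hiso m hm).coend hchart hchart'⟩

end Stratified

end DiagFamily

end StratBundle

/-! ### The evaluation map -/

namespace StratBundle

variable {F : Type u} [SmallCategory F] {φ : F ⥤ TopCat.{u}} [φ.Faithful]
  [∀ V : F, Nonempty (φ.obj V)]

namespace Family

variable {X B X' B' : Type u} [TopologicalSpace X] [TopologicalSpace B] [TopologicalSpace X']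
  [TopologicalSpace B'] [∀ V : F, LocallyCompactSpace (φ.obj V)]

theorem evalMap_coendIncl (E : Family φ X B) (b : B) (y : φ.obj (E.fib b)) :
    E.evalMap (E.assoc.coendIncl φ b y) = E.incl b y := by
  change E.incl b (φ.map (𝟙 _) y) = E.incl b y
  rw [φ.map_id]
  rfl

theorem proj_evalMap (E : Family φ X B) (z : Coend E.assocDiag φ) :
    E.proj (E.evalMap z) = E.assoc.coendProj φ z := by
  obtain ⟨V, a, y, rfl⟩ := Coend.exists_mk z
  exact E.mapSpaceProj_eq a y

/-- On the fibre over `b`, both sides are parametrized by `φ (E.fib b)`, and evaluation is the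
identity in these parameters. -/
theorem bijective_evalMap (E : Family φ X B) : Function.Bijective E.evalMap := by
  constructor
  · intro z z' h
    obtain ⟨b, hb⟩ : ∃ b, E.assoc.coendProj φ z = b := ⟨_, rfl⟩
    have h1 := E.proj_evalMap z'
    rw [← h, E.proj_evalMap, hb] at h1
    obtain ⟨y, rfl⟩ := E.assoc.exists_coendIncl_eq hb
    obtain ⟨y', rfl⟩ := E.assoc.exists_coendIncl_eq h1.symm
    have h2 := (E.evalMap_coendIncl b y).symm.trans (h.trans (E.evalMap_coendIncl b y'))
    exact congrArg (E.assoc.coendIncl φ b) (E.incl_injective b h2)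
  · intro x
    obtain ⟨y, hy⟩ := E.exists_incl x
    exact ⟨_, (E.evalMap_coendIncl _ y).trans hy⟩

/-- In a trivialization `k` the inverse of evaluation has the explicit continuous form `(u, y) ↦ [f
∘ k(u, ·), y]`: the identity of `W` gives the tautological `F`-map into the fibre. -/
theorem IsBundle.continuous_evalMap_symm {N : Family φ X' B'} {E : Family φ X B} {f : C(X', X)}
    {fbar : C(B', B)} (hN : N.IsBundle) (hf : N.IsMap E f fbar) :
    Continuous ((Equiv.ofBijective _ E.bijective_evalMap).symm ∘ f) := by
  refine hN.continuous_of_comp fun U W k hk => ?_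
  have h : ∀ z : U × φ.obj W, (Equiv.ofBijective _ E.bijective_evalMap).symm (f (k z)) =
      Coend.mk (P := E.assocDiag) (mapSpaceMap hf W (hk.mapSpace W (z.1, ⟨𝟙 W⟩))) z.2 := by
    intro z
    rw [Equiv.symm_apply_eq]
    change f (k z) = f (k (z.1, φ.map (𝟙 W) z.2))
    rw [φ.map_id]
    rfl
  refine Continuous.congr ?_ fun z => (h z).symm
  exact (Coend.continuous_mk (P := E.assocDiag) W).comp
    (((mapSpaceMap hf W).continuous.comp ((hk.mapSpace W).continuous.comp
      (continuous_fst.prodMk continuous_const))).prodMk continuous_snd)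

/-- The topology of `X` is detected on `X_0` and on the attached bundles, where the inverse is
continuous. -/
theorem IsStratifiedBundle.exists_homeomorph {S : StratifiedSpace B} {E : Family φ X B}
    (hE : E.IsStratifiedBundle S) : ∃ e : Coend E.assocDiag φ ≃ₜ X, ∀ z, e z = E.evalMap z := by
  have D := fun i => (hE.nonempty_attachedBundle i).some
  refine ⟨⟨Equiv.ofBijective _ E.bijective_evalMap, E.evalMap.continuous, ?_⟩, fun _ => rfl⟩
  refine continuous_iff_isClosed.2 fun s hs => hE.isClosed D ?_ fun k => ?_
  · exact hs.preimage (hE.1.continuous_evalMap_symm (E.isMap_restrict (S.skel 0)))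
  · exact hs.preimage ((D k).isBundle.continuous_evalMap_symm (D k).isMap_map)

theorem isIso_of_eq_evalMap {E : Family φ X B}
    {chart : ∀ b : B, (E.assoc.coendProj φ ⁻¹' {b} : Set (Coend E.assocDiag φ)) ≃ₜ φ.obj (E.fib b)}
    (hchart : E.assoc.IsCoendChart φ chart) {e : Coend E.assocDiag φ ≃ₜ X}
    (he : ∀ z, e z = E.evalMap z) :
    (E.assoc.coendFamily φ chart).IsIso E e (Homeomorph.refl B) := by
  have hincl : ∀ b (y : φ.obj (E.fib b)),
      e ((E.assoc.coendFamily φ chart).incl b y) = E.incl b y := fun b y => by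
    rw [he]
    exact (congrArg E.evalMap (hchart.coendFamily_incl b y)).trans (E.evalMap_coendIncl b y)
  have hid : ∀ (V : F) (y : φ.obj V), φ.map (𝟙 V) y = y := fun V y =>
    ConcreteCategory.congr_hom (φ.map_id V) y
  refine ⟨⟨fun z => ?_, fun b => ⟨𝟙 (E.fib b), fun y => ?_⟩⟩,
    ⟨fun x => ?_, fun b => ⟨𝟙 (E.fib b), fun y => ?_⟩⟩⟩
  · exact (congrArg E.proj (he z)).trans (E.proj_evalMap z)
  · exact (hincl b y).trans (congrArg (E.incl b) (hid _ y).symm)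
  · obtain ⟨z, rfl⟩ := e.surjective x
    refine (congrArg (E.assoc.coendProj φ) (e.symm_apply_apply z)).trans ?_
    exact ((congrArg E.proj (he z)).trans (E.proj_evalMap z)).symm
  · refine (e.symm_apply_eq).2 ?_
    exact ((hincl b _).trans (congrArg (E.incl b) (hid _ y))).symm

end Family

end StratBundle

theorem mainTheorem4 {F : Type u} [SmallCategory F] (φ : F ⥤ TopCat.{u}) (hφ : IsFibreFunctor φ)
    [φ.Faithful] [∀ V : F, Nonempty (φ.obj V)] :
    (IsNKC φ → ∀ {X B : Type u} [TopologicalSpace X] [TopologicalSpace B]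
      (S : StratifiedSpace B) (E : Family φ X B), E.IsStratifiedBundle S →
        (∀ V : F, IsFibreFunctor (homFunctor φ V)) ∧
        E.assoc.IsPrincipalStratifiedBundle S ∧
        ∃ (chart : ∀ b : B,
            (E.assoc.coendProj φ ⁻¹' {b} : Set (Coend E.assocDiag φ)) ≃ₜ φ.obj (E.fib b))
          (e : Coend E.assocDiag φ ≃ₜ X),
          E.assoc.IsCoendChart φ chart ∧
          (E.assoc.coendFamily φ chart).IsStratifiedBundle S ∧
          (∀ (V : F) (a : E.MapSpace V) (y : φ.obj V),
            e (Coend.mk (P := E.assocDiag) a y) = a.1 y) ∧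
          (E.assoc.coendFamily φ chart).IsIso E e (Homeomorph.refl B)) ∧
    (∀ ψ : F ⥤ TopCat.{u}, IsFibreFunctor ψ →
      (∀ V W : F, Continuous
        (fun g : HomSpace φ V W => ((ψ.map g.hom).hom : C(ψ.obj V, ψ.obj W)))) →
      ∀ {P : Fᵒᵖ ⥤ TopCat.{u}} {B : Type u} [TopologicalSpace B]
        (S : StratifiedSpace B) (E : DiagFamily φ P B), E.IsPrincipalStratifiedBundle S →
        ∃ chart : ∀ b : B, (E.coendProj ψ ⁻¹' {b} : Set (Coend P ψ)) ≃ₜ ψ.obj (E.fib b),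
          E.IsCoendChart ψ chart ∧
          (E.coendFamily ψ chart).IsStratifiedBundle S) := by
  refine ⟨fun h X B _ _ S E hE => ?_, fun ψ hψ hc P B _ S E hE => ?_⟩
  · have := hφ.locallyCompact
    have := S.t1Space
    obtain ⟨chart, hchart⟩ := E.assoc.exists_isCoendChart (continuous_hom_map φ)
    obtain ⟨e, he⟩ := hE.exists_homeomorph
    exact ⟨h.isFibreFunctor_homFunctor hφ, hE.assoc h hφ, chart, e, hchart,
      (hE.assoc h hφ).coend (continuous_hom_map φ) hchart, fun V a y => he _,
      Family.isIso_of_eq_evalMap hchart he⟩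
  · have := hψ.locallyCompact
    have := S.t1Space
    obtain ⟨chart, hchart⟩ := E.exists_isCoendChart (ψ := ψ) hc
    exact ⟨chart, hchart, hE.coend hc hchart⟩
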